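/- Let $(\mathcal M,\otimes,I,\sigma)$ be a symmetric strict monoidal 2-category. Write juxtaposition for $\otimes$, $g.f$ for horizontal composition and $b\cdot a$ for vertical composition. Assume the following. (i) $\mathcal M$ admits Eilenberg--Moore construction, i.e. the inclusion 2-functor $\mathcal M\to\mathsf{Mnd}(\mathcal M)$ has a right 2-adjoint. Its value at a monad $(A,t)$ is denoted by $A^t$, with the canonical adjunction $f^t\dashv u^t:A^t\to A$, which generates the monad $t$, and its counit $\epsilon^t:f^t.u^t\to 1$. (ii) This Eilenberg--Moore construction is monoidal: the canonical comparison 1-cells $I\to I^1$ and $A^tB^s\to (AB)^{ts}$ are identities, for all monads $(A,t)$ and $(B,s)$. (iii) For every 1-cell $(h,\chi)$ from $(A,t)$ to $(B,s)$ in $\mathsf{Mnd}_{\mathsf{op}}(\mathcal M)=\mathsf{Mnd}(\mathcal M_{\mathsf{op}})_{\mathsf{op}}$ (that is, a 1-cell $h:A\to B$ with a 2-cell $\chi:h.t\to s.h$ compatible with the multiplications and units), the parallel 2-cells $$f^s.h.u^t.\epsilon^t\quad\text{and}\quad(\epsilon^s.f^s.h.u^t)\cdot(f^s.\chi.u^t)\;:\;f^s.h.t.u^t\longrightarrow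 f^s.h.u^t$$ have a coequalizer $\pi(h,\chi):f^s.h.u^t\to \mathsf V(h,\chi)$ in $\mathcal M(A^t,B^s)$, and it is preserved by horizontal composition on either side with any 1-cell. For $p\ge 0$ let $\mathcal M_{p0}$ be the symmetric strict monoidal 2-category obtained by applying $p$ times the construction $\mathcal M\mapsto\mathcal M_{10}$ (0-cells: pseudomonoids in $\mathcal M$; 1-cells: monoidal 1-cells $(f,\varphi_2:m'.ff\to f.m,\varphi_0:u'\to f.u)$; 2-cells: monoidal 2-cells). A $p$-oidal object of $\mathcal M$ is a 0-cell of $\mathcal M_{p0}$, and a $(p,0)$-oidal monad is a monad in $\mathcal M_{p0}$. Call a 1-cell of $\mathcal M_{p0}$ strong (respectively, strict) if the binary and nullary parts of all of its $p$ monoidal structures are invertible (respectively, identity 2-cells). Then for every $p\ge 0$ and every $(p,0)$-oidal monad $(A,t)$, the $p$-oidal structure of $A$ lifts to $A^t$ along $f^t:A\to A^t$, in the following sense. (a) There are a $p$-oidal object $B$ whose underlying 0-cell is $A^t$ and a strong 1-cell $F:A\to B$ of $\mathcal M_{p0}$ whose underlying 1-cell is $f^t$, such that $\epsilon^t.f^t:f^t.t\to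 f^t$ underlies a 2-cell $F.t\to F$ of $\mathcal M_{p0}$. (So each structure 1-cell $h$ of $A$ is lifted to a structure 1-cell $\overline h$ of $B$, up to the coherent invertible 2-cells $\overline h.f\cong f.h$ constituting $F$, where $f$ stands for the relevant left adjoints.) (b) If the coequalizers in (iii) can be chosen so that the equality of 2-cells $$\pi(h,\chi).f^t=(\epsilon^s.f^s.h)\cdot (f^s.\chi)$$ holds for every $(h,\chi)$ (in particular $\mathsf V(h,\chi).f^t=f^s.h$), then $B$ and $F$ in (a) can be chosen with $F$ strict. (So the structure 1-cells of $B$ are literally liftings: $\overline h.f=f.h$.) This generalizes Theorem 7.1 of Aguiar, Haim and López Franco. -/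

import Mathlib

universe u

set_option linter.unusedSimpArgs false
set_option linter.unusedTactic false

/-- A (strict) 2-category: 0-cells `Ob`, 1-cells `Ar`, 2-cells `Ce` with sources and targets,
where `comp g f` is the composite `g.f`, `hc b a` the horizontal composite `b.a` and `vc b a` the
vertical composite `b ∙ a`.  The compositions are only constrained on composable pairs. -/
structure TwoCat where
  /-- 0-cells -/
  Ob : Type u
  /-- 1-cells -/
  Ar : Type u
  /-- 2-cells -/
  Ce : Type u
  /-- domain of a 1-cell -/
  dom : Ar → Ob
  /-- codomain of a 1-cell -/
  cod : Ar → Ob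
  /-- source of a 2-cell -/
  src : Ce → Ar
  /-- target of a 2-cell -/
  tgt : Ce → Ar
  /-- identity 1-cells -/
  one : Ob → Ar
  /-- identity 2-cells -/
  idn : Ar → Ce
  /-- composition of 1-cells -/
  comp : Ar → Ar → Ar
  /-- horizontal composition of 2-cells -/
  hc : Ce → Ce → Ce
  /-- vertical composition of 2-cells -/
  vc : Ce → Ce → Ce
  dom_tgt : ∀ a, dom (tgt a) = dom (src a)
  cod_tgt : ∀ a, cod (tgt a) = cod (src a)
  dom_one : ∀ A, dom (one A) = A
  cod_one : ∀ A, cod (one A) = A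
  src_idn : ∀ f, src (idn f) = f
  tgt_idn : ∀ f, tgt (idn f) = f
  dom_comp : ∀ g f, dom g = cod f → dom (comp g f) = dom f
  cod_comp : ∀ g f, dom g = cod f → cod (comp g f) = cod g
  src_hc : ∀ b a, dom (src b) = cod (src a) → src (hc b a) = comp (src b) (src a)
  tgt_hc : ∀ b a, dom (src b) = cod (src a) → tgt (hc b a) = comp (tgt b) (tgt a)
  src_vc : ∀ b a, src b = tgt a → src (vc b a) = src a
  tgt_vc : ∀ b a, src b = tgt a → tgt (vc b a) = tgt b
  comp_one : ∀ f, comp f (one (dom f)) = f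
  one_comp : ∀ f, comp (one (cod f)) f = f
  comp_assoc : ∀ h g f, dom h = cod g → dom g = cod f →
    comp (comp h g) f = comp h (comp g f)
  vc_idn : ∀ a, vc a (idn (src a)) = a
  idn_vc : ∀ a, vc (idn (tgt a)) a = a
  vc_assoc : ∀ c b a, src c = tgt b → src b = tgt a → vc (vc c b) a = vc c (vc b a)
  hc_one : ∀ a, hc a (idn (one (dom (src a)))) = a
  one_hc : ∀ a, hc (idn (one (cod (src a)))) a = a
  hc_assoc : ∀ c b a, dom (src c) = cod (src b) → dom (src b) = cod (src a) →
    hc (hc c b) a = hc c (hc b a)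
  idn_comp : ∀ g f, dom g = cod f → idn (comp g f) = hc (idn g) (idn f)
  interchange : ∀ b' b a' a, src b' = tgt b → src a' = tgt a → dom (src b) = cod (src a) →
    hc (vc b' b) (vc a' a) = vc (hc b' a') (hc b a)

/-- A symmetric strict monoidal 2-category: a 2-category with a monoidal unit `I`, a strictly
associative and unital 2-functor `⊗` (`t0`, `t1`, `t2` on 0-, 1- and 2-cells) and a 2-natural
symmetry `br A B : A ⊗ B → B ⊗ A`. -/
structure SM2Cat extends TwoCat.{u} where
  /-- the monoidal unit -/
  I : Ob
  /-- monoidal product of 0-cells -/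
  t0 : Ob → Ob → Ob
  /-- monoidal product of 1-cells -/
  t1 : Ar → Ar → Ar
  /-- monoidal product of 2-cells -/
  t2 : Ce → Ce → Ce
  /-- the symmetry -/
  br : Ob → Ob → Ar
  dom_t1 : ∀ f g, dom (t1 f g) = t0 (dom f) (dom g)
  cod_t1 : ∀ f g, cod (t1 f g) = t0 (cod f) (cod g)
  src_t2 : ∀ a b, src (t2 a b) = t1 (src a) (src b)
  tgt_t2 : ∀ a b, tgt (t2 a b) = t1 (tgt a) (tgt b)
  t1_one : ∀ A B, t1 (one A) (one B) = one (t0 A B)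
  t2_idn : ∀ f g, t2 (idn f) (idn g) = idn (t1 f g)
  t1_comp : ∀ g f g' f', dom g = cod f → dom g' = cod f' →
    t1 (comp g f) (comp g' f') = comp (t1 g g') (t1 f f')
  t2_hc : ∀ b a b' a', dom (src b) = cod (src a) → dom (src b') = cod (src a') →
    t2 (hc b a) (hc b' a') = hc (t2 b b') (t2 a a')
  t2_vc : ∀ b a b' a', src b = tgt a → src b' = tgt a' →
    t2 (vc b a) (vc b' a') = vc (t2 b b') (t2 a a')
  t0_assoc : ∀ A B C, t0 (t0 A B) C = t0 A (t0 B C)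
  t1_assoc : ∀ f g h, t1 (t1 f g) h = t1 f (t1 g h)
  t2_assoc : ∀ a b c, t2 (t2 a b) c = t2 a (t2 b c)
  I_t0 : ∀ A, t0 I A = A
  t0_I : ∀ A, t0 A I = A
  I_t1 : ∀ f, t1 (one I) f = f
  t1_I : ∀ f, t1 f (one I) = f
  I_t2 : ∀ a, t2 (idn (one I)) a = a
  t2_I : ∀ a, t2 a (idn (one I)) = a
  dom_br : ∀ A B, dom (br A B) = t0 A B
  cod_br : ∀ A B, cod (br A B) = t0 B A
  br_nat1 : ∀ f g, comp (br (cod f) (cod g)) (t1 f g) = comp (t1 g f) (br (dom f) (dom g))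
  br_nat2 : ∀ a b, hc (idn (br (cod (src a)) (cod (src b)))) (t2 a b) =
    hc (t2 b a) (idn (br (dom (src a)) (dom (src b))))
  br_br : ∀ A B, comp (br B A) (br A B) = one (t0 A B)
  br_t0 : ∀ A B C, br A (t0 B C) = comp (t1 (one B) (br A C)) (t1 (br A B) (one C))

attribute [simp] TwoCat.dom_tgt TwoCat.cod_tgt TwoCat.dom_one TwoCat.cod_one TwoCat.src_idn
  TwoCat.tgt_idn TwoCat.dom_comp TwoCat.cod_comp TwoCat.src_hc TwoCat.tgt_hc TwoCat.src_vc
  TwoCat.tgt_vc SM2Cat.dom_t1 SM2Cat.cod_t1 SM2Cat.src_t2 SM2Cat.tgt_t2 SM2Cat.dom_br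
  SM2Cat.cod_br SM2Cat.t0_assoc SM2Cat.I_t0 SM2Cat.t0_I
  SM2Cat.I_t1 SM2Cat.t1_I SM2Cat.I_t2 SM2Cat.t2_I

namespace SM2Cat

variable (N : SM2Cat.{u})

theorem one_comp_of (f : N.Ar) (A : N.Ob) (h : N.cod f = A) : N.comp (N.one A) f = f := by
  subst h; exact N.one_comp f

theorem comp_one_of (f : N.Ar) (A : N.Ob) (h : N.dom f = A) : N.comp f (N.one A) = f := by
  subst h; exact N.comp_one f

theorem one_hc_of (a : N.Ce) (A : N.Ob) (h : N.cod (N.src a) = A) :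
    N.hc (N.idn (N.one A)) a = a := by
  subst h; exact N.one_hc a

theorem hc_one_of (a : N.Ce) (A : N.Ob) (h : N.dom (N.src a) = A) :
    N.hc a (N.idn (N.one A)) = a := by
  subst h; exact N.hc_one a

theorem vc_idn_of (a : N.Ce) (f : N.Ar) (h : N.src a = f) : N.vc a (N.idn f) = a := by
  subst h; exact N.vc_idn a

theorem idn_vc_of (a : N.Ce) (f : N.Ar) (h : N.tgt a = f) : N.vc (N.idn f) a = a := by
  subst h; exact N.idn_vc a

attribute [simp] one_comp_of comp_one_of one_hc_of hc_one_of vc_idn_of idn_vc_of t1_one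

/-- The middle-four interchange `1 σ 1 : A A' B B' → A B A' B'`. -/
def sh (A A' B B' : N.Ob) : N.Ar := N.t1 (N.one A) (N.t1 (N.br A' B) (N.one B'))

theorem dom_sh (A A' B B' : N.Ob) :
    N.dom (N.sh A A' B B') = N.t0 A (N.t0 A' (N.t0 B B')) := by simp [sh]

theorem cod_sh (A A' B B' : N.Ob) :
    N.cod (N.sh A A' B B') = N.t0 A (N.t0 B (N.t0 A' B')) := by simp [sh]

attribute [simp] dom_sh cod_sh

theorem sh_nat2 (a a' b b' : N.Ce) :
    N.hc (N.idn (N.sh (N.cod (N.src a)) (N.cod (N.src a')) (N.cod (N.src b)) (N.cod (N.src b'))))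
      (N.t2 a (N.t2 a' (N.t2 b b'))) =
    N.hc (N.t2 a (N.t2 b (N.t2 a' b')))
      (N.idn (N.sh (N.dom (N.src a)) (N.dom (N.src a')) (N.dom (N.src b)) (N.dom (N.src b')))) := by
  simp only [sh, ← N.t2_idn]
  rw [← N.t2_assoc a' b b', ← N.t2_assoc b a' b']
  rw [← N.t2_hc, ← N.t2_hc, ← N.t2_hc, ← N.t2_hc, N.br_nat2] <;> simp

theorem sh_nat1 (a a' b b' : N.Ar) :
    N.comp (N.sh (N.cod a) (N.cod a') (N.cod b) (N.cod b'))
      (N.t1 a (N.t1 a' (N.t1 b b'))) =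
    N.comp (N.t1 a (N.t1 b (N.t1 a' b')))
      (N.sh (N.dom a) (N.dom a') (N.dom b) (N.dom b')) := by
  have h := congrArg N.src (N.sh_nat2 (N.idn a) (N.idn a') (N.idn b) (N.idn b'))
  simpa using h

theorem br_I_right (A : N.Ob) : N.br A N.I = N.one A := by
  have h := N.br_t0 A N.I N.I
  rw [N.t1_I, N.I_t1, N.I_t0] at h
  have h2 := congrArg (N.comp (N.br N.I A)) h
  rw [← N.comp_assoc, N.br_br] at h2 <;> simp at h2 ⊢
  exact h2.symm

theorem br_I_left (A : N.Ob) : N.br N.I A = N.one A := by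
  have h := N.br_br A N.I
  rw [N.br_I_right] at h
  simpa using h

/-- Second hexagon. -/
theorem t0_br (A B C : N.Ob) :
    N.br (N.t0 A B) C = N.comp (N.t1 (N.br A C) (N.one B)) (N.t1 (N.one A) (N.br B C)) := by
  have h0 := N.br_t0 C A B
  have e : N.comp (N.comp (N.t1 (N.br A C) (N.one B)) (N.t1 (N.one A) (N.br B C))) (N.br C (N.t0 A B)) = N.one (N.t0 C (N.t0 A B)) := by
    rw [h0, N.comp_assoc, ← N.comp_assoc (N.t1 (N.one A) (N.br B C)), ← N.t1_comp, N.br_br]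
    rotate_left
    all_goals simp
    rw [← N.t1_comp, N.br_br] <;> simp
  have h1 := congrArg (fun x => N.comp x (N.br (N.t0 A B) C)) e
  rw [N.comp_assoc, N.br_br] at h1
  rotate_left
  · simp
  · simp
  simp at h1
  exact h1.symm

theorem sh_I_left (A B : N.Ob) : N.sh N.I N.I A B = N.one (N.t0 A B) := by
  simp [sh, br_I_left]

theorem sh_I_right (A B : N.Ob) : N.sh A B N.I N.I = N.one (N.t0 A B) := by
  simp [sh, br_I_right]

end SM2Cat

namespace SM2Cat
variable (N : SM2Cat.{u})

theorem one_t1_comp (X : N.Ob) (g f : N.Ar) (h : N.dom g = N.cod f) :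
    N.t1 (N.one X) (N.comp g f) = N.comp (N.t1 (N.one X) g) (N.t1 (N.one X) f) := by
  rw [← N.t1_comp] <;> simp [h]

theorem comp_t1_one (X : N.Ob) (g f : N.Ar) (h : N.dom g = N.cod f) :
    N.t1 (N.comp g f) (N.one X) = N.comp (N.t1 g (N.one X)) (N.t1 f (N.one X)) := by
  rw [← N.t1_comp] <;> simp [h]

theorem t1_split (f g : N.Ar) : N.comp (N.t1 f (N.one (N.cod g))) (N.t1 (N.one (N.dom f)) g) = N.t1 f g := by
  rw [← N.t1_comp] <;> simp

theorem t1_split' (f g : N.Ar) : N.comp (N.t1 (N.one (N.cod f)) g) (N.t1 f (N.one (N.dom g))) = N.t1 f g := by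
  rw [← N.t1_comp] <;> simp

theorem one_t1_one_t1 (A B : N.Ob) (f : N.Ar) :
    N.t1 (N.one A) (N.t1 (N.one B) f) = N.t1 (N.one (N.t0 A B)) f := by
  rw [← N.t1_assoc, N.t1_one]

theorem sh_assoc (A A' B B' C C' : N.Ob) :
    N.comp (N.sh (N.t0 A B) (N.t0 A' B') C C') (N.t1 (N.sh A A' B B') (N.one (N.t0 C C'))) =
    N.comp (N.sh A A' (N.t0 B C) (N.t0 B' C')) (N.t1 (N.one (N.t0 A A')) (N.sh B B' C C')) := by
  have e := (N.t1_split (N.br A' B) (N.br B' C)).trans (N.t1_split' _ _).symm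
  have e1 := congrArg (fun x => N.t1 (N.one A) (N.t1 x (N.one C'))) e
  simp [one_t1_comp, comp_t1_one, N.one_t1_one_t1, N.t1_assoc] at e1
  simp [sh, br_t0, t0_br, one_t1_comp, comp_t1_one, N.one_t1_one_t1, N.t1_assoc, N.comp_assoc] at e1 ⊢
  rw [e1]

theorem sh_assoc3 (A A' A'' B B' B'' : N.Ob) :
    N.comp (N.t1 (N.sh A A' B B') (N.one (N.t0 A'' B''))) (N.sh (N.t0 A A') A'' (N.t0 B B') B'') =
    N.comp (N.t1 (N.one (N.t0 A B)) (N.sh A' A'' B' B'')) (N.sh A (N.t0 A' A'') B (N.t0 B' B'')) := by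
  have e := (N.t1_split (N.br A' B) (N.br A'' B')).trans (N.t1_split' _ _).symm
  have e1 := congrArg (fun x => N.t1 (N.one A) (N.t1 x (N.one B''))) e
  simp [one_t1_comp, comp_t1_one, N.one_t1_one_t1, N.t1_assoc] at e1
  simp [sh, br_t0, t0_br, one_t1_comp, comp_t1_one, N.one_t1_one_t1, N.t1_assoc] at e1 ⊢
  rw [← N.comp_assoc, e1, N.comp_assoc] <;> simp

theorem sh_br (A A' B B' : N.Ob) :
    N.comp (N.sh A' A B' B) (N.t1 (N.br A A') (N.br B B')) =
    N.comp (N.br (N.t0 A B) (N.t0 A' B')) (N.sh A A' B B') := by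
  simp [sh, br_t0, t0_br, one_t1_comp, comp_t1_one, N.one_t1_one_t1, N.t1_assoc, N.comp_assoc]
  have e := congrArg (fun x => N.t1 (N.one A) (N.t1 x (N.one B'))) (N.br_br A' B)
  simp [one_t1_comp, comp_t1_one] at e
  have e' := N.t1_split' (N.br A A') (N.br B B')
  simp at e'
  rw [N.comp_assoc, N.comp_assoc, N.comp_assoc, e] <;> simp [e']
end SM2Cat

namespace SM2Cat

/-- Invertible 2-cells. -/
def IsInv (N : TwoCat.{u}) (a : N.Ce) : Prop :=
  ∃ b, N.src b = N.tgt a ∧ N.tgt b = N.src a ∧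
    N.vc b a = N.idn (N.src a) ∧ N.vc a b = N.idn (N.tgt a)

/-- A pseudomonoid (monoidal object). -/
@[ext]
structure Pseudomonoid (N : SM2Cat.{u}) : Type u where
  /-- the underlying 0-cell -/
  A : N.Ob
  /-- multiplication -/
  m : N.Ar
  /-- unit -/
  u : N.Ar
  /-- associativity `m.m1 → m.1m` -/
  α : N.Ce
  /-- left unitality `m.u1 → 1` -/
  l : N.Ce
  /-- right unitality `m.1u → 1` -/
  r : N.Ce
  dom_m : N.dom m = N.t0 A A
  cod_m : N.cod m = A
  dom_u : N.dom u = N.I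
  cod_u : N.cod u = A
  src_α : N.src α = N.comp m (N.t1 m (N.one A))
  tgt_α : N.tgt α = N.comp m (N.t1 (N.one A) m)
  src_l : N.src l = N.comp m (N.t1 u (N.one A))
  tgt_l : N.tgt l = N.one A
  src_r : N.src r = N.comp m (N.t1 (N.one A) u)
  tgt_r : N.tgt r = N.one A
  inv_α : IsInv N.toTwoCat α
  inv_l : IsInv N.toTwoCat l
  inv_r : IsInv N.toTwoCat r
  pentagon :
    N.vc (N.hc (N.idn m) (N.t2 (N.idn (N.one A)) α))
      (N.vc (N.hc α (N.t2 (N.idn (N.one A)) (N.t2 (N.idn m) (N.idn (N.one A)))))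
        (N.hc (N.idn m) (N.t2 α (N.idn (N.one A))))) =
    N.vc (N.hc α (N.t2 (N.idn (N.one A)) (N.t2 (N.idn (N.one A)) (N.idn m))))
      (N.hc α (N.t2 (N.idn m) (N.t2 (N.idn (N.one A)) (N.idn (N.one A)))))
  triangle :
    N.vc (N.hc (N.idn m) (N.t2 (N.idn (N.one A)) l))
      (N.hc α (N.t2 (N.idn (N.one A)) (N.t2 (N.idn u) (N.idn (N.one A))))) =
    N.hc (N.idn m) (N.t2 r (N.idn (N.one A)))

attribute [simp] Pseudomonoid.dom_m Pseudomonoid.cod_m Pseudomonoid.dom_u Pseudomonoid.cod_u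
  Pseudomonoid.src_α Pseudomonoid.tgt_α Pseudomonoid.src_l Pseudomonoid.tgt_l
  Pseudomonoid.src_r Pseudomonoid.tgt_r

variable (N : SM2Cat.{u})

/-- The binary shuffle word: `(p p').sh . ((x x').w ⊗ (y y').v) = (p.xy ⊗ p'.x'y').sh.(w ⊗ v)`. -/
theorem sh_word2 (p p' x x' y y' : N.Ce) (w v : N.Ar)
    (hp : N.dom (N.src p) = N.t0 (N.cod (N.src x)) (N.cod (N.src y)))
    (hp' : N.dom (N.src p') = N.t0 (N.cod (N.src x')) (N.cod (N.src y')))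
    (hw : N.cod w = N.t0 (N.dom (N.src x)) (N.dom (N.src x')))
    (hv : N.cod v = N.t0 (N.dom (N.src y)) (N.dom (N.src y')))
    (A A' B B' : N.Ob) (hA : N.cod (N.src x) = A) (hA' : N.cod (N.src x') = A')
    (hB : N.cod (N.src y) = B) (hB' : N.cod (N.src y') = B') :
    N.hc (N.hc (N.t2 p p') (N.idn (N.sh A A' B B')))
      (N.t2 (N.hc (N.t2 x x') (N.idn w)) (N.hc (N.t2 y y') (N.idn v))) =
    N.hc (N.t2 (N.hc p (N.t2 x y)) (N.hc p' (N.t2 x' y')))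
      (N.idn (N.comp (N.sh (N.dom (N.src x)) (N.dom (N.src x')) (N.dom (N.src y)) (N.dom (N.src y')))
        (N.t1 w v))) := by
  subst hA hA' hB hB'
  rw [N.t2_hc _ _ _ _ _ _, N.t2_hc, N.t2_assoc x x', N.hc_assoc, ← N.hc_assoc (N.idn _), sh_nat2, N.hc_assoc,
    N.idn_comp, N.t2_idn, N.t2_assoc, ← N.hc_assoc (N.t2 p p')] <;> simp [*]

theorem sh_word1 (p p' x x' y y' : N.Ar) (w v : N.Ar)
    (hp : N.dom p = N.t0 (N.cod x) (N.cod y))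
    (hp' : N.dom p' = N.t0 (N.cod x') (N.cod y'))
    (hw : N.cod w = N.t0 (N.dom x) (N.dom x'))
    (hv : N.cod v = N.t0 (N.dom y) (N.dom y'))
    (A A' B B' : N.Ob) (hA : N.cod x = A) (hA' : N.cod x' = A')
    (hB : N.cod y = B) (hB' : N.cod y' = B') :
    N.comp (N.comp (N.t1 p p') (N.sh A A' B B'))
      (N.t1 (N.comp (N.t1 x x') w) (N.comp (N.t1 y y') v)) =
    N.comp (N.t1 (N.comp p (N.t1 x y)) (N.comp p' (N.t1 x' y')))
      (N.comp (N.sh (N.dom x) (N.dom x') (N.dom y) (N.dom y')) (N.t1 w v)) := by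
  have h := congrArg N.src (N.sh_word2 (N.idn p) (N.idn p') (N.idn x) (N.idn x') (N.idn y)
    (N.idn y') w v (by simpa) (by simpa) (by simpa) (by simpa) A A' B B' (by simpa) (by simpa) (by simpa) (by simpa))
  subst hA hA' hB hB'
  simpa [hp, hp', hw, hv] using h

/-- The ternary shuffle `A A' B B' C C' → A B C A' B' C'`. -/
def sh3 (A A' B B' C C' : N.Ob) : N.Ar :=
  N.comp (N.sh (N.t0 A B) (N.t0 A' B') C C') (N.t1 (N.sh A A' B B') (N.one (N.t0 C C')))

theorem dom_sh3 (A A' B B' C C' : N.Ob) :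
    N.dom (N.sh3 A A' B B' C C') = N.t0 A (N.t0 A' (N.t0 B (N.t0 B' (N.t0 C C')))) := by
  simp [sh3]

theorem cod_sh3 (A A' B B' C C' : N.Ob) :
    N.cod (N.sh3 A A' B B' C C') = N.t0 A (N.t0 B (N.t0 C (N.t0 A' (N.t0 B' C')))) := by
  simp [sh3]

attribute [simp] dom_sh3 cod_sh3

theorem t2_hc_left (a b c : N.Ce) (h : N.dom (N.src a) = N.cod (N.src b)) :
    N.t2 (N.hc a b) c = N.hc (N.t2 a (N.idn (N.one (N.cod (N.src c))))) (N.t2 b c) := by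
  rw [← N.t2_hc] <;> simp [h]

theorem t1_comp_left (a b c : N.Ar) (h : N.dom a = N.cod b) :
    N.t1 (N.comp a b) c = N.comp (N.t1 a (N.one (N.cod c))) (N.t1 b c) := by
  rw [← N.t1_comp] <;> simp [h]

theorem sh_word3 (p p' x x' y y' z z' : N.Ce) (w v s : N.Ar)
    (hp : N.dom (N.src p) = N.t0 (N.cod (N.src x)) (N.t0 (N.cod (N.src y)) (N.cod (N.src z))))
    (hp' : N.dom (N.src p') = N.t0 (N.cod (N.src x')) (N.t0 (N.cod (N.src y')) (N.cod (N.src z'))))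
    (hw : N.cod w = N.t0 (N.dom (N.src x)) (N.dom (N.src x')))
    (hv : N.cod v = N.t0 (N.dom (N.src y)) (N.dom (N.src y')))
    (hs : N.cod s = N.t0 (N.dom (N.src z)) (N.dom (N.src z')))
    (A A' B B' C C' : N.Ob) (hA : N.cod (N.src x) = A) (hA' : N.cod (N.src x') = A')
    (hB : N.cod (N.src y) = B) (hB' : N.cod (N.src y') = B')
    (hC : N.cod (N.src z) = C) (hC' : N.cod (N.src z') = C') :
    N.hc (N.hc (N.t2 p p') (N.idn (N.sh3 A A' B B' C C')))
      (N.t2 (N.hc (N.t2 x x') (N.idn w)) (N.t2 (N.hc (N.t2 y y') (N.idn v))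
        (N.hc (N.t2 z z') (N.idn s)))) =
    N.hc (N.t2 (N.hc p (N.t2 x (N.t2 y z))) (N.hc p' (N.t2 x' (N.t2 y' z'))))
      (N.idn (N.comp (N.sh3 (N.dom (N.src x)) (N.dom (N.src x')) (N.dom (N.src y))
        (N.dom (N.src y')) (N.dom (N.src z)) (N.dom (N.src z'))) (N.t1 w (N.t1 v s)))) := by
  subst hA hA' hB hB' hC hC'
  have h1 := N.sh_word2 (N.idn (N.t1 (N.one (N.cod (N.src x))) (N.one (N.cod (N.src y)))))
    (N.idn (N.t1 (N.one (N.cod (N.src x'))) (N.one (N.cod (N.src y')))))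
    x x' y y' w v (by simp) (by simp) hw hv _ _ _ _ rfl rfl rfl rfl
  have h2 := N.sh_word2 p p' (N.t2 x y) (N.t2 x' y') z z'
    (N.comp (N.sh (N.dom (N.src x)) (N.dom (N.src x')) (N.dom (N.src y)) (N.dom (N.src y'))) (N.t1 w v)) s
    (by simp [hp]) (by simp [hp']) (by simp [hw, hv]) hs _ _ _ _ rfl rfl rfl rfl
  simp [N.t2_assoc, N.t2_idn] at h1 h2
  rw [← h1] at h2
  rw [t2_hc_left, ← N.hc_assoc, N.hc_assoc (N.t2 p p'), N.t2_idn, ← N.idn_comp,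
    t1_comp_left, ← N.comp_assoc, N.t2_assoc, N.t1_assoc] at h2
  · simpa [sh3, hs] using h2
  all_goals simp [*]
end SM2Cat

namespace SM2Cat
variable (N : SM2Cat.{u})

theorem sh3_eq (A A' B B' C C' : N.Ob) : N.sh3 A A' B B' C C' =
    N.comp (N.sh A A' (N.t0 B C) (N.t0 B' C')) (N.t1 (N.one (N.t0 A A')) (N.sh B B' C C')) :=
  N.sh_assoc A A' B B' C C'

/-- The quaternary shuffle. -/
def sh4 (A A' B B' C C' D D' : N.Ob) : N.Ar :=
  N.comp (N.sh (N.t0 A (N.t0 B C)) (N.t0 A' (N.t0 B' C')) D D')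
    (N.t1 (N.sh3 A A' B B' C C') (N.one (N.t0 D D')))

theorem dom_sh4 (A A' B B' C C' D D' : N.Ob) : N.dom (N.sh4 A A' B B' C C' D D') =
    N.t0 A (N.t0 A' (N.t0 B (N.t0 B' (N.t0 C (N.t0 C' (N.t0 D D')))))) := by
  simp [sh4]

theorem cod_sh4 (A A' B B' C C' D D' : N.Ob) : N.cod (N.sh4 A A' B B' C C' D D') =
    N.t0 A (N.t0 B (N.t0 C (N.t0 D (N.t0 A' (N.t0 B' (N.t0 C' D')))))) := by
  simp [sh4]

attribute [simp] dom_sh4 cod_sh4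

theorem sh4_1 (A A' B B' C C' D D' : N.Ob) :
    N.comp (N.sh3 (N.t0 A B) (N.t0 A' B') C C' D D')
      (N.t1 (N.sh A A' B B') (N.one (N.t0 C (N.t0 C' (N.t0 D D'))))) =
    N.sh4 A A' B B' C C' D D' := by
  simp [sh4, sh3, N.comp_assoc, comp_t1_one, N.t1_assoc]

theorem sh4_2 (A A' B B' C C' D D' : N.Ob) :
    N.comp (N.sh3 A A' (N.t0 B C) (N.t0 B' C') D D')
      (N.t1 (N.one (N.t0 A A')) (N.t1 (N.sh B B' C C') (N.one (N.t0 D D')))) =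
    N.sh4 A A' B B' C C' D D' := by
  rw [sh3, sh4, sh3_eq]
  simp [N.comp_assoc, comp_t1_one, N.t1_assoc]

theorem sh4_5 (A A' B B' C C' D D' : N.Ob) :
    N.comp (N.sh A A' (N.t0 B (N.t0 C D)) (N.t0 B' (N.t0 C' D')))
      (N.t1 (N.one (N.t0 A A')) (N.sh3 B B' C C' D D')) =
    N.sh4 A A' B B' C C' D D' := by
  rw [← sh4_2, sh3_eq N A, sh3]
  simp [N.comp_assoc, one_t1_comp]

theorem sh4_3 (A A' B B' C C' D D' : N.Ob) :
    N.comp (N.sh3 A A' B B' (N.t0 C D) (N.t0 C' D'))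
      (N.t1 (N.one (N.t0 A A')) (N.t1 (N.one (N.t0 B B')) (N.sh C C' D D'))) =
    N.sh4 A A' B B' C C' D D' := by
  rw [← sh4_5, sh3_eq, sh3_eq]
  simp [N.comp_assoc, one_t1_comp]

theorem sh4_4 (A A' B B' C C' D D' : N.Ob) :
    N.comp (N.sh (N.t0 A (N.t0 B C)) (N.t0 A' (N.t0 B' C')) D D')
      (N.t1 (N.sh3 A A' B B' C C') (N.one (N.t0 D D'))) = N.sh4 A A' B B' C C' D D' := rfl

theorem sh3_I (A A' C C' : N.Ob) : N.sh3 A A' N.I N.I C C' = N.sh A A' C C' := by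
  simp [sh3, sh_I_right]

theorem merge1 (f g : N.Ar) (A B : N.Ob) (hA : N.dom f = A) (hB : N.cod g = B) :
    N.comp (N.t1 f (N.one B)) (N.t1 (N.one A) g) = N.t1 f g := by
  subst hA hB; exact N.t1_split f g

theorem merge2 (f g : N.Ar) (A B : N.Ob) (hA : N.cod f = A) (hB : N.dom g = B) :
    N.comp (N.t1 (N.one A) g) (N.t1 f (N.one B)) = N.t1 f g := by
  subst hA hB; exact N.t1_split' f g

theorem merge1' (f g h : N.Ar) (A B : N.Ob) (hA : N.dom f = A) (hB : N.cod g = B)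
    (hh : N.cod h = N.t0 A (N.dom g)) :
    N.comp (N.t1 f (N.one B)) (N.comp (N.t1 (N.one A) g) h) = N.comp (N.t1 f g) h := by
  rw [← N.comp_assoc, N.merge1 f g A B hA hB] <;> simp [*]

theorem merge2' (f g h : N.Ar) (A B : N.Ob) (hA : N.cod f = A) (hB : N.dom g = B)
    (hh : N.cod h = N.t0 (N.dom f) B) :
    N.comp (N.t1 (N.one A) g) (N.comp (N.t1 f (N.one B)) h) = N.comp (N.t1 f g) h := by
  rw [← N.comp_assoc, N.merge2 f g A B hA hB] <;> simp [*]

theorem t2_idn_one (A B : N.Ob) :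
    N.t2 (N.idn (N.one A)) (N.idn (N.one B)) = N.idn (N.one (N.t0 A B)) := by
  rw [N.t2_idn, N.t1_one]

attribute [simp] t2_idn_one

theorem vc_word (x x' y y' : N.Ce) (w : N.Ar) (h : N.src x = N.tgt y) (h' : N.src x' = N.tgt y')
    (hw : N.cod w = N.t0 (N.dom (N.src y)) (N.dom (N.src y'))) :
    N.vc (N.hc (N.t2 x x') (N.idn w)) (N.hc (N.t2 y y') (N.idn w)) =
      N.hc (N.t2 (N.vc x y) (N.vc x' y')) (N.idn w) := by
  rw [N.t2_vc, ← N.interchange] <;> simp [*]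

theorem IsInv.t2 {N : SM2Cat.{u}} {a b : N.Ce} (ha : IsInv N.toTwoCat a) (hb : IsInv N.toTwoCat b) :
    IsInv N.toTwoCat (N.t2 a b) := by
  obtain ⟨a', h1, h2, h3, h4⟩ := ha
  obtain ⟨b', k1, k2, k3, k4⟩ := hb
  refine ⟨N.t2 a' b', ?_, ?_, ?_, ?_⟩ <;> simp [← N.t2_vc, *, N.t2_idn]

theorem IsInv.hc_idn {N : SM2Cat.{u}} {a : N.Ce} (ha : IsInv N.toTwoCat a) (w : N.Ar)
    (hw : N.cod w = N.dom (N.src a)) : IsInv N.toTwoCat (N.hc a (N.idn w)) := by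
  obtain ⟨a', h1, h2, h3, h4⟩ := ha
  have e : N.dom (N.src a') = N.dom (N.src a) := by rw [h1, N.dom_tgt]
  refine ⟨N.hc a' (N.idn w), ?_, ?_, ?_, ?_⟩
  · simp [*]
  · simp [*]
  · rw [← N.interchange] <;> simp [*, N.idn_comp]
  · rw [← N.interchange] <;> simp [*, N.idn_comp]

theorem IsInv.idn {N : SM2Cat.{u}} (f : N.Ar) : IsInv N.toTwoCat (N.idn f) :=
  ⟨N.idn f, by simp, by simp, by simp, by simp⟩

namespace Pseudomonoid
variable {N}

/-- The monoidal product of pseudomonoids. -/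
def tensor (P Q : Pseudomonoid N) : Pseudomonoid N where
  A := N.t0 P.A Q.A
  m := N.comp (N.t1 P.m Q.m) (N.sh P.A Q.A P.A Q.A)
  u := N.t1 P.u Q.u
  α := N.hc (N.t2 P.α Q.α) (N.idn (N.sh3 P.A Q.A P.A Q.A P.A Q.A))
  l := N.t2 P.l Q.l
  r := N.t2 P.r Q.r
  dom_m := by simp
  cod_m := by simp
  dom_u := by simp
  cod_u := by simp
  src_α := by
    have h := N.sh_word1 P.m Q.m P.m Q.m (N.one P.A) (N.one Q.A) (N.sh P.A Q.A P.A Q.A)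
      (N.one (N.t0 P.A Q.A)) (by simp) (by simp) (by simp) (by simp) _ _ _ _ rfl rfl rfl rfl
    simp at h
    simp [sh3, h]
  tgt_α := by
    have h := N.sh_word1 P.m Q.m (N.one P.A) (N.one Q.A) P.m Q.m
      (N.one (N.t0 P.A Q.A)) (N.sh P.A Q.A P.A Q.A) (by simp) (by simp) (by simp) (by simp) _ _ _ _ rfl rfl rfl rfl
    simp at h
    simp [sh3_eq, h]
  src_l := by
    have h := N.sh_word1 P.m Q.m P.u Q.u (N.one P.A) (N.one Q.A) (N.one N.I)
      (N.one (N.t0 P.A Q.A)) (by simp) (by simp) (by simp) (by simp) _ _ _ _ rfl rfl rfl rfl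
    simp [sh_I_left] at h
    simp [h]
  tgt_l := by simp
  src_r := by
    have h := N.sh_word1 P.m Q.m (N.one P.A) (N.one Q.A) P.u Q.u
      (N.one (N.t0 P.A Q.A)) (N.one N.I) (by simp) (by simp) (by simp) (by simp) _ _ _ _ rfl rfl rfl rfl
    simp [sh_I_right] at h
    simp [h]
  tgt_r := by simp
  inv_α := (P.inv_α.t2 Q.inv_α).hc_idn _ (by simp)
  inv_l := P.inv_l.t2 Q.inv_l
  inv_r := P.inv_r.t2 Q.inv_r
  pentagon := by
    have e1 := N.sh_word2 (N.idn P.m) (N.idn Q.m) (N.idn (N.one P.A)) (N.idn (N.one Q.A)) P.α Q.α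
      (N.one (N.t0 P.A Q.A)) (N.sh3 P.A Q.A P.A Q.A P.A Q.A)
      (by simp) (by simp) (by simp) (by simp) _ _ _ _ rfl rfl rfl rfl
    have e2 := N.sh_word3 P.α Q.α (N.idn (N.one P.A)) (N.idn (N.one Q.A)) (N.idn P.m) (N.idn Q.m)
      (N.idn (N.one P.A)) (N.idn (N.one Q.A))
      (N.one (N.t0 P.A Q.A)) (N.sh P.A Q.A P.A Q.A) (N.one (N.t0 P.A Q.A))
      (by simp) (by simp) (by simp) (by simp) (by simp) _ _ _ _ _ _ rfl rfl rfl rfl rfl rfl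
    have e3 := N.sh_word2 (N.idn P.m) (N.idn Q.m) P.α Q.α (N.idn (N.one P.A)) (N.idn (N.one Q.A))
       (N.sh3 P.A Q.A P.A Q.A P.A Q.A) (N.one (N.t0 P.A Q.A))
      (by simp) (by simp) (by simp) (by simp) _ _ _ _ rfl rfl rfl rfl
    have e4 := N.sh_word3 P.α Q.α (N.idn (N.one P.A)) (N.idn (N.one Q.A))
      (N.idn (N.one P.A)) (N.idn (N.one Q.A)) (N.idn P.m) (N.idn Q.m)
      (N.one (N.t0 P.A Q.A)) (N.one (N.t0 P.A Q.A)) (N.sh P.A Q.A P.A Q.A)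
      (by simp) (by simp) (by simp) (by simp) (by simp) _ _ _ _ _ _ rfl rfl rfl rfl rfl rfl
    have e5 := N.sh_word3 P.α Q.α (N.idn P.m) (N.idn Q.m) (N.idn (N.one P.A)) (N.idn (N.one Q.A))
      (N.idn (N.one P.A)) (N.idn (N.one Q.A))
      (N.sh P.A Q.A P.A Q.A) (N.one (N.t0 P.A Q.A)) (N.one (N.t0 P.A Q.A))
      (by simp) (by simp) (by simp) (by simp) (by simp) _ _ _ _ _ _ rfl rfl rfl rfl rfl rfl
    simp only [N.t1_one, N.t0_assoc, N.src_idn, N.dom_one, N.cod_one, P.dom_m, Q.dom_m, P.src_α, Q.src_α] at e1 e2 e3 e4 e5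
    simp [sh4_1, sh4_2, sh4_3, sh4_4, sh4_5, ← N.t2_idn, N.idn_comp] at e1 e2 e3 e4 e5
    simp [← N.t2_idn, N.idn_comp]
    have hp := P.pentagon
    have hq := Q.pentagon
    simp only [t2_idn_one] at hp hq
    rw [e1, e2, e3, e4, e5, vc_word, vc_word, vc_word, hp, hq]
    all_goals clear e1 e2 e3
    all_goals simp (maxDischargeDepth := 8) [N.t2_idn, N.comp_assoc, one_t1_comp, comp_t1_one, N.t1_assoc, one_t1_one_t1, merge1, merge2, merge1', merge2']
  triangle := by
    have e1 := N.sh_word2 (N.idn P.m) (N.idn Q.m) (N.idn (N.one P.A)) (N.idn (N.one Q.A)) P.l Q.l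
      (N.one (N.t0 P.A Q.A)) (N.one (N.t0 P.A Q.A))
      (by simp) (by simp) (by simp) (by simp) _ _ _ _ rfl rfl rfl rfl
    have e2 := N.sh_word3 P.α Q.α (N.idn (N.one P.A)) (N.idn (N.one Q.A)) (N.idn P.u) (N.idn Q.u)
      (N.idn (N.one P.A)) (N.idn (N.one Q.A))
      (N.one (N.t0 P.A Q.A)) (N.one N.I) (N.one (N.t0 P.A Q.A))
      (by simp) (by simp) (by simp) (by simp) (by simp) _ _ _ _ _ _ rfl rfl rfl rfl rfl rfl
    have e3 := N.sh_word2 (N.idn P.m) (N.idn Q.m) P.r Q.r (N.idn (N.one P.A)) (N.idn (N.one Q.A))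
      (N.one (N.t0 P.A Q.A)) (N.one (N.t0 P.A Q.A))
      (by simp) (by simp) (by simp) (by simp) _ _ _ _ rfl rfl rfl rfl
    simp [sh3_I, N.t2_assoc] at e1 e2 e3
    simp [← N.t2_idn, N.idn_comp, N.t2_assoc]
    rw [e1, e2, e3, vc_word, P.triangle, Q.triangle]
    all_goals clear e1 e2 e3
    all_goals simp (maxDischargeDepth := 8) [N.t2_idn, N.comp_assoc, one_t1_comp, comp_t1_one, N.t1_assoc, one_t1_one_t1, merge1, merge2, merge1', merge2']

end Pseudomonoid
end SM2Cat

namespace SM2Cat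
variable (N : SM2Cat.{u})

theorem w_hc_vc (w b a : N.Ce) (h : N.src b = N.tgt a) (hw : N.idn (N.src w) = w)
    (hg : N.dom (N.src w) = N.cod (N.src a)) :
    N.hc w (N.vc b a) = N.vc (N.hc w b) (N.hc w a) := by
  have e : w = N.vc w w := by
    have := N.vc_idn w
    rw [hw] at this
    exact this.symm
  have e2 : N.src w = N.tgt w := by
    have := N.tgt_idn (N.src w)
    rw [hw] at this
    exact this.symm
  conv_lhs => rw [e]
  rw [N.interchange] <;> simp [← e2, h, hg]

theorem vc_hc_w (w b a : N.Ce) (h : N.src b = N.tgt a) (hw : N.idn (N.src w) = w)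
    (hg : N.cod (N.src w) = N.dom (N.src a)) :
    N.hc (N.vc b a) w = N.vc (N.hc b w) (N.hc a w) := by
  have e : w = N.vc w w := by
    have := N.vc_idn w
    rw [hw] at this
    exact this.symm
  have e2 : N.src w = N.tgt w := by
    have := N.tgt_idn (N.src w)
    rw [hw] at this
    exact this.symm
  conv_lhs => rw [e]
  rw [N.interchange] <;> simp [← e2, h, hg]

theorem w_t2_vc (w b a : N.Ce) (h : N.src b = N.tgt a) (hw : N.idn (N.src w) = w)
     :
    N.t2 w (N.vc b a) = N.vc (N.t2 w b) (N.t2 w a) := by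
  have e : w = N.vc w w := by
    have := N.vc_idn w
    rw [hw] at this
    exact this.symm
  have e2 : N.src w = N.tgt w := by
    have := N.tgt_idn (N.src w)
    rw [hw] at this
    exact this.symm
  conv_lhs => rw [e]
  rw [N.t2_vc] <;> simp [← e2, h]

theorem vc_t2_w (w b a : N.Ce) (h : N.src b = N.tgt a) (hw : N.idn (N.src w) = w)
     :
    N.t2 (N.vc b a) w = N.vc (N.t2 b w) (N.t2 a w) := by
  have e : w = N.vc w w := by
    have := N.vc_idn w
    rw [hw] at this
    exact this.symm
  have e2 : N.src w = N.tgt w := by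
    have := N.tgt_idn (N.src w)
    rw [hw] at this
    exact this.symm
  conv_lhs => rw [e]
  rw [N.t2_vc] <;> simp [← e2, h]

theorem one_t2_hc (A : N.Ob) (b a : N.Ce)
    (h : N.dom (N.src b) = N.cod (N.src a)) :
    N.t2 (N.idn (N.one A)) (N.hc b a) =
      N.hc (N.t2 (N.idn (N.one A)) b) (N.t2 (N.idn (N.one A)) a) := by
  rw [← N.t2_hc] <;> simp [*]

theorem hc_t2_one (A : N.Ob) (b a : N.Ce)
    (h : N.dom (N.src b) = N.cod (N.src a)) :
    N.t2 (N.hc b a) (N.idn (N.one A)) =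
      N.hc (N.t2 b (N.idn (N.one A))) (N.t2 a (N.idn (N.one A))) := by
  rw [← N.t2_hc] <;> simp [*]

theorem exchange (b a : N.Ce)
    (h : N.dom (N.src b) = N.cod (N.src a)) :
    N.vc (N.hc b (N.idn (N.tgt a))) (N.hc (N.idn (N.src b)) a) =
      N.vc (N.hc (N.idn (N.tgt b)) a) (N.hc b (N.idn (N.src a))) := by
  rw [← N.interchange, ← N.interchange] <;> simp [*]

theorem vc_congr2 {b a b' a' : N.Ce} (h : N.vc b a = N.vc b' a')
    (x : N.Ce) (h1 : N.src b = N.tgt a) (h2 : N.src b' = N.tgt a') (h3 : N.src a = N.tgt x)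
    (h4 : N.src a' = N.src a) :
    N.vc b (N.vc a x) = N.vc b' (N.vc a' x) := by
  rw [← N.vc_assoc _ _ _ h1 h3, ← N.vc_assoc _ _ _ h2 (h4.trans h3), h]

theorem vc_congr3 {c b a c' b' a' : N.Ce}
    (h : N.vc c (N.vc b a) = N.vc c' (N.vc b' a'))
    (x : N.Ce) (h0 : N.src c = N.tgt b) (h1 : N.src b = N.tgt a) (h0' : N.src c' = N.tgt b')
    (h2 : N.src b' = N.tgt a') (h3 : N.src a = N.tgt x)
    (h4 : N.src a' = N.src a) :
    N.vc c (N.vc b (N.vc a x)) = N.vc c' (N.vc b' (N.vc a' x)) := by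
  rw [← N.vc_assoc b a x h1 h3, ← N.vc_assoc c, h, N.vc_assoc, N.vc_assoc] <;> simp [*]

theorem vc_congr31 {c b a d : N.Ce} (h : N.vc c (N.vc b a) = d)
    (x : N.Ce) (h0 : N.src c = N.tgt b) (h1 : N.src b = N.tgt a) (h3 : N.src a = N.tgt x) :
    N.vc c (N.vc b (N.vc a x)) = N.vc d x := by
  rw [← N.vc_assoc b a x h1 h3, ← N.vc_assoc c, h] <;> simp [*]

theorem t2_hc_I (a g f : N.Ce) (h : N.dom (N.src a) = N.I) (hg : N.dom (N.src g) = N.cod (N.src f)) :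
    N.t2 a (N.hc g f) = N.hc (N.t2 a g) f := by
  conv_rhs => rw [← N.I_t2 f]
  rw [← N.t2_hc] <;> simp [*]

theorem t2_hc_I' (a g f : N.Ce) (h : N.dom (N.src a) = N.I) (hg : N.dom (N.src g) = N.cod (N.src f)) :
    N.t2 (N.hc g f) a = N.hc (N.t2 g a) f := by
  conv_rhs => rw [← N.t2_I f]
  rw [← N.t2_hc] <;> simp [*]

theorem k1 (f m : N.Ar) (h : N.dom f = N.cod m) :
    N.t1 (N.comp f m) f = N.comp (N.t1 f f) (N.t1 m (N.one (N.dom f))) := by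
  rw [← N.t1_comp] <;> simp [h]

theorem k1' (f m : N.Ar) (h : N.dom f = N.cod m) :
    N.t1 f (N.comp f m) = N.comp (N.t1 f f) (N.t1 (N.one (N.dom f)) m) := by
  rw [← N.t1_comp] <;> simp [h]

theorem k2 (f m : N.Ar) (h : N.dom m = N.t0 (N.cod f) (N.cod f)) :
    N.t1 (N.comp m (N.t1 f f)) f = N.comp (N.t1 m (N.one (N.cod f))) (N.t1 f (N.t1 f f)) := by
  rw [← N.t1_assoc, ← N.t1_comp] <;> simp [h]

theorem k2' (f m : N.Ar) (h : N.dom m = N.t0 (N.cod f) (N.cod f)) :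
    N.t1 f (N.comp m (N.t1 f f)) = N.comp (N.t1 (N.one (N.cod f)) m) (N.t1 f (N.t1 f f)) := by
  rw [← N.t1_comp] <;> simp [h]

theorem k3 (f : N.Ar) (m : N.Ce) (h : N.dom f = N.cod (N.src m)) :
    N.t2 (N.hc (N.idn f) m) (N.idn f) =
      N.hc (N.t2 (N.idn f) (N.idn f)) (N.t2 m (N.idn (N.one (N.dom f)))) := by
  rw [← N.t2_hc] <;> simp [h]

theorem k3' (f : N.Ar) (m : N.Ce) (h : N.dom f = N.cod (N.src m)) :
    N.t2 (N.idn f) (N.hc (N.idn f) m) =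
      N.hc (N.t2 (N.idn f) (N.idn f)) (N.t2 (N.idn (N.one (N.dom f))) m) := by
  rw [← N.t2_hc] <;> simp [h]

theorem k4 (f : N.Ar) (m : N.Ce) (h : N.dom (N.src m) = N.t0 (N.cod f) (N.cod f)) :
    N.t2 (N.hc m (N.t2 (N.idn f) (N.idn f))) (N.idn f) =
      N.hc (N.t2 m (N.idn (N.one (N.cod f)))) (N.t2 (N.idn f) (N.t2 (N.idn f) (N.idn f))) := by
  rw [← N.t2_assoc, ← N.t2_hc] <;> simp [h]

theorem k4' (f : N.Ar) (m : N.Ce) (h : N.dom (N.src m) = N.t0 (N.cod f) (N.cod f)) :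
    N.t2 (N.idn f) (N.hc m (N.t2 (N.idn f) (N.idn f))) =
      N.hc (N.t2 (N.idn (N.one (N.cod f))) m) (N.t2 (N.idn f) (N.t2 (N.idn f) (N.idn f))) := by
  rw [← N.t2_hc] <;> simp [h]

end SM2Cat

namespace SM2Cat

namespace Pseudomonoid

/-- The unit pseudomonoid on the monoidal unit. -/
def unit (N : SM2Cat.{u}) : Pseudomonoid N where
  A := N.I
  m := N.one N.I
  u := N.one N.I
  α := N.idn (N.one N.I)
  l := N.idn (N.one N.I)
  r := N.idn (N.one N.I)
  dom_m := by simp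
  cod_m := by simp
  dom_u := by simp
  cod_u := by simp
  src_α := by simp
  tgt_α := by simp
  src_l := by simp
  tgt_l := by simp
  src_r := by simp
  tgt_r := by simp
  inv_α := IsInv.idn _
  inv_l := IsInv.idn _
  inv_r := IsInv.idn _
  pentagon := by simp
  triangle := by simp

end Pseudomonoid

/-- A monoidal 1-cell `(f, φ₂ : m'.ff → f.m, φ₀ : u' → f.u)` between pseudomonoids. -/
@[ext]
structure MonArrow (N : SM2Cat.{u}) : Type u where
  /-- the domain -/
  P : Pseudomonoid N
  /-- the codomain -/
  Q : Pseudomonoid N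
  /-- the underlying 1-cell -/
  f : N.Ar
  /-- the binary part -/
  φ₂ : N.Ce
  /-- the nullary part -/
  φ₀ : N.Ce
  dom_f : N.dom f = P.A
  cod_f : N.cod f = Q.A
  src_φ₂ : N.src φ₂ = N.comp Q.m (N.t1 f f)
  tgt_φ₂ : N.tgt φ₂ = N.comp f P.m
  src_φ₀ : N.src φ₀ = Q.u
  tgt_φ₀ : N.tgt φ₀ = N.comp f P.u
  assoc :
    N.vc (N.hc (N.idn f) P.α)
      (N.vc (N.hc φ₂ (N.t2 (N.idn P.m) (N.idn (N.one P.A))))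
        (N.hc (N.idn Q.m) (N.t2 φ₂ (N.idn f)))) =
    N.vc (N.hc φ₂ (N.t2 (N.idn (N.one P.A)) (N.idn P.m)))
      (N.vc (N.hc (N.idn Q.m) (N.t2 (N.idn f) φ₂))
        (N.hc Q.α (N.t2 (N.idn f) (N.t2 (N.idn f) (N.idn f)))))
  unit_left :
    N.vc (N.hc (N.idn f) P.l)
      (N.vc (N.hc φ₂ (N.t2 (N.idn P.u) (N.idn (N.one P.A))))
        (N.hc (N.idn Q.m) (N.t2 φ₀ (N.idn f)))) =
    N.hc Q.l (N.idn f)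
  unit_right :
    N.vc (N.hc (N.idn f) P.r)
      (N.vc (N.hc φ₂ (N.t2 (N.idn (N.one P.A)) (N.idn P.u)))
        (N.hc (N.idn Q.m) (N.t2 (N.idn f) φ₀))) =
    N.hc Q.r (N.idn f)

attribute [simp] MonArrow.dom_f MonArrow.cod_f MonArrow.src_φ₂ MonArrow.tgt_φ₂ MonArrow.src_φ₀
  MonArrow.tgt_φ₀

namespace MonArrow
variable {N : SM2Cat.{u}}

/-- The identity monoidal 1-cell. -/
def one (P : Pseudomonoid N) : MonArrow N where
  P := P
  Q := P
  f := N.one P.A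
  φ₂ := N.idn P.m
  φ₀ := N.idn P.u
  dom_f := by simp
  cod_f := by simp
  src_φ₂ := by simp
  tgt_φ₂ := by simp
  src_φ₀ := by simp
  tgt_φ₀ := by simp
  assoc := by
    simp [N.t2_idn, ← N.idn_comp]
  unit_left := by
    simp [N.t2_idn, ← N.idn_comp]
  unit_right := by
    simp [N.t2_idn, ← N.idn_comp]

/-- Composition of monoidal 1-cells. -/
def comp (G F : MonArrow N) (h : G.P = F.Q) : MonArrow N where
  P := F.P
  Q := G.Q
  f := N.comp G.f F.f
  φ₂ := N.vc (N.hc (N.idn G.f) F.φ₂) (N.hc G.φ₂ (N.t2 (N.idn F.f) (N.idn F.f)))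
  φ₀ := N.vc (N.hc (N.idn G.f) F.φ₀) G.φ₀
  dom_f := by simp [h]
  cod_f := by simp [h]
  src_φ₂ := by simp (maxDischargeDepth := 8) [h, N.comp_assoc, N.t1_comp]
  tgt_φ₂ := by simp (maxDischargeDepth := 8) [h, N.comp_assoc, N.t1_comp]
  src_φ₀ := by simp [h]
  tgt_φ₀ := by simp [h, N.comp_assoc]
  assoc := by
    have h1 := congrArg (fun x => N.hc (N.idn G.f) x) F.assoc
    have h2 := congrArg (fun x => N.hc x (N.t2 (N.idn F.f) (N.t2 (N.idn F.f) (N.idn F.f)))) G.assoc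
    have h3 := N.exchange G.φ₂ (N.t2 F.φ₂ (N.idn F.f)) (by simp [h])
    have h4 := N.exchange G.φ₂ (N.t2 (N.idn F.f) F.φ₂) (by simp [h])
    simp (maxDischargeDepth := 8) [h, w_hc_vc, vc_hc_w, w_t2_vc, vc_t2_w, one_t2_hc, hc_t2_one, N.idn_comp, ← N.t2_idn, N.t2_assoc, N.hc_assoc, N.vc_assoc, N.t2_hc, N.t1_comp, k1, k1', k2, k2', k3, k3', k4, k4', N.t1_assoc, N.comp_assoc] at h1 h2 h3 h4 ⊢
    rw [N.vc_congr2 h3, N.vc_congr3 h1, h2, N.vc_congr2 h4]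
    all_goals simp (maxDischargeDepth := 8) [h, w_hc_vc, vc_hc_w, w_t2_vc, vc_t2_w, one_t2_hc, hc_t2_one, N.idn_comp, ← N.t2_idn, N.t2_assoc, N.hc_assoc, N.vc_assoc, N.t2_hc, N.t1_comp, k1, k1', k2, k2', k3, k3', k4, k4', N.t1_assoc, N.comp_assoc]
  unit_left := by
    have h1 := congrArg (fun x => N.hc (N.idn G.f) x) F.unit_left
    have h2 := congrArg (fun x => N.hc x (N.idn F.f)) G.unit_left
    have h3 := N.exchange G.φ₂ (N.t2 F.φ₀ (N.idn F.f)) (by simp [h])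
    have e := N.merge1 F.Q.u F.f _ _ F.Q.dom_u F.cod_f
    have e' := congrArg N.idn e
    simp (maxDischargeDepth := 8) [N.idn_comp, ← N.t2_idn] at e e'
    simp (maxDischargeDepth := 8) [h, w_hc_vc, vc_hc_w, w_t2_vc, vc_t2_w, one_t2_hc, hc_t2_one, N.idn_comp, ← N.t2_idn, N.t2_assoc, N.hc_assoc, N.vc_assoc, N.t2_hc, N.t1_comp, k1, k1', k2, k2', k3, k3', k4, k4', N.t1_assoc, N.comp_assoc, N.t2_hc_I G.φ₀, N.t2_hc_I' G.φ₀, ← e, ← e'] at h1 h2 h3 ⊢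
    rw [N.vc_congr2 h3, N.vc_congr31 h1, h2]
    all_goals simp (maxDischargeDepth := 8) [h, w_hc_vc, vc_hc_w, w_t2_vc, vc_t2_w, one_t2_hc, hc_t2_one, N.idn_comp, ← N.t2_idn, N.t2_assoc, N.hc_assoc, N.vc_assoc, N.t2_hc, N.t1_comp, k1, k1', k2, k2', k3, k3', k4, k4', N.t1_assoc, N.comp_assoc, ← e]
  unit_right := by
    have h1 := congrArg (fun x => N.hc (N.idn G.f) x) F.unit_right
    have h2 := congrArg (fun x => N.hc x (N.idn F.f)) G.unit_right
    have h3 := N.exchange G.φ₂ (N.t2 (N.idn F.f) F.φ₀) (by simp [h])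
    have e := N.merge2 F.f F.Q.u _ _ F.cod_f F.Q.dom_u
    have e' := congrArg N.idn e
    simp (maxDischargeDepth := 8) [N.idn_comp, ← N.t2_idn] at e e'
    simp (maxDischargeDepth := 8) [h, w_hc_vc, vc_hc_w, w_t2_vc, vc_t2_w, one_t2_hc, hc_t2_one, N.idn_comp, ← N.t2_idn, N.t2_assoc, N.hc_assoc, N.vc_assoc, N.t2_hc, N.t1_comp, k1, k1', k2, k2', k3, k3', k4, k4', N.t1_assoc, N.comp_assoc, N.t2_hc_I G.φ₀, N.t2_hc_I' G.φ₀, ← e, ← e'] at h1 h2 h3 ⊢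
    rw [N.vc_congr2 h3, N.vc_congr31 h1, h2]
    all_goals simp (maxDischargeDepth := 8) [h, w_hc_vc, vc_hc_w, w_t2_vc, vc_t2_w, one_t2_hc, hc_t2_one, N.idn_comp, ← N.t2_idn, N.t2_assoc, N.hc_assoc, N.vc_assoc, N.t2_hc, N.t1_comp, k1, k1', k2, k2', k3, k3', k4, k4', N.t1_assoc, N.comp_assoc, ← e]

end MonArrow
end SM2Cat

namespace SM2Cat
variable {N : SM2Cat.{u}}

theorem sh3_def (A A' B B' C C' : N.Ob) :
    N.comp (N.sh (N.t0 A B) (N.t0 A' B') C C') (N.t1 (N.sh A A' B B') (N.one (N.t0 C C'))) =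
      N.sh3 A A' B B' C C' := rfl

theorem sh3_def' (A A' B B' C C' : N.Ob) :
    N.hc (N.idn (N.sh (N.t0 A B) (N.t0 A' B') C C'))
      (N.idn (N.t1 (N.sh A A' B B') (N.one (N.t0 C C')))) =
      N.idn (N.sh3 A A' B B' C C') := by
  rw [← N.idn_comp, sh3_def]; simp

theorem sh3_eq' (A A' B B' C C' : N.Ob) :
    N.hc (N.idn (N.sh A A' (N.t0 B C) (N.t0 B' C')))
      (N.idn (N.t1 (N.one (N.t0 A A')) (N.sh B B' C C'))) =
      N.idn (N.sh3 A A' B B' C C') := by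
  rw [← N.idn_comp, sh3_eq]; simp

namespace MonArrow

/-- The monoidal product of monoidal 1-cells. -/
def tensor (F G : MonArrow N) : MonArrow N where
  P := F.P.tensor G.P
  Q := F.Q.tensor G.Q
  f := N.t1 F.f G.f
  φ₂ := N.hc (N.t2 F.φ₂ G.φ₂) (N.idn (N.sh F.P.A G.P.A F.P.A G.P.A))
  φ₀ := N.t2 F.φ₀ G.φ₀
  dom_f := by simp [Pseudomonoid.tensor]
  cod_f := by simp [Pseudomonoid.tensor]
  src_φ₂ := by
    have h := N.sh_word1 F.Q.m G.Q.m F.f G.f F.f G.f (N.one (N.t0 F.P.A G.P.A))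
      (N.one (N.t0 F.P.A G.P.A)) (by simp) (by simp) (by simp) (by simp) _ _ _ _ rfl rfl rfl rfl
    simp at h
    simp [Pseudomonoid.tensor, h]
  tgt_φ₂ := by simp [Pseudomonoid.tensor, N.t1_comp, N.comp_assoc]
  src_φ₀ := by simp [Pseudomonoid.tensor]
  tgt_φ₀ := by simp [Pseudomonoid.tensor, N.t1_comp]
  assoc := by
    have e2 := N.sh_word2 F.φ₂ G.φ₂ (N.idn F.P.m) (N.idn G.P.m) (N.idn (N.one F.P.A))
      (N.idn (N.one G.P.A)) (N.sh F.P.A G.P.A F.P.A G.P.A) (N.one (N.t0 F.P.A G.P.A))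
      (by simp) (by simp) (by simp) (by simp) _ _ _ _ rfl rfl rfl rfl
    have e3 := N.sh_word2 (N.idn F.Q.m) (N.idn G.Q.m) F.φ₂ G.φ₂ (N.idn F.f) (N.idn G.f)
      (N.sh F.P.A G.P.A F.P.A G.P.A) (N.one (N.t0 F.P.A G.P.A))
      (by simp) (by simp) (by simp) (by simp) _ _ _ _ rfl rfl rfl rfl
    have e4 := N.sh_word2 F.φ₂ G.φ₂ (N.idn (N.one F.P.A))
      (N.idn (N.one G.P.A)) (N.idn F.P.m) (N.idn G.P.m) (N.one (N.t0 F.P.A G.P.A))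
      (N.sh F.P.A G.P.A F.P.A G.P.A)
      (by simp) (by simp) (by simp) (by simp) _ _ _ _ rfl rfl rfl rfl
    have e5 := N.sh_word2 (N.idn F.Q.m) (N.idn G.Q.m) (N.idn F.f) (N.idn G.f) F.φ₂ G.φ₂
      (N.one (N.t0 F.P.A G.P.A)) (N.sh F.P.A G.P.A F.P.A G.P.A)
      (by simp) (by simp) (by simp) (by simp) _ _ _ _ rfl rfl rfl rfl
    have e6 := N.sh_word3 F.Q.α G.Q.α (N.idn F.f) (N.idn G.f) (N.idn F.f) (N.idn G.f)
      (N.idn F.f) (N.idn G.f) (N.one (N.t0 F.P.A G.P.A)) (N.one (N.t0 F.P.A G.P.A))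
      (N.one (N.t0 F.P.A G.P.A))
      (by simp) (by simp) (by simp) (by simp) (by simp) _ _ _ _ _ _ rfl rfl rfl rfl rfl rfl
    have e1 : N.hc (N.t2 (N.idn F.f) (N.idn G.f))
        (N.hc (N.t2 F.P.α G.P.α) (N.idn (N.sh3 F.P.A G.P.A F.P.A G.P.A F.P.A G.P.A))) =
        N.hc (N.t2 (N.hc (N.idn F.f) F.P.α) (N.hc (N.idn G.f) G.P.α))
          (N.idn (N.sh3 F.P.A G.P.A F.P.A G.P.A F.P.A G.P.A)) := by
      rw [N.t2_hc, N.hc_assoc] <;> simp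
    simp [sh3_def, ← sh3_eq, ← N.t2_idn, N.idn_comp, N.t2_assoc] at e2 e3 e4 e5 e6
    have hF := F.assoc
    have hG := G.assoc
    simp [Pseudomonoid.tensor, ← N.t2_idn, N.idn_comp, N.t2_assoc]
    rw [e1, e2, e3, e4, e5, e6, vc_word, vc_word, vc_word, vc_word, hF, hG]
    all_goals simp (maxDischargeDepth := 8) [N.t2_idn, N.comp_assoc, k1, k1', k2, k2', N.t1_assoc]
  unit_left := by
    have e2 := N.sh_word2 F.φ₂ G.φ₂ (N.idn F.P.u) (N.idn G.P.u) (N.idn (N.one F.P.A))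
      (N.idn (N.one G.P.A)) (N.one N.I) (N.one (N.t0 F.P.A G.P.A))
      (by simp) (by simp) (by simp) (by simp) _ _ _ _ rfl rfl rfl rfl
    have e3 := N.sh_word2 (N.idn F.Q.m) (N.idn G.Q.m) F.φ₀ G.φ₀ (N.idn F.f) (N.idn G.f)
      (N.one N.I) (N.one (N.t0 F.P.A G.P.A))
      (by simp) (by simp) (by simp) (by simp) _ _ _ _ rfl rfl rfl rfl
    simp (maxDischargeDepth := 8) [sh_I_left, ← N.t2_idn, N.idn_comp, N.t2_assoc] at e2 e3
    simp [Pseudomonoid.tensor, ← N.t2_idn, N.idn_comp, N.t2_assoc]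
    rw [e2, e3, ← N.t2_hc, ← N.t2_hc, ← N.t2_vc, ← N.t2_vc, F.unit_left, G.unit_left]
    all_goals simp (maxDischargeDepth := 8) [N.t2_idn, N.comp_assoc, k1, k1', k2, k2', N.t1_assoc]
  unit_right := by
    have e2 := N.sh_word2 F.φ₂ G.φ₂ (N.idn (N.one F.P.A))
      (N.idn (N.one G.P.A)) (N.idn F.P.u) (N.idn G.P.u) (N.one (N.t0 F.P.A G.P.A)) (N.one N.I)
      (by simp) (by simp) (by simp) (by simp) _ _ _ _ rfl rfl rfl rfl
    have e3 := N.sh_word2 (N.idn F.Q.m) (N.idn G.Q.m) (N.idn F.f) (N.idn G.f) F.φ₀ G.φ₀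
      (N.one (N.t0 F.P.A G.P.A)) (N.one N.I)
      (by simp) (by simp) (by simp) (by simp) _ _ _ _ rfl rfl rfl rfl
    simp (maxDischargeDepth := 8) [sh_I_right, ← N.t2_idn, N.idn_comp, N.t2_assoc] at e2 e3
    simp [Pseudomonoid.tensor, ← N.t2_idn, N.idn_comp, N.t2_assoc]
    rw [e2, e3, ← N.t2_hc, ← N.t2_hc, ← N.t2_vc, ← N.t2_vc, F.unit_right, G.unit_right]
    all_goals simp (maxDischargeDepth := 8) [N.t2_idn, N.comp_assoc, k1, k1', k2, k2', N.t1_assoc]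

end MonArrow
end SM2Cat

namespace SM2Cat
variable {N : SM2Cat.{u}}

theorem sh3_br (A A' B B' C C' : N.Ob) :
    N.comp (N.sh3 A' A B' B C' C) (N.t1 (N.br A A') (N.t1 (N.br B B') (N.br C C'))) =
    N.comp (N.br (N.t0 A (N.t0 B C)) (N.t0 A' (N.t0 B' C'))) (N.sh3 A A' B B' C C') := by
  have h1 := N.sh_br A A' B B'
  have h2 := N.sh_br (N.t0 A B) (N.t0 A' B') C C'
  have h3 := congrArg (fun x => N.t1 x (N.br C C')) h1
  simp only [N.t0_assoc] at h2
  rw [sh3, sh3, N.comp_assoc, ← N.t1_assoc, ← N.t1_comp, h1, ← N.comp_assoc, ← h2, N.comp_assoc,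
    ← N.t1_comp] <;> simp

namespace MonArrow

theorem braid_src (P Q : Pseudomonoid N) :
    N.comp (Q.tensor P).m (N.t1 (N.br P.A Q.A) (N.br P.A Q.A)) =
      N.comp (N.br P.A Q.A) (P.tensor Q).m := by
  have h1 := N.br_nat1 P.m Q.m
  have h2 := N.sh_br P.A Q.A P.A Q.A
  simp at h1
  simp only [Pseudomonoid.tensor]
  rw [N.comp_assoc, h2, ← N.comp_assoc, ← h1, N.comp_assoc] <;> simp

theorem braid_unit (P Q : Pseudomonoid N) :
    (Q.tensor P).u = N.comp (N.br P.A Q.A) (P.tensor Q).u := by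
  have := N.br_nat1 P.u Q.u
  simp [br_I_left] at this
  simp [Pseudomonoid.tensor, this]

theorem braid_α (P Q : Pseudomonoid N) :
    N.hc (N.idn (N.br P.A Q.A)) (P.tensor Q).α =
      N.hc (Q.tensor P).α (N.idn (N.t1 (N.br P.A Q.A) (N.t1 (N.br P.A Q.A) (N.br P.A Q.A)))) := by
  have h1 := N.br_nat2 P.α Q.α
  have h2 := N.sh3_br P.A Q.A P.A Q.A P.A Q.A
  simp at h1
  simp only [Pseudomonoid.tensor]
  rw [N.hc_assoc, ← N.idn_comp, h2, N.idn_comp, ← N.hc_assoc, ← N.hc_assoc, h1] <;> simp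

theorem braid_l (P Q : Pseudomonoid N) :
    N.hc (N.idn (N.br P.A Q.A)) (P.tensor Q).l = N.hc (Q.tensor P).l (N.idn (N.br P.A Q.A)) := by
  have h1 := N.br_nat2 P.l Q.l
  simpa [Pseudomonoid.tensor] using h1

theorem braid_r (P Q : Pseudomonoid N) :
    N.hc (N.idn (N.br P.A Q.A)) (P.tensor Q).r = N.hc (Q.tensor P).r (N.idn (N.br P.A Q.A)) := by
  have h1 := N.br_nat2 P.r Q.r
  simpa [Pseudomonoid.tensor] using h1

theorem vc3_left (x a b : N.Ce) (ha : N.idn (N.src a) = a) (hb : N.idn (N.src b) = b)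
    (h : N.src x = N.tgt a) (h' : N.src a = N.tgt b) : N.vc x (N.vc a b) = x := by
  have h1 : N.tgt a = N.src a := by rw [← ha]; simp
  have h2 : N.tgt b = N.src b := by rw [← hb]; simp
  rw [← hb, vc_idn_of _ _ _ (h'.trans h2), ← ha, vc_idn_of _ _ _ (h.trans h1)]

theorem vc3_right (x a b : N.Ce) (ha : N.idn (N.src a) = a) (hb : N.idn (N.src b) = b)
    (h' : N.src a = N.tgt b) (h : N.src b = N.tgt x) : N.vc a (N.vc b x) = x := by
  have h2 : N.tgt b = N.src b := by rw [← hb]; simp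
  rw [← hb, idn_vc_of _ _ _ h.symm, ← ha, idn_vc_of _ _ _ (h.symm.trans (h2.symm.trans h'.symm))]

/-- A strict monoidal 1-cell. -/
def ofStrict (P Q : Pseudomonoid N) (f : N.Ar) (hd : N.dom f = P.A) (hc : N.cod f = Q.A)
    (h2 : N.comp Q.m (N.t1 f f) = N.comp f P.m) (h0 : Q.u = N.comp f P.u)
    (hα : N.hc (N.idn f) P.α = N.hc Q.α (N.idn (N.t1 f (N.t1 f f))))
    (hl : N.hc (N.idn f) P.l = N.hc Q.l (N.idn f))
    (hr : N.hc (N.idn f) P.r = N.hc Q.r (N.idn f)) : MonArrow N where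
  P := P
  Q := Q
  f := f
  φ₂ := N.idn (N.comp f P.m)
  φ₀ := N.idn Q.u
  dom_f := hd
  cod_f := hc
  src_φ₂ := by rw [h2]; simp
  tgt_φ₂ := by simp
  src_φ₀ := by simp
  tgt_φ₀ := by rw [h0]; simp
  assoc := by
    have a1 : N.comp Q.m (N.t1 (N.comp f P.m) f) =
        N.comp f (N.comp P.m (N.t1 P.m (N.one P.A))) := by
      rw [k1, ← N.comp_assoc, h2, N.comp_assoc, hd] <;> simp [*]
    have a2 : N.comp Q.m (N.t1 f (N.comp f P.m)) =
        N.comp f (N.comp P.m (N.t1 (N.one P.A) P.m)) := by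
      rw [k1', ← N.comp_assoc, h2, N.comp_assoc, hd] <;> simp [*]
    have a3 : N.comp Q.m (N.t1 f (N.comp f P.m)) =
        N.comp Q.m (N.comp (N.t1 (N.one Q.A) Q.m) (N.t1 f (N.t1 f f))) := by
      rw [← h2, k2', hc] <;> simp [hd, hc]
    rw [vc3_left, vc3_right, hα, N.t2_idn, N.t2_idn]
    all_goals first
      | (rw [N.t2_idn, ← N.idn_comp] <;> simp [hd, hc]; done)
      | (simp (maxDischargeDepth := 8) [N.comp_assoc, hd, hc, a1, a2]; done)
      | (simp (maxDischargeDepth := 8) [N.comp_assoc, hd, hc, a3]; done)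
  unit_left := by
    have a1 : N.comp Q.m (N.t1 Q.u f) = N.comp (N.comp f P.m) (N.t1 P.u (N.one P.A)) := by
      have e : N.t1 Q.u f = N.comp (N.t1 f f) (N.t1 P.u (N.one P.A)) := by
        rw [← N.t1_comp, ← h0] <;> simp [*]
      rw [e, ← N.comp_assoc, h2] <;> simp [*]
    rw [vc3_left, hl]
    all_goals first
      | (rw [N.t2_idn, ← N.idn_comp] <;> simp [hd, hc]; done)
      | (simp (maxDischargeDepth := 8) [N.comp_assoc, hd, hc, a1]; done)
  unit_right := by
    have a1 : N.comp Q.m (N.t1 f Q.u) = N.comp (N.comp f P.m) (N.t1 (N.one P.A) P.u) := by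
      have e : N.t1 f Q.u = N.comp (N.t1 f f) (N.t1 (N.one P.A) P.u) := by
        rw [← N.t1_comp, ← h0] <;> simp [*]
      rw [e, ← N.comp_assoc, h2] <;> simp [*]
    rw [vc3_left, hr]
    all_goals first
      | (rw [N.t2_idn, ← N.idn_comp] <;> simp [hd, hc]; done)
      | (simp (maxDischargeDepth := 8) [N.comp_assoc, hd, hc, a1]; done)

/-- The symmetry as a (strict) monoidal 1-cell. -/
def braid (P Q : Pseudomonoid N) : MonArrow N :=
  ofStrict (P.tensor Q) (Q.tensor P) (N.br P.A Q.A) (by simp [Pseudomonoid.tensor])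
    (by simp [Pseudomonoid.tensor]) (braid_src P Q) (braid_unit P Q) (braid_α P Q) (braid_l P Q)
    (braid_r P Q)

end MonArrow
end SM2Cat

namespace SM2Cat

/-- A monoidal 2-cell. -/
@[ext]
structure MonTrans (N : SM2Cat.{u}) : Type u where
  /-- the source -/
  F : MonArrow N
  /-- the target -/
  G : MonArrow N
  /-- the underlying 2-cell -/
  ω : N.Ce
  hP : G.P = F.P
  hQ : G.Q = F.Q
  src_ω : N.src ω = F.f
  tgt_ω : N.tgt ω = G.f
  binary : N.vc (N.hc ω (N.idn F.P.m)) F.φ₂ = N.vc G.φ₂ (N.hc (N.idn F.Q.m) (N.t2 ω ω))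
  nullary : N.vc (N.hc ω (N.idn F.P.u)) F.φ₀ = G.φ₀

attribute [simp] MonTrans.hP MonTrans.hQ MonTrans.src_ω MonTrans.tgt_ω

namespace MonTrans
variable {N : SM2Cat.{u}}

/-- The identity monoidal 2-cell. -/
def idn (F : MonArrow N) : MonTrans N where
  F := F
  G := F
  ω := N.idn F.f
  hP := rfl
  hQ := rfl
  src_ω := by simp
  tgt_ω := by simp
  binary := by simp [N.t2_idn, ← N.idn_comp]
  nullary := by simp [← N.idn_comp]

/-- Vertical composition of monoidal 2-cells. -/
def vc (b a : MonTrans N) (h : b.F = a.G) : MonTrans N where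
  F := a.F
  G := b.G
  ω := N.vc b.ω a.ω
  hP := by rw [b.hP, h, a.hP]
  hQ := by rw [b.hQ, h, a.hQ]
  src_ω := by simp [h]
  tgt_ω := by simp [h]
  binary := by
    have h1 := a.binary
    have h2 := b.binary
    simp only [h, a.hP, a.hQ] at h2
    rw [N.vc_hc_w, N.vc_assoc, h1, ← N.vc_assoc, h2, N.vc_assoc, ← N.w_hc_vc, ← N.t2_vc] <;> simp [h]
  nullary := by
    have h1 := a.nullary
    have h2 := b.nullary
    simp only [h, a.hP, a.hQ] at h2
    rw [N.vc_hc_w, N.vc_assoc, h1, h2] <;> simp [h]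

/-- Horizontal composition of monoidal 2-cells. -/
def hc (b a : MonTrans N) (h : b.F.P = a.F.Q) : MonTrans N where
  F := b.F.comp a.F h
  G := b.G.comp a.G (by rw [b.hP, h, a.hQ])
  ω := N.hc b.ω a.ω
  hP := a.hP
  hQ := b.hQ
  src_ω := by simp [h, MonArrow.comp]
  tgt_ω := by simp [h, MonArrow.comp]
  binary := by
    have h1 : N.vc (N.hc b.ω (N.hc a.ω (N.idn a.F.P.m))) (N.hc (N.idn b.F.f) a.F.φ₂) =
        N.vc (N.hc (N.idn b.G.f) a.G.φ₂) (N.hc b.ω (N.hc (N.idn a.F.Q.m) (N.t2 a.ω a.ω))) := by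
      rw [← N.interchange, ← N.interchange, a.binary] <;> simp [h]
    have h2 : N.vc (N.hc (N.hc b.ω (N.idn a.F.Q.m)) (N.t2 a.ω a.ω))
          (N.hc b.F.φ₂ (N.t2 (N.idn a.F.f) (N.idn a.F.f))) =
        N.vc (N.hc b.G.φ₂ (N.t2 (N.idn a.G.f) (N.idn a.G.f)))
          (N.hc (N.hc (N.idn b.F.Q.m) (N.t2 b.ω b.ω)) (N.t2 a.ω a.ω)) := by
      have hb := b.binary
      simp only [h] at hb
      rw [← N.interchange, ← N.interchange, hb] <;> simp [h, N.t2_idn]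
    simp only [MonArrow.comp]
    rw [N.hc_assoc, N.vc_congr2 h1, ← N.hc_assoc b.ω, h2, N.vc_assoc, N.hc_assoc, ← N.t2_hc] <;> simp (maxDischargeDepth := 8) [h, N.comp_assoc, k1, k2, k1', k2', N.t1_comp]
  nullary := by
    have h1 : N.vc (N.hc b.ω (N.hc a.ω (N.idn a.F.P.u))) (N.hc (N.idn b.F.f) a.F.φ₀) =
        N.vc (N.hc (N.idn b.G.f) a.G.φ₀) (N.hc b.ω (N.idn a.F.Q.u)) := by
      rw [← N.interchange, ← N.interchange, a.nullary] <;> simp [h]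
    have hb := b.nullary
    simp only [h] at hb
    simp only [MonArrow.comp]
    rw [N.hc_assoc, N.vc_congr2 h1, hb] <;> simp (maxDischargeDepth := 8) [h]

/-- The monoidal product of monoidal 2-cells. -/
def tensor (a b : MonTrans N) : MonTrans N where
  F := a.F.tensor b.F
  G := a.G.tensor b.G
  ω := N.t2 a.ω b.ω
  hP := by simp [MonArrow.tensor]
  hQ := by simp [MonArrow.tensor]
  src_ω := by simp [MonArrow.tensor]
  tgt_ω := by simp [MonArrow.tensor]
  binary := by
    have e2 := N.sh_word2 (N.idn a.F.Q.m) (N.idn b.F.Q.m) a.ω b.ω a.ω b.ω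
      (N.one (N.t0 a.F.P.A b.F.P.A)) (N.one (N.t0 a.F.P.A b.F.P.A))
      (by simp) (by simp) (by simp) (by simp) _ _ _ _ rfl rfl rfl rfl
    have e1 : N.hc (N.t2 a.ω b.ω) (N.hc (N.t2 (N.idn a.F.P.m) (N.idn b.F.P.m))
        (N.idn (N.sh a.F.P.A b.F.P.A a.F.P.A b.F.P.A))) =
        N.hc (N.t2 (N.hc a.ω (N.idn a.F.P.m)) (N.hc b.ω (N.idn b.F.P.m)))
        (N.idn (N.sh a.F.P.A b.F.P.A a.F.P.A b.F.P.A)) := by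
      rw [N.t2_hc, N.hc_assoc] <;> simp
    simp [← N.t2_idn, N.idn_comp, N.t2_assoc] at e2
    simp only [MonArrow.tensor, Pseudomonoid.tensor]
    rw [N.idn_comp, N.idn_comp, N.t2_assoc, ← N.t2_idn, ← N.t2_idn, e1, e2, vc_word, a.hP, b.hP, vc_word,
      a.binary, b.binary] <;> simp
  nullary := by
    simp only [MonArrow.tensor, Pseudomonoid.tensor]
    rw [← N.t2_idn, ← N.t2_hc, ← N.t2_vc, a.nullary, b.nullary] <;> simp

end MonTrans
end SM2Cat

namespace SM2Cat
variable (N : SM2Cat.{u})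

theorem sh3_assoc3 (A A' A'' B B' B'' C C' C'' : N.Ob) :
    N.comp (N.t1 (N.sh3 A A' B B' C C') (N.one (N.t0 A'' (N.t0 B'' C''))))
      (N.sh3 (N.t0 A A') A'' (N.t0 B B') B'' (N.t0 C C') C'') =
    N.comp (N.t1 (N.one (N.t0 A (N.t0 B C))) (N.sh3 A' A'' B' B'' C' C''))
      (N.sh3 A (N.t0 A' A'') B (N.t0 B' B'') C (N.t0 C' C'')) := by
  have n1 := N.sh_nat1 (N.sh A A' B B') (N.one (N.t0 A'' B'')) (N.one (N.t0 C C')) (N.one C'')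
  have n2 := N.sh_nat1 (N.one (N.t0 A B)) (N.sh A' A'' B' B'') (N.one C) (N.one (N.t0 C' C''))
  have s1 := congrArg (fun x => N.t1 x (N.one (N.t0 C (N.t0 C' C'')))) (N.sh_assoc3 A A' A'' B B' B'')
  have s2 := N.sh_assoc3 (N.t0 A B) (N.t0 A' B') (N.t0 A'' B'') C C' C''
  simp [one_t1_one_t1, comp_t1_one, one_t1_comp, N.t1_assoc] at n1 n2 s1 s2
  simp [sh3, one_t1_one_t1, comp_t1_one, one_t1_comp, N.t1_assoc]
  rw [N.comp_assoc, ← N.comp_assoc (N.t1 (N.sh A A' B B') _), ← n1, N.comp_assoc, s1,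
    ← N.comp_assoc, s2, N.comp_assoc, ← N.comp_assoc (N.sh (N.t0 A B) _ _ _)]
  rotate_left
  all_goals try simp
  rw [n2, N.comp_assoc, N.comp_assoc]
  all_goals simp

theorem word_assoc2 (p q r : N.Ce) (P P' Q Q' R R' : N.Ob)
    (hp : N.dom (N.src p) = N.t0 P P') (hq : N.dom (N.src q) = N.t0 Q Q')
    (hr : N.dom (N.src r) = N.t0 R R') :
    N.hc (N.t2 (N.hc (N.t2 p q) (N.idn (N.sh P Q P' Q'))) r)
      (N.idn (N.sh (N.t0 P Q) R (N.t0 P' Q') R')) =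
    N.hc (N.t2 p (N.hc (N.t2 q r) (N.idn (N.sh Q R Q' R'))))
      (N.idn (N.sh P (N.t0 Q R) P' (N.t0 Q' R'))) := by
  have h := congrArg N.idn (N.sh_assoc3 P Q R P' Q' R')
  rw [N.idn_comp, N.idn_comp, ← N.t2_idn, ← N.t2_idn] at h
  have e1 : N.t2 (N.hc (N.t2 p q) (N.idn (N.sh P Q P' Q'))) r =
      N.hc (N.t2 p (N.t2 q r)) (N.t2 (N.idn (N.sh P Q P' Q')) (N.idn (N.one (N.t0 R R')))) := by
    rw [← N.t2_assoc, ← N.t2_hc] <;> simp [hp, hq, hr]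
  have e2 : N.t2 p (N.hc (N.t2 q r) (N.idn (N.sh Q R Q' R'))) =
      N.hc (N.t2 p (N.t2 q r)) (N.t2 (N.idn (N.one (N.t0 P P'))) (N.idn (N.sh Q R Q' R'))) := by
    rw [← N.t2_hc] <;> simp [hp, hq, hr]
  rw [e1, e2, N.hc_assoc, N.hc_assoc, h] <;> simp [hp, hq, hr]
  all_goals simp

theorem word_assoc1 (p q r : N.Ar) (P P' Q Q' R R' : N.Ob)
    (hp : N.dom p = N.t0 P P') (hq : N.dom q = N.t0 Q Q')
    (hr : N.dom r = N.t0 R R') :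
    N.comp (N.t1 (N.comp (N.t1 p q) (N.sh P Q P' Q')) r)
      (N.sh (N.t0 P Q) R (N.t0 P' Q') R') =
    N.comp (N.t1 p (N.comp (N.t1 q r) (N.sh Q R Q' R')))
      (N.sh P (N.t0 Q R) P' (N.t0 Q' R')) := by
  have h := congrArg N.src (N.word_assoc2 (N.idn p) (N.idn q) (N.idn r) P P' Q Q' R R'
    (by simpa) (by simpa) (by simpa))
  simpa [hp, hq, hr] using h

theorem word_assoc3 (p q r : N.Ce) (P P' P'' Q Q' Q'' R R' R'' : N.Ob)
    (hp : N.dom (N.src p) = N.t0 P (N.t0 P' P'')) (hq : N.dom (N.src q) = N.t0 Q (N.t0 Q' Q''))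
    (hr : N.dom (N.src r) = N.t0 R (N.t0 R' R'')) :
    N.hc (N.t2 (N.hc (N.t2 p q) (N.idn (N.sh3 P Q P' Q' P'' Q''))) r)
      (N.idn (N.sh3 (N.t0 P Q) R (N.t0 P' Q') R' (N.t0 P'' Q'') R'')) =
    N.hc (N.t2 p (N.hc (N.t2 q r) (N.idn (N.sh3 Q R Q' R' Q'' R''))))
      (N.idn (N.sh3 P (N.t0 Q R) P' (N.t0 Q' R') P'' (N.t0 Q'' R''))) := by
  have h := congrArg N.idn (N.sh3_assoc3 P Q R P' Q' R' P'' Q'' R'')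
  rw [N.idn_comp, N.idn_comp, ← N.t2_idn, ← N.t2_idn] at h
  have e1 : N.t2 (N.hc (N.t2 p q) (N.idn (N.sh3 P Q P' Q' P'' Q''))) r =
      N.hc (N.t2 p (N.t2 q r)) (N.t2 (N.idn (N.sh3 P Q P' Q' P'' Q''))
        (N.idn (N.one (N.t0 R (N.t0 R' R''))))) := by
    rw [← N.t2_assoc, ← N.t2_hc] <;> simp [hp, hq, hr]
  have e2 : N.t2 p (N.hc (N.t2 q r) (N.idn (N.sh3 Q R Q' R' Q'' R''))) =
      N.hc (N.t2 p (N.t2 q r)) (N.t2 (N.idn (N.one (N.t0 P (N.t0 P' P''))))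
        (N.idn (N.sh3 Q R Q' R' Q'' R''))) := by
    rw [← N.t2_hc] <;> simp [hp, hq, hr]
  rw [e1, e2, N.hc_assoc, N.hc_assoc, h] <;> simp [hp, hq, hr]
  all_goals simp

end SM2Cat

namespace SM2Cat

namespace Pseudomonoid
variable {N : SM2Cat.{u}}

theorem tensor_assoc (P Q R : Pseudomonoid N) :
    (P.tensor Q).tensor R = P.tensor (Q.tensor R) := by
  ext
  · simp [tensor]
  · simpa [tensor] using N.word_assoc1 P.m Q.m R.m P.A P.A Q.A Q.A R.A R.A (by simp) (by simp)
      (by simp)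
  · simp [tensor, N.t1_assoc]
  · simpa [tensor] using N.word_assoc3 P.α Q.α R.α P.A P.A P.A Q.A Q.A Q.A R.A R.A R.A (by simp)
      (by simp) (by simp)
  · simp [tensor, N.t2_assoc]
  · simp [tensor, N.t2_assoc]

theorem unit_tensor (P : Pseudomonoid N) : (unit N).tensor P = P := by
  ext <;> simp (maxDischargeDepth := 8) [tensor, unit, sh, br_I_left, br_I_right, sh3]

theorem tensor_unit (P : Pseudomonoid N) : P.tensor (unit N) = P := by
  ext <;> simp (maxDischargeDepth := 8) [tensor, unit, sh, br_I_left, br_I_right, sh3]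

end Pseudomonoid

namespace MonArrow
variable {N : SM2Cat.{u}}

theorem comp_one (F : MonArrow N) : F.comp (one F.P) rfl = F := by
  ext <;> simp [comp, one, ← N.idn_comp]

theorem one_comp (F : MonArrow N) : (one F.Q).comp F rfl = F := by
  ext <;> simp [comp, one, N.t2_idn, ← N.idn_comp]

theorem comp_assoc (H G F : MonArrow N) (h : H.P = G.Q) (h' : G.P = F.Q) :
    (H.comp G h).comp F h' = H.comp (G.comp F h') h := by
  ext1
  · rfl
  · rfl
  · simp [comp, N.comp_assoc, h, h']
  · simp (maxDischargeDepth := 8) [comp, h, h', N.idn_comp, N.comp_assoc, N.hc_assoc, w_hc_vc, vc_hc_w, N.vc_assoc,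
      ← N.t2_idn, N.t2_hc]
  · simp (maxDischargeDepth := 8) [comp, h, h', N.idn_comp, N.comp_assoc, N.hc_assoc, w_hc_vc, vc_hc_w, N.vc_assoc]

theorem tensor_one (P Q : Pseudomonoid N) : (one P).tensor (one Q) = one (P.tensor Q) := by
  ext <;> simp [tensor, one, Pseudomonoid.tensor, N.t2_idn, ← N.idn_comp]

theorem tensor_comp (G F G' F' : MonArrow N) (h : G.P = F.Q) (h' : G'.P = F'.Q) :
    (G.comp F h).tensor (G'.comp F' h') =
      (G.tensor G').comp (F.tensor F') (by simp [tensor, h, h']) := by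
  ext1
  · rfl
  · rfl
  · simp [comp, tensor, N.t1_comp, h, h']
  · have e := N.sh_word2 G.φ₂ G'.φ₂ (N.idn F.f) (N.idn F'.f) (N.idn F.f) (N.idn F'.f)
      (N.one (N.t0 F.P.A F'.P.A)) (N.one (N.t0 F.P.A F'.P.A))
      (by simp [h]) (by simp [h']) (by simp) (by simp) _ _ _ _ rfl rfl rfl rfl
    simp [N.t2_assoc] at e
    simp [comp, tensor, h, h', ← N.t2_idn, N.t2_assoc]
    rw [e, ← N.hc_assoc, ← N.t2_hc, vc_word] <;> simp [h, h', N.comp_assoc]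
  · simp [comp, tensor, h, h', N.t2_vc, ← N.t2_idn, N.t2_hc]

theorem tensor_assoc (F G H : MonArrow N) :
    (F.tensor G).tensor H = F.tensor (G.tensor H) := by
  ext1
  · exact Pseudomonoid.tensor_assoc _ _ _
  · exact Pseudomonoid.tensor_assoc _ _ _
  · simp [tensor, N.t1_assoc]
  · simpa [tensor, Pseudomonoid.tensor] using N.word_assoc2 F.φ₂ G.φ₂ H.φ₂ F.P.A F.P.A G.P.A G.P.A
      H.P.A H.P.A (by simp) (by simp) (by simp)
  · simp [tensor, N.t2_assoc]

theorem unit_tensor (F : MonArrow N) : (one (Pseudomonoid.unit N)).tensor F = F := by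
  ext1
  · exact Pseudomonoid.unit_tensor _
  · exact Pseudomonoid.unit_tensor _
  all_goals simp (maxDischargeDepth := 8) [tensor, one, Pseudomonoid.unit, sh, br_I_left, br_I_right]

theorem tensor_unit (F : MonArrow N) : F.tensor (one (Pseudomonoid.unit N)) = F := by
  ext1
  · exact Pseudomonoid.tensor_unit _
  · exact Pseudomonoid.tensor_unit _
  all_goals simp (maxDischargeDepth := 8) [tensor, one, Pseudomonoid.unit, sh, br_I_left, br_I_right]

/-- Auxiliary: both structure 2-cells are identities. -/
def Str (F : MonArrow N) : Prop := (∃ z, F.φ₂ = N.idn z) ∧ ∃ z, F.φ₀ = N.idn z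

theorem Str.eq {F G : MonArrow N} (hF : F.Str) (hG : G.Str) (hP : F.P = G.P) (hQ : F.Q = G.Q)
    (hf : F.f = G.f) : F = G := by
  obtain ⟨⟨a, ha⟩, b, hb⟩ := hF
  obtain ⟨⟨c, hc⟩, d, hd⟩ := hG
  have a1 := F.src_φ₂
  have b1 := F.src_φ₀
  have c1 := G.src_φ₂
  have d1 := G.src_φ₀
  rw [ha, N.src_idn] at a1
  rw [hb, N.src_idn] at b1
  rw [hc, N.src_idn] at c1
  rw [hd, N.src_idn] at d1
  ext1
  · exact hP
  · exact hQ
  · exact hf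
  · rw [ha, hc, a1, c1, hQ, hf]
  · rw [hb, hd, b1, d1, hQ]

theorem vc_right_id {x y : N.Ce} (h : N.idn (N.src y) = y) (hx : N.src x = N.tgt y) :
    N.vc x y = x := by
  rw [← h, N.tgt_idn] at hx
  rw [← h, vc_idn_of _ _ _ hx]

theorem vc_left_id {x y : N.Ce} (h : N.idn (N.src x) = x) (hx : N.src x = N.tgt y) :
    N.vc x y = y := by
  rw [← h, idn_vc_of _ _ _ hx.symm]

theorem vc_idns {x y : N.Ar} (h : x = y) : N.vc (N.idn x) (N.idn y) = N.idn y := by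
  subst h; simp

theorem Str.comp {G F : MonArrow N} (hG : G.Str) (hF : F.Str) (h : G.P = F.Q) :
    (G.comp F h).Str := by
  obtain ⟨⟨a, ha⟩, b, hb⟩ := hF
  obtain ⟨⟨c, hc⟩, d, hd⟩ := hG
  have a1 := F.src_φ₂
  have a2 := F.tgt_φ₂
  have b1 := F.src_φ₀
  have c1 := G.src_φ₂
  have c2 := G.tgt_φ₂
  have d1 := G.src_φ₀
  have d2 := G.tgt_φ₀
  rw [ha, N.src_idn] at a1
  rw [ha, N.tgt_idn] at a2
  rw [hb, N.src_idn] at b1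
  rw [hc, N.src_idn] at c1
  rw [hc, N.tgt_idn] at c2
  rw [hd, N.src_idn] at d1
  rw [hd, N.tgt_idn] at d2
  have k1 : N.dom G.f = N.cod a := by rw [a1]; simp [h]
  have k2 : N.dom c = N.cod (N.t1 F.f F.f) := by rw [c1]; simp [h]
  have k3 : N.dom G.f = N.cod b := by rw [b1]; simp [h]
  refine ⟨⟨N.comp c (N.t1 F.f F.f), ?_⟩, d, ?_⟩
  · simp only [MonArrow.comp]
    rw [ha, hc, N.t2_idn, ← N.idn_comp _ _ k1, ← N.idn_comp _ _ k2]
    apply vc_idns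
    rw [c2, a1, N.comp_assoc, h] <;> simp [h]
  · simp only [MonArrow.comp]
    rw [hb, hd, ← N.idn_comp _ _ k3]
    apply vc_idns
    rw [d2, b1, h]

theorem Str.tensor {G F : MonArrow N} (hG : G.Str) (hF : F.Str) : (G.tensor F).Str := by
  obtain ⟨⟨a, ha⟩, b, hb⟩ := hF
  obtain ⟨⟨c, hc⟩, d, hd⟩ := hG
  have a1 := F.src_φ₂
  have c1 := G.src_φ₂
  rw [ha, N.src_idn] at a1
  rw [hc, N.src_idn] at c1
  refine ⟨⟨N.comp (N.t1 c a) (N.sh G.P.A F.P.A G.P.A F.P.A), ?_⟩, N.t1 d b, ?_⟩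
  · simp only [MonArrow.tensor]
    rw [ha, hc, N.t2_idn, ← N.idn_comp]
    simp [a1, c1]
  · simp only [MonArrow.tensor]
    rw [hb, hd, N.t2_idn]

theorem Str.braid (P Q : Pseudomonoid N) : (braid P Q).Str := ⟨⟨_, rfl⟩, _, rfl⟩

theorem Str.one (P : Pseudomonoid N) : (one P).Str := ⟨⟨_, rfl⟩, _, rfl⟩

theorem braid_nat (F G : MonArrow N) :
    (braid F.Q G.Q).comp (F.tensor G) rfl = (G.tensor F).comp (braid F.P G.P) rfl := by
  ext1
  · rfl
  · rfl
  · simpa [comp, braid, ofStrict, tensor] using N.br_nat1 F.f G.f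
  · have h1 := N.br_nat2 F.φ₂ G.φ₂
    have h2 := N.sh_br F.P.A G.P.A F.P.A G.P.A
    have h3 := braid_src F.P G.P
    simp [comp, braid, ofStrict, tensor] at h1 ⊢
    have r1 := N.sh_word1 F.Q.m G.Q.m F.f G.f F.f G.f (N.one (N.t0 F.P.A G.P.A))
      (N.one (N.t0 F.P.A G.P.A)) (by simp) (by simp) (by simp) (by simp) _ _ _ _ rfl rfl rfl rfl
    simp at r1
    rw [vc_right_id, vc_left_id, ← N.hc_assoc, h1, N.hc_assoc, N.hc_assoc, ← N.idn_comp, ← h2,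
      N.t2_idn, N.idn_comp]
    all_goals try (simp [N.t2_idn, ← N.idn_comp]; done)
    · rw [← N.idn_comp] <;> simp [Pseudomonoid.tensor]
    · rw [N.src_hc, N.tgt_hc, N.src_idn, N.src_idn, ← h3]
      · have r2 := N.t1_comp G.f G.P.m F.f F.P.m (by simp) (by simp)
        simp [Pseudomonoid.tensor, r2]
        rw [N.comp_assoc, N.comp_assoc, N.comp_assoc] <;> simp
      all_goals simp [Pseudomonoid.tensor]
    · rw [N.t2_idn, ← N.idn_comp] <;> simp [Pseudomonoid.tensor]
    · simp (maxDischargeDepth := 8) [Pseudomonoid.tensor, ← r1, N.comp_assoc]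
  · have h1 := N.br_nat2 F.φ₀ G.φ₀
    simp [comp, braid, ofStrict, tensor, br_I_left] at h1 ⊢
    rw [h1, vc_idn_of, ← N.idn_comp, idn_vc_of] <;> simp [Pseudomonoid.tensor, N.t1_comp]

theorem braid_braid (P Q : Pseudomonoid N) :
    (braid Q P).comp (braid P Q) rfl = one (P.tensor Q) := by
  apply Str.eq ((Str.braid _ _).comp (Str.braid _ _) _) (Str.one _) rfl rfl
  simp [comp, braid, ofStrict, one, Pseudomonoid.tensor, N.br_br]

theorem braid_tensor (P Q R : Pseudomonoid N) :
    braid P (Q.tensor R) = ((one Q).tensor (braid P R)).comp ((braid P Q).tensor (one R))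
      (by simp [tensor, one, braid, ofStrict, Pseudomonoid.tensor_assoc]) := by
  apply Str.eq (Str.braid _ _) (((Str.one _).tensor (Str.braid _ _)).comp
    ((Str.braid _ _).tensor (Str.one _)) _)
  · exact (Pseudomonoid.tensor_assoc _ _ _).symm
  · exact (Pseudomonoid.tensor_assoc _ _ _)
  · simp [comp, braid, tensor, ofStrict, one, Pseudomonoid.tensor, N.br_t0]

end MonArrow

namespace MonTrans
variable {N : SM2Cat.{u}}

theorem tensor_idn (F G : MonArrow N) : (idn F).tensor (idn G) = idn (F.tensor G) := by
  ext1 <;> simp [idn, tensor, MonArrow.tensor, N.t2_idn]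

theorem tensor_hc (b a b' a' : MonTrans N) (h : b.F.P = a.F.Q) (h' : b'.F.P = a'.F.Q) :
    (b.hc a h).tensor (b'.hc a' h') =
      (b.tensor b').hc (a.tensor a') (by simp [tensor, MonArrow.tensor, h, h']) := by
  ext1
  · exact MonArrow.tensor_comp _ _ _ _ h h'
  · exact MonArrow.tensor_comp _ _ _ _ (by rw [b.hP, h, a.hQ]) (by rw [b'.hP, h', a'.hQ])
  · simp [hc, tensor, N.t2_hc, h, h']

theorem tensor_vc (b a b' a' : MonTrans N) (h : b.F = a.G) (h' : b'.F = a'.G) :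
    (b.vc a h).tensor (b'.vc a' h') =
      (b.tensor b').vc (a.tensor a') (by simp [tensor, h, h']) := by
  ext1
  · rfl
  · rfl
  · simp [vc, tensor, N.t2_vc, h, h']

theorem tensor_assoc (a b c : MonTrans N) :
    (a.tensor b).tensor c = a.tensor (b.tensor c) := by
  ext1
  · exact MonArrow.tensor_assoc _ _ _
  · exact MonArrow.tensor_assoc _ _ _
  · simp [tensor, N.t2_assoc]

theorem unit_tensor (a : MonTrans N) : (idn (MonArrow.one (Pseudomonoid.unit N))).tensor a = a := by
  ext1
  · exact MonArrow.unit_tensor _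
  · exact MonArrow.unit_tensor _
  · simp [tensor, idn, MonArrow.one, Pseudomonoid.unit]

theorem tensor_unit (a : MonTrans N) : a.tensor (idn (MonArrow.one (Pseudomonoid.unit N))) = a := by
  ext1
  · exact MonArrow.tensor_unit _
  · exact MonArrow.tensor_unit _
  · simp [tensor, idn, MonArrow.one, Pseudomonoid.unit]

theorem braid_nat (a b : MonTrans N) :
    (idn (MonArrow.braid a.F.Q b.F.Q)).hc (a.tensor b) rfl =
      (b.tensor a).hc (idn (MonArrow.braid a.F.P b.F.P)) rfl := by
  ext1
  · exact MonArrow.braid_nat _ _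
  · have h := MonArrow.braid_nat a.G b.G
    simpa [hc, idn, tensor, a.hP, a.hQ, b.hP, b.hQ] using h
  · have h := N.br_nat2 a.ω b.ω
    simpa [hc, idn, tensor, MonArrow.braid, MonArrow.ofStrict] using h

end MonTrans
end SM2Cat

namespace SM2Cat

open Classical in
/-- The symmetric strict monoidal 2-category `M₁₀` of pseudomonoids, monoidal 1-cells and monoidal
2-cells in `M`. -/
noncomputable def tenZero (N : SM2Cat.{u}) : SM2Cat.{u} where
  Ob := Pseudomonoid N
  Ar := MonArrow N
  Ce := MonTrans N
  dom := MonArrow.P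
  cod := MonArrow.Q
  src := MonTrans.F
  tgt := MonTrans.G
  one := MonArrow.one
  idn := MonTrans.idn
  comp G F := if h : G.P = F.Q then G.comp F h else G
  hc b a := if h : b.F.P = a.F.Q then b.hc a h else b
  vc b a := if h : b.F = a.G then b.vc a h else b
  I := Pseudomonoid.unit N
  t0 := Pseudomonoid.tensor
  t1 := MonArrow.tensor
  t2 := MonTrans.tensor
  br := MonArrow.braid
  dom_tgt a := a.hP
  cod_tgt a := a.hQ
  dom_one _ := rfl
  cod_one _ := rfl
  src_idn _ := rfl
  tgt_idn _ := rfl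
  dom_comp g f h := by simp only [dif_pos h]; rfl
  cod_comp g f h := by simp only [dif_pos h]; rfl
  src_hc b a h := by
    simp only [dif_pos h]; rfl
  tgt_hc b a h := by
    have h' : b.G.P = a.G.Q := by rw [b.hP, h, a.hQ]
    simp only [dif_pos h, dif_pos h']; rfl
  src_vc b a h := by simp only [dif_pos h]; rfl
  tgt_vc b a h := by simp only [dif_pos h]; rfl
  comp_one f := by
    have h : f.P = (MonArrow.one f.P).Q := rfl
    simp only [dif_pos h]; exact f.comp_one
  one_comp f := by
    have h : (MonArrow.one f.Q).P = f.Q := rfl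
    simp only [dif_pos h]; exact f.one_comp
  comp_assoc h g f h1 h2 := by
    have h3 : (h.comp g h1).P = f.Q := h2
    have h4 : h.P = (g.comp f h2).Q := h1
    simp only [dif_pos h1, dif_pos h2, dif_pos h3, dif_pos h4]
    exact MonArrow.comp_assoc _ _ _ _ _
  vc_idn a := by
    have h : a.F = (MonTrans.idn a.F).G := rfl
    simp only [dif_pos h]
    ext1 <;> simp [MonTrans.vc, MonTrans.idn]
  idn_vc a := by
    have h : (MonTrans.idn a.G).F = a.G := rfl
    simp only [dif_pos h]
    ext1 <;> simp [MonTrans.vc, MonTrans.idn]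
  vc_assoc c b a h1 h2 := by
    have h3 : (c.vc b h1).F = a.G := h2
    have h4 : c.F = (b.vc a h2).G := h1
    simp only [dif_pos h1, dif_pos h2, dif_pos h3, dif_pos h4]
    ext1
    · rfl
    · rfl
    · simp [MonTrans.vc, N.vc_assoc, h1, h2]
  hc_one a := by
    have h : a.F.P = (MonTrans.idn (MonArrow.one a.F.P)).F.Q := rfl
    simp only [dif_pos h]
    ext1
    · exact a.F.comp_one
    · have e := a.G.comp_one
      simpa only [MonTrans.hc, MonTrans.idn, a.hP] using e
    · simp [MonTrans.hc, MonTrans.idn, MonArrow.one]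
  one_hc a := by
    have h : (MonTrans.idn (MonArrow.one a.F.Q)).F.P = a.F.Q := rfl
    simp only [dif_pos h]
    ext1
    · exact a.F.one_comp
    · have e := a.G.one_comp
      simpa only [MonTrans.hc, MonTrans.idn, a.hQ] using e
    · simp [MonTrans.hc, MonTrans.idn, MonArrow.one]
  hc_assoc c b a h1 h2 := by
    have h3 : (c.hc b h1).F.P = a.F.Q := h2
    have h4 : c.F.P = (b.hc a h2).F.Q := h1
    simp only [dif_pos h1, dif_pos h2, dif_pos h3, dif_pos h4]
    ext1
    · exact MonArrow.comp_assoc _ _ _ h1 h2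
    · exact MonArrow.comp_assoc _ _ _ (by rw [c.hP, h1, b.hQ]) (by rw [b.hP, h2, a.hQ])
    · simp [MonTrans.hc, N.hc_assoc, h1, h2]
  idn_comp g f h := by
    have h' : (MonTrans.idn g).F.P = (MonTrans.idn f).F.Q := h
    simp only [dif_pos h, dif_pos h']
    ext1
    · rfl
    · rfl
    · simp [MonTrans.hc, MonTrans.idn, MonArrow.comp, h, N.idn_comp]
  interchange b' b a' a h1 h2 h3 := by
    have h4 : b'.F.P = a'.F.Q := by rw [h1, h2, b.hP, h3, a.hQ]
    have h5 : (b'.vc b h1).F.P = (a'.vc a h2).F.Q := h3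
    have h6 : (b'.hc a' h4).F = (b.hc a h3).G := by simp [MonTrans.hc, h1, h2]
    simp only [dif_pos h1, dif_pos h2, dif_pos h3, dif_pos h4, dif_pos h5, dif_pos h6]
    ext1
    · rfl
    · rfl
    · simp [MonTrans.hc, MonTrans.vc, N.interchange, h1, h2, h3]
  dom_t1 _ _ := rfl
  cod_t1 _ _ := rfl
  src_t2 _ _ := rfl
  tgt_t2 _ _ := rfl
  t1_one := MonArrow.tensor_one
  t2_idn := MonTrans.tensor_idn
  t1_comp g f g' f' h h' := by
    have h1 : (g.tensor g').P = (f.tensor f').Q := by simp [MonArrow.tensor, h, h']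
    simp only [dif_pos h, dif_pos h', dif_pos h1]
    exact MonArrow.tensor_comp _ _ _ _ _ _
  t2_hc b a b' a' h h' := by
    have h1 : (b.tensor b').F.P = (a.tensor a').F.Q := by
      simp [MonTrans.tensor, MonArrow.tensor, h, h']
    simp only [dif_pos h, dif_pos h', dif_pos h1]
    exact MonTrans.tensor_hc _ _ _ _ _ _
  t2_vc b a b' a' h h' := by
    have h1 : (b.tensor b').F = (a.tensor a').G := by simp [MonTrans.tensor, h, h']
    simp only [dif_pos h, dif_pos h', dif_pos h1]
    exact MonTrans.tensor_vc _ _ _ _ _ _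
  t0_assoc := Pseudomonoid.tensor_assoc
  t1_assoc := MonArrow.tensor_assoc
  t2_assoc := MonTrans.tensor_assoc
  I_t0 := Pseudomonoid.unit_tensor
  t0_I := Pseudomonoid.tensor_unit
  I_t1 := MonArrow.unit_tensor
  t1_I := MonArrow.tensor_unit
  I_t2 := MonTrans.unit_tensor
  t2_I := MonTrans.tensor_unit
  dom_br _ _ := rfl
  cod_br _ _ := rfl
  br_nat1 f g := by
    have h1 : (MonArrow.braid f.Q g.Q).P = (f.tensor g).Q := rfl
    have h2 : (g.tensor f).P = (MonArrow.braid f.P g.P).Q := rfl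
    simp only [dif_pos h1, dif_pos h2]
    exact MonArrow.braid_nat f g
  br_nat2 a b := by
    have h1 : (MonTrans.idn (MonArrow.braid a.F.Q b.F.Q)).F.P = (a.tensor b).F.Q := rfl
    have h2 : (b.tensor a).F.P = (MonTrans.idn (MonArrow.braid a.F.P b.F.P)).F.Q := rfl
    simp only [dif_pos h1, dif_pos h2]
    exact MonTrans.braid_nat a b
  br_br A B := by
    have h1 : (MonArrow.braid B A).P = (MonArrow.braid A B).Q := rfl
    simp only [dif_pos h1]
    exact MonArrow.braid_braid A B
  br_t0 A B C := by
    have h1 : ((MonArrow.one B).tensor (MonArrow.braid A C)).P =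
        ((MonArrow.braid A B).tensor (MonArrow.one C)).Q := by
      simp [MonArrow.tensor, MonArrow.one, MonArrow.braid, MonArrow.ofStrict,
        Pseudomonoid.tensor_assoc]
    simp only [dif_pos h1]
    exact MonArrow.braid_tensor A B C

end SM2Cat

namespace SM2Cat

/-- A monad `(A, t, μ, η)` in a 2-category. -/
@[ext]
structure MonadIn (N : TwoCat.{u}) : Type u where
  /-- the base object -/
  A : N.Ob
  /-- the underlying 1-cell -/
  t : N.Ar
  /-- multiplication `t.t → t` -/
  μ : N.Ce
  /-- unit `1 → t` -/
  η : N.Ce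
  dom_t : N.dom t = A
  cod_t : N.cod t = A
  src_μ : N.src μ = N.comp t t
  tgt_μ : N.tgt μ = t
  src_η : N.src η = N.one A
  tgt_η : N.tgt η = t
  assoc : N.vc μ (N.hc μ (N.idn t)) = N.vc μ (N.hc (N.idn t) μ)
  unit_left : N.vc μ (N.hc η (N.idn t)) = N.idn t
  unit_right : N.vc μ (N.hc (N.idn t) η) = N.idn t

attribute [simp] MonadIn.dom_t MonadIn.cod_t MonadIn.src_μ MonadIn.tgt_μ MonadIn.src_η
  MonadIn.tgt_η

namespace MonadIn

/-- The identity monad on a 0-cell. -/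
def trivial (M : SM2Cat.{u}) (X : M.Ob) : MonadIn M.toTwoCat where
  A := X
  t := M.one X
  μ := M.idn (M.one X)
  η := M.idn (M.one X)
  dom_t := by simp
  cod_t := by simp
  src_μ := by simp
  tgt_μ := by simp
  src_η := by simp
  tgt_η := by simp
  assoc := by simp
  unit_left := by simp
  unit_right := by simp

/-- The monoidal product of monads. -/
def tensor {M : SM2Cat.{u}} (T S : MonadIn M.toTwoCat) : MonadIn M.toTwoCat where
  A := M.t0 T.A S.A
  t := M.t1 T.t S.t
  μ := M.t2 T.μ S.μ
  η := M.t2 T.η S.η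
  dom_t := by simp
  cod_t := by simp
  src_μ := by simp [M.t1_comp]
  tgt_μ := by simp
  src_η := by simp
  tgt_η := by simp
  assoc := by
    rw [← M.t2_idn, ← M.t2_hc, ← M.t2_hc, ← M.t2_vc, ← M.t2_vc, T.assoc, S.assoc] <;> simp
  unit_left := by
    rw [← M.t2_idn, ← M.t2_hc, ← M.t2_vc, T.unit_left, S.unit_left] <;> simp
  unit_right := by
    rw [← M.t2_idn, ← M.t2_hc, ← M.t2_vc, T.unit_right, S.unit_right] <;> simp

/-- The monad in `M` underlying a monad in `M₁₀`. -/
noncomputable def under {M : SM2Cat.{u}} (T : MonadIn M.tenZero.toTwoCat) :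
    MonadIn M.toTwoCat :=
  let A : Pseudomonoid M := T.A
  let t : MonArrow M := T.t
  let μ : MonTrans M := T.μ
  let η : MonTrans M := T.η
  have hd : t.P = A := T.dom_t
  have hc : t.Q = A := T.cod_t
  have h : t.P = t.Q := hd.trans hc.symm
  have hμs : μ.F = t.comp t h := T.src_μ.trans (dif_pos h)
  have hμt : μ.G = t := T.tgt_μ
  have hηs : η.F = MonArrow.one A := T.src_η
  have hηt : η.G = t := T.tgt_η
  { A := A.A
    t := t.f
    μ := μ.ω
    η := η.ω
    dom_t := by rw [t.dom_f, hd]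
    cod_t := by rw [t.cod_f, hc]
    src_μ := by rw [μ.src_ω, hμs]; rfl
    tgt_μ := by rw [μ.tgt_ω, hμt]
    src_η := by rw [η.src_ω, hηs]; rfl
    tgt_η := by rw [η.tgt_ω, hηt]
    assoc := by
      have h1 : μ.F.P = (MonTrans.idn t).F.Q := by rw [hμs]; exact h
      have h2 : (MonTrans.idn t).F.P = μ.F.Q := by rw [hμs]; exact h
      have h3 : μ.F = (μ.hc (MonTrans.idn t) h1).G := by
        simp only [MonTrans.hc, MonTrans.idn, hμs, hμt]
      have h4 : μ.F = ((MonTrans.idn t).hc μ h2).G := by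
        simp only [MonTrans.hc, MonTrans.idn, hμs, hμt]
      have e1 : M.tenZero.hc T.μ (M.tenZero.idn T.t) = μ.hc (MonTrans.idn t) h1 := dif_pos h1
      have e2 : M.tenZero.hc (M.tenZero.idn T.t) T.μ = (MonTrans.idn t).hc μ h2 := dif_pos h2
      have e := T.assoc
      rw [e1, e2] at e
      have e3 : M.tenZero.vc T.μ (μ.hc (MonTrans.idn t) h1) = μ.vc _ h3 := dif_pos h3
      have e4 : M.tenZero.vc T.μ ((MonTrans.idn t).hc μ h2) = μ.vc _ h4 := dif_pos h4
      rw [e3, e4] at e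
      exact congrArg MonTrans.ω e
    unit_left := by
      have h1 : η.F.P = (MonTrans.idn t).F.Q := by rw [hηs]; exact hc.symm
      have h3 : μ.F = (η.hc (MonTrans.idn t) h1).G := by
        simp only [MonTrans.hc, MonTrans.idn, hμs, hηt]
      have e1 : M.tenZero.hc T.η (M.tenZero.idn T.t) = η.hc (MonTrans.idn t) h1 := dif_pos h1
      have e := T.unit_left
      rw [e1] at e
      have e3 : M.tenZero.vc T.μ (η.hc (MonTrans.idn t) h1) = μ.vc _ h3 := dif_pos h3
      rw [e3] at e
      exact congrArg MonTrans.ω e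
    unit_right := by
      have h2 : (MonTrans.idn t).F.P = η.F.Q := by rw [hηs]; exact hd
      have h4 : μ.F = ((MonTrans.idn t).hc η h2).G := by
        simp only [MonTrans.hc, MonTrans.idn, hμs, hηt]
      have e2 : M.tenZero.hc (M.tenZero.idn T.t) T.η = (MonTrans.idn t).hc η h2 := dif_pos h2
      have e := T.unit_right
      rw [e2] at e
      have e4 : M.tenZero.vc T.μ ((MonTrans.idn t).hc η h2) = μ.vc _ h4 := dif_pos h4
      rw [e4] at e
      exact congrArg MonTrans.ω e }

end MonadIn

/-- The 2-category `M_{p0}`, obtained by applying `M ↦ M₁₀` to `M` repeatedly, `p` times. -/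
noncomputable def oidal (M : SM2Cat.{u}) : ℕ → SM2Cat.{u}
  | 0 => M
  | p + 1 => (oidal M p).tenZero

variable (M : SM2Cat.{u})

/-- The 0-cell of `M` underlying a 0-cell of `M_{p0}` (a `p`-oidal object). -/
noncomputable def base0 : (p : ℕ) → (M.oidal p).Ob → M.Ob
  | 0, A => A
  | p + 1, A => base0 p (Pseudomonoid.A (N := M.oidal p) A)

/-- The 1-cell of `M` underlying a 1-cell of `M_{p0}`. -/
noncomputable def base1 : (p : ℕ) → (M.oidal p).Ar → M.Ar
  | 0, F => F
  | p + 1, F => base1 p (MonArrow.f (N := M.oidal p) F)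

/-- The 2-cell of `M` underlying a 2-cell of `M_{p0}`. -/
noncomputable def base2 : (p : ℕ) → (M.oidal p).Ce → M.Ce
  | 0, a => a
  | p + 1, a => base2 p (MonTrans.ω (N := M.oidal p) a)

/-- The monad in `M` underlying a `(p,0)`-oidal monad, that is, a monad in `M_{p0}`. -/
noncomputable def baseMonad : (p : ℕ) → MonadIn (M.oidal p).toTwoCat → MonadIn M.toTwoCat
  | 0, T => T
  | p + 1, T => baseMonad p (MonadIn.under (M := M.oidal p) T)

/-- A 1-cell of `M_{p0}` is strong if the binary and nullary parts of all of its `p` monoidal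
structures are invertible. -/
def IsStrong : (p : ℕ) → (M.oidal p).Ar → Prop
  | 0, _ => True
  | p + 1, F => IsStrong p (MonArrow.f (N := M.oidal p) F) ∧
      IsInv (M.oidal p).toTwoCat (MonArrow.φ₂ (N := M.oidal p) F) ∧
      IsInv (M.oidal p).toTwoCat (MonArrow.φ₀ (N := M.oidal p) F)

/-- A 1-cell `F : A → B` of `M_{p0}` is strict if the binary and nullary parts of all of its `p`
monoidal structures are identity 2-cells; so the multiplications and units of `B` are literally liftings of those
of `A`: each multiplication `n` of `B` satisfies `n.FF = F.m` for that of `A`, and each unit `v` of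
`B` satisfies `v = F.u`. -/
def IsStrict : (p : ℕ) → (M.oidal p).Ar → Prop
  | 0, _ => True
  | p + 1, F => IsStrict p (MonArrow.f (N := M.oidal p) F) ∧
      MonArrow.φ₂ (N := M.oidal p) F =
        (M.oidal p).idn ((M.oidal p).src (MonArrow.φ₂ (N := M.oidal p) F)) ∧
      MonArrow.φ₀ (N := M.oidal p) F =
        (M.oidal p).idn ((M.oidal p).src (MonArrow.φ₀ (N := M.oidal p) F))

end SM2Cat

open SM2Cat

/-- An action of the monad `(A, t)` on a 1-cell `g : X → A`: a 2-cell `φ : t.g → g` which is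
associative and unital.  Equivalently, `(g, φ)` is a 1-cell `(X, 1) → (A, t)` of `Mnd(N)`. -/
structure IsAction {N : TwoCat.{u}} (T : MonadIn N) (g : N.Ar) (φ : N.Ce) : Prop where
  cod_g : N.cod g = T.A
  src_φ : N.src φ = N.comp T.t g
  tgt_φ : N.tgt φ = g
  assoc : N.vc φ (N.hc (N.idn T.t) φ) = N.vc φ (N.hc T.μ (N.idn g))
  unit : N.vc φ (N.hc T.η (N.idn g)) = N.idn g

/-- A 2-cell `(g, φ) → (g', φ')` between 1-cells `(X, 1) → (A, t)` of `Mnd(N)`. -/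
structure IsActionMap {N : TwoCat.{u}} (T : MonadIn N) (g : N.Ar) (φ : N.Ce) (g' : N.Ar)
    (φ' : N.Ce) (ω : N.Ce) : Prop where
  src_ω : N.src ω = g
  tgt_ω : N.tgt ω = g'
  comm : N.vc ω φ = N.vc φ' (N.hc (N.idn T.t) ω)

/-- Eilenberg–Moore construction: a right 2-adjoint of the inclusion `N → Mnd(N)`, presented by
its values `A^t = obj (A, t)` and its counit `(u, θ) : (A^t, 1) → (A, t)`.  The universal property
says that `k ↦ (u.k, θ.k)`, `κ ↦ u.κ` is an isomorphism of categories
`N(X, A^t) ≅ Mnd(N)((X, 1), (A, t))` for every 0-cell `X`. -/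
structure EMConstruction (N : TwoCat.{u}) where
  /-- the Eilenberg–Moore object -/
  obj : MonadIn N → N.Ob
  /-- the forgetful 1-cell `A^t → A` -/
  u : MonadIn N → N.Ar
  /-- the universal action `t.u → u` -/
  θ : MonadIn N → N.Ce
  dom_u : ∀ T, N.dom (u T) = obj T
  action : ∀ T, IsAction T (u T) (θ T)
  lift_one : ∀ (T : MonadIn N) (g : N.Ar) (φ : N.Ce), IsAction T g φ →
    ∃! k, N.dom k = N.dom g ∧ N.cod k = obj T ∧ N.comp (u T) k = g ∧ N.hc (θ T) (N.idn k) = φ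
  lift_two : ∀ (T : MonadIn N) (k k' : N.Ar) (ω : N.Ce), N.dom k = N.dom k' →
    N.cod k = obj T → N.cod k' = obj T →
    IsActionMap T (N.comp (u T) k) (N.hc (θ T) (N.idn k)) (N.comp (u T) k')
      (N.hc (θ T) (N.idn k')) ω →
    ∃! κ, N.src κ = k ∧ N.tgt κ = k' ∧ N.hc (N.idn (u T)) κ = ω

namespace EMConstruction
variable {N : TwoCat.{u}} (E : EMConstruction N)

theorem exists_free (T : MonadIn N) : ∃ f, N.dom f = T.A ∧ N.cod f = E.obj T ∧
    N.comp (E.u T) f = T.t ∧ N.hc (E.θ T) (N.idn f) = T.μ := by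
  obtain ⟨f, h, -⟩ := E.lift_one T T.t T.μ
    ⟨T.cod_t, T.src_μ, T.tgt_μ, T.assoc.symm, T.unit_left⟩
  exact ⟨f, h.1.trans T.dom_t, h.2⟩

/-- The left adjoint 1-cell `f^t : A → A^t` of `u^t`, the unique 1-cell with `u^t.f^t = t` and
`θ^t.f^t = μ`. -/
noncomputable def free (T : MonadIn N) : N.Ar := (E.exists_free T).choose

theorem free_spec (T : MonadIn N) : N.dom (E.free T) = T.A ∧ N.cod (E.free T) = E.obj T ∧
    N.comp (E.u T) (E.free T) = T.t ∧ N.hc (E.θ T) (N.idn (E.free T)) = T.μ :=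
  (E.exists_free T).choose_spec

theorem exists_counit (T : MonadIn N) : ∃ e, N.src e = N.comp (E.free T) (E.u T) ∧
    N.tgt e = N.one (E.obj T) ∧ N.hc (N.idn (E.u T)) e = E.θ T := by
  obtain ⟨h1, h2, h3, h4⟩ := E.free_spec T
  have a := E.action T
  have du := E.dom_u T
  have c1 : N.dom (E.free T) = N.cod (E.u T) := by rw [h1, a.cod_g]
  have c2 : N.dom (E.u T) = N.cod (E.free T) := by rw [du, h2]
  have e1 : N.comp (E.u T) (N.comp (E.free T) (E.u T)) = N.comp T.t (E.u T) := by
    rw [← N.comp_assoc _ _ _ c2 c1, h3]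
  have ds : N.dom (N.src (E.θ T)) = E.obj T := by
    rw [a.src_φ, N.dom_comp _ _ (by rw [T.dom_t, a.cod_g]), du]
  have e2 : N.hc (E.θ T) (N.idn (N.comp (E.free T) (E.u T))) = N.hc T.μ (N.idn (E.u T)) := by
    rw [N.idn_comp _ _ c1, ← N.hc_assoc, h4]
    · rw [N.src_idn, ds, h2]
    · rw [N.src_idn, N.src_idn, c1]
  have e3 : N.comp (E.u T) (N.one (E.obj T)) = E.u T := by rw [← du]; exact N.comp_one _
  have e4 : N.hc (E.θ T) (N.idn (N.one (E.obj T))) = E.θ T := by rw [← ds]; exact N.hc_one _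
  obtain ⟨e, h, -⟩ := E.lift_two T (N.comp (E.free T) (E.u T)) (N.one (E.obj T)) (E.θ T)
    (by rw [N.dom_comp _ _ c1, du, N.dom_one]) (by rw [N.cod_comp _ _ c1, h2])
    (N.cod_one _) (by
      rw [e1, e2, e3, e4]
      exact ⟨a.src_φ, a.tgt_φ, a.assoc.symm⟩)
  exact ⟨e, h⟩

/-- The counit `ε^t : f^t.u^t → 1` of the adjunction `f^t ⊣ u^t`, the unique 2-cell with
`u^t.ε^t = θ^t`. -/
noncomputable def counit (T : MonadIn N) : N.Ce := (E.exists_counit T).choose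

end EMConstruction

/-- A 1-cell `(h, χ : h.t → s.h) : (A, t) → (B, s)` of `Mnd_op(N) = Mnd(N_op)_op`. -/
structure IsMndOp {N : TwoCat.{u}} (T S : MonadIn N) (h : N.Ar) (χ : N.Ce) : Prop where
  dom_h : N.dom h = T.A
  cod_h : N.cod h = S.A
  src_χ : N.src χ = N.comp h T.t
  tgt_χ : N.tgt χ = N.comp S.t h
  mul : N.vc χ (N.hc (N.idn h) T.μ) =
    N.vc (N.hc S.μ (N.idn h)) (N.vc (N.hc (N.idn S.t) χ) (N.hc χ (N.idn T.t)))
  unit : N.vc χ (N.hc (N.idn h) T.η) = N.hc S.η (N.idn h)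

/-- `π` is a coequalizer of the parallel 2-cells `a`, `b` in their hom category. -/
structure IsCoeq (N : TwoCat.{u}) (a b π : N.Ce) : Prop where
  src_eq : N.src a = N.src b
  tgt_eq : N.tgt a = N.tgt b
  src_π : N.src π = N.tgt a
  comm : N.vc π a = N.vc π b
  desc : ∀ ψ, N.src ψ = N.tgt a → N.vc ψ a = N.vc ψ b →
    ∃! κ, N.src κ = N.tgt π ∧ N.tgt κ = N.tgt ψ ∧ N.vc κ π = ψ

namespace EMConstruction
variable {N : TwoCat.{u}} (E : EMConstruction N) (T S : MonadIn N) (h : N.Ar) (χ : N.Ce)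

/-- The first arrow `1.1.1.ε^t : f^s.h.u^t.f^t.u^t → f^s.h.u^t` of the Linton pair. -/
noncomputable def linton₁ : N.Ce :=
  N.hc (N.idn (N.comp (E.free S) (N.comp h (E.u T)))) (E.counit T)

/-- The second arrow `f^s.h.t.u^t → f^s.s.h.u^t = f^s.u^s.f^s.h.u^t → f^s.h.u^t`,
`(ε^s.1.1.1) ∙ (1.χ.1)`, of the Linton pair. -/
noncomputable def linton₂ : N.Ce :=
  N.vc (N.hc (E.counit S) (N.idn (N.comp (E.free S) (N.comp h (E.u T)))))
    (N.hc (N.idn (E.free S)) (N.hc χ (N.idn (E.u T))))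

/-- `π : f^s.h.u^t → V(h, χ)` is a Linton coequalizer of `(h, χ)`, which is preserved by
horizontal composition on either side with any 1-cell. -/
structure IsLinton (π : N.Ce) : Prop where
  coeq : IsCoeq N (E.linton₁ T S h) (E.linton₂ T S h χ) π
  left : ∀ k, N.dom k = E.obj S →
    IsCoeq N (N.hc (N.idn k) (E.linton₁ T S h)) (N.hc (N.idn k) (E.linton₂ T S h χ))
      (N.hc (N.idn k) π)
  right : ∀ k, N.cod k = E.obj T →
    IsCoeq N (N.hc (E.linton₁ T S h) (N.idn k)) (N.hc (E.linton₂ T S h χ) (N.idn k))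
      (N.hc π (N.idn k))

/-- The Linton coequalizers of all 1-cells of `Mnd_op(N)` exist and are preserved by horizontal
composition on either side with any 1-cell. -/
def HasLinton : Prop :=
  ∀ (T S : MonadIn N) (h : N.Ar) (χ : N.Ce), IsMndOp T S h χ → ∃ π, E.IsLinton T S h χ π

/-- The Linton coequalizers of all 1-cells `(h, χ)` of `Mnd_op(N)` can be chosen such that, as an
equality of 2-cells, `π(h, χ).f^t = (ε^s.1.1) ∙ (1.χ) : f^s.h.t → f^s.h`; in particular
`V(h, χ).f^t = f^s.h`. -/
def HasStrictLinton : Prop :=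
  ∀ (T S : MonadIn N) (h : N.Ar) (χ : N.Ce), IsMndOp T S h χ → ∃ π, E.IsLinton T S h χ π ∧
    N.comp (N.tgt π) (E.free T) = N.comp (E.free S) h ∧
    N.hc π (N.idn (E.free T)) =
      N.vc (N.hc (E.counit S) (N.idn (N.comp (E.free S) h))) (N.hc (N.idn (E.free S)) χ)

end EMConstruction

/-- Monoidality of the Eilenberg–Moore construction: the comparison 1-cells `I → I^1` and
`A^t B^s → (AB)^{ts}` are identities.  The latter is the unique `k` with
`u^{ts}.k = u^t u^s` and `θ^{ts}.k = θ^t θ^s`, so this says that `A^t B^s` with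
`u^t u^s` and `θ^t θ^s` is literally the chosen Eilenberg–Moore object of `(AB, ts)`. -/
structure EMConstruction.IsMonoidal {M : SM2Cat.{u}} (E : EMConstruction M.toTwoCat) : Prop where
  obj_unit : E.obj (MonadIn.trivial M M.I) = M.I
  u_unit : E.u (MonadIn.trivial M M.I) = M.one M.I
  θ_unit : E.θ (MonadIn.trivial M M.I) = M.idn (M.one M.I)
  obj_tensor : ∀ T S : MonadIn M.toTwoCat, E.obj (T.tensor S) = M.t0 (E.obj T) (E.obj S)
  u_tensor : ∀ T S : MonadIn M.toTwoCat, E.u (T.tensor S) = M.t1 (E.u T) (E.u S)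
  θ_tensor : ∀ T S : MonadIn M.toTwoCat, E.θ (T.tensor S) = M.t2 (E.θ T) (E.θ S)

/-- `F : A → B` exhibits the `p`-oidal object `B` as a lifting of the `p`-oidal base object `A` of
the `(p,0)`-oidal monad `T = (A, t)` along `f^t : A → A^t`: `B` has the underlying 0-cell `A^t`,
`F` has the underlying 1-cell `f^t`, and the action `ε^t.f^t : f^t.t = f^t.u^t.f^t → f^t` of `t` on
`f^t` underlies a 2-cell `F.t → F` of `M_{p0}`. -/
structure IsLifting {M : SM2Cat.{u}} (E : EMConstruction M.toTwoCat) (p : ℕ)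
    (T : MonadIn (M.oidal p).toTwoCat) (B : (M.oidal p).Ob) (F : (M.oidal p).Ar) : Prop where
  dom_F : (M.oidal p).dom F = T.A
  cod_F : (M.oidal p).cod F = B
  base_B : M.base0 p B = E.obj (M.baseMonad p T)
  base_F : M.base1 p F = E.free (M.baseMonad p T)
  action : ∃ ρ : (M.oidal p).Ce, (M.oidal p).src ρ = (M.oidal p).comp F T.t ∧
    (M.oidal p).tgt ρ = F ∧
    M.base2 p ρ = M.hc (E.counit (M.baseMonad p T)) (M.idn (E.free (M.baseMonad p T)))

/-! Two facts about a single monad carry the theorem, and an induction on `p` does the rest. First,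
precomposition with `f^t` is fully faithful as a functor to 1-cells with a right `t`-action. Indeed
the counit `ε^t` is, up to isomorphism, the Linton coequalizer of `(1, 1_t)` (`exists_linton_iso`).
So 2-cells `k → k'` are 2-cells `k.f.u → k'` coequalizing a pair, and by `f ⊣ u` these are
equivariant 2-cells `k.f → k'.f` (`free_full`, `free_faithful`). Second, the 1-cells `(h, χ)` of
`Mnd_op` lift along the free 1-cells. After precomposition with `f^t` the Linton pair is split by
the unit of `t`, with coequalizer `(ε^s.f^s.h) ∙ (f^s.χ)`; since `π` is preserved, this yields an
equivariant isomorphism `V.f^t ≅ f^s.h` (`exists_lift_square`), which is an identity if `π` is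
chosen strictly. Monoidality of the Eilenberg–Moore construction makes `f^t f^s` the free 1-cell of
the product monad.

These properties are abstracted into `HasLifts s N G`: `G` singles out the good pairs of a 1-cell
and an action, and the proposition `s` is a switch that upgrades "invertible" to "identity", so that
(a) and (b) share one argument. The heart is `HasLifts.tenZero`: the properties pass from `N` to
`N.tenZero`, where the good 1-cells are the monoidal ones with coherent structure 2-cells, a
monoidal action and good underlying data. For a monad in `N.tenZero` on `A`, the multiplication and
unit of `A`, with the monoidal structure of `t`, are 1-cells of `Mnd_op(N)` and hence lift; the
constraints of `A` are compatible with these structures and lift by fullness; the axioms lift by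
faithfulness. The same pattern lifts monoidal 1-cells.

The bookkeeping is done in the arrow 2-category `arr N`, with lax squares `k.f → g.h` as 1-cells. It
is again symmetric strict monoidal; a pseudomonoid in it is a monoidal 1-cell of `N`, and a monoidal
1-cell in it is a square of monoidal 1-cells filled by a monoidal 2-cell. Lifting a structure along
`f` thus means finding a pseudomonoid (or monoidal 1-cell) in `arr N` with prescribed top. Its
axioms hold on tops by assumption and on bottoms because, over a good `f`, a 2-cell of squares with
invertible target filler is determined by its top (`HasLifts.cell_ext`). -/

namespace SM2Cat

/-! ### Lax squares and their pasting, product and symmetry -/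

/-- A lax square `ξ : k.f → g.h`, seen as a 1-cell `f → g` with top `h` and bottom `k`. -/
@[ext]
structure Square (N : SM2Cat.{u}) : Type u where
  /-- the domain -/
  f : N.Ar
  /-- the codomain -/
  g : N.Ar
  /-- the top -/
  h : N.Ar
  /-- the bottom -/
  k : N.Ar
  /-- the filler `k.f → g.h` -/
  ξ : N.Ce
  dom_h : N.dom h = N.dom f
  cod_h : N.cod h = N.dom g
  dom_k : N.dom k = N.cod f
  cod_k : N.cod k = N.cod g
  src_ξ : N.src ξ = N.comp k f
  tgt_ξ : N.tgt ξ = N.comp g h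

attribute [simp] Square.dom_h Square.cod_h Square.dom_k Square.cod_k Square.src_ξ Square.tgt_ξ

namespace Square
variable {N : SM2Cat.{u}}

/-- The identity square. -/
def one (f : N.Ar) : Square N where
  f := f
  g := f
  h := N.one (N.dom f)
  k := N.one (N.cod f)
  ξ := N.idn f
  dom_h := by simp
  cod_h := by simp
  dom_k := by simp
  cod_k := by simp
  src_ξ := by simp
  tgt_ξ := by simp

/-- Pasting of squares. -/
def comp (Y X : Square N) (e : Y.f = X.g) : Square N where
  f := X.f
  g := Y.g
  h := N.comp Y.h X.h
  k := N.comp Y.k X.k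
  ξ := N.vc (N.hc Y.ξ (N.idn X.h)) (N.hc (N.idn Y.k) X.ξ)
  dom_h := by simp [e]
  cod_h := by simp [e]
  dom_k := by simp [e]
  cod_k := by simp [e]
  src_ξ := by simp (maxDischargeDepth := 8) [e, N.comp_assoc]
  tgt_ξ := by simp (maxDischargeDepth := 8) [e, N.comp_assoc]

/-- The monoidal product of squares. -/
def tensor (X Y : Square N) : Square N where
  f := N.t1 X.f Y.f
  g := N.t1 X.g Y.g
  h := N.t1 X.h Y.h
  k := N.t1 X.k Y.k
  ξ := N.t2 X.ξ Y.ξ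
  dom_h := by simp
  cod_h := by simp
  dom_k := by simp
  cod_k := by simp
  src_ξ := by simp [N.t1_comp]
  tgt_ξ := by simp [N.t1_comp]

/-- The symmetry. -/
def braid (f g : N.Ar) : Square N where
  f := N.t1 f g
  g := N.t1 g f
  h := N.br (N.dom f) (N.dom g)
  k := N.br (N.cod f) (N.cod g)
  ξ := N.idn (N.comp (N.br (N.cod f) (N.cod g)) (N.t1 f g))
  dom_h := by simp
  cod_h := by simp
  dom_k := by simp
  cod_k := by simp
  src_ξ := by simp
  tgt_ξ := by simp [N.br_nat1]

theorem comp_one (X : Square N) : X.comp (one X.f) rfl = X := by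
  ext <;> simp [comp, one, ← N.idn_comp]

theorem one_comp (X : Square N) : (one X.g).comp X rfl = X := by
  ext <;> simp [comp, one, ← N.idn_comp]

theorem comp_assoc (Z Y X : Square N) (e : Z.f = Y.g) (e' : Y.f = X.g) :
    (Z.comp Y e).comp X e' = Z.comp (Y.comp X e') e := by
  ext1
  · rfl
  · rfl
  · simp [comp, N.comp_assoc, e, e']
  · simp [comp, N.comp_assoc, e, e']
  · simp (maxDischargeDepth := 8) [comp, e, e', N.idn_comp, N.comp_assoc, N.hc_assoc, w_hc_vc,
      vc_hc_w, N.vc_assoc]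

theorem tensor_one (f g : N.Ar) : (one f).tensor (one g) = one (N.t1 f g) := by
  ext <;> simp [tensor, one, N.t2_idn]

theorem tensor_comp (Y X Y' X' : Square N) (e : Y.f = X.g) (e' : Y'.f = X'.g) :
    (Y.comp X e).tensor (Y'.comp X' e') =
      (Y.tensor Y').comp (X.tensor X') (by simp [tensor, e, e']) := by
  ext1
  · rfl
  · rfl
  · simp [comp, tensor, N.t1_comp, e, e']
  · simp [comp, tensor, N.t1_comp, e, e']
  · simp only [comp, tensor]
    rw [N.t2_vc, N.t2_hc, N.t2_hc, N.t2_idn, N.t2_idn] <;>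
      simp (maxDischargeDepth := 8) [e, e', N.comp_assoc]

theorem tensor_assoc (X Y Z : Square N) : (X.tensor Y).tensor Z = X.tensor (Y.tensor Z) := by
  ext1 <;> simp [tensor, N.t1_assoc, N.t2_assoc]

theorem unit_tensor (X : Square N) : (one (N.one N.I)).tensor X = X := by
  ext1 <;> simp [tensor, one]

theorem tensor_unit (X : Square N) : X.tensor (one (N.one N.I)) = X := by
  ext1 <;> simp [tensor, one]

/-- The filler is an identity 2-cell. -/
def Str (X : Square N) : Prop := ∃ z, X.ξ = N.idn z

/-- An identity filler is the identity of the source `k.f`, hence read off from the boundary. The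
involution and hexagon axioms of the symmetry then reduce to their tops and bottoms. -/
theorem Str.eq {X Y : Square N} (hX : X.Str) (hY : Y.Str) (hf : X.f = Y.f) (hg : X.g = Y.g)
    (hh : X.h = Y.h) (hk : X.k = Y.k) : X = Y := by
  obtain ⟨a, ha⟩ := hX
  obtain ⟨b, hb⟩ := hY
  have a1 := X.src_ξ
  have b1 := Y.src_ξ
  rw [ha, N.src_idn] at a1
  rw [hb, N.src_idn] at b1
  ext1
  · exact hf
  · exact hg
  · exact hh
  · exact hk
  · rw [ha, hb, a1, b1, hf, hk]

theorem Str.one (f : N.Ar) : (one f).Str := ⟨_, rfl⟩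

theorem Str.braid (f g : N.Ar) : (braid f g).Str := ⟨_, rfl⟩

theorem Str.comp {Y X : Square N} (hY : Y.Str) (hX : X.Str) (e : Y.f = X.g) :
    (Y.comp X e).Str := by
  obtain ⟨a, ha⟩ := hX
  obtain ⟨b, hb⟩ := hY
  have a1 := X.src_ξ
  have a2 := X.tgt_ξ
  have b1 := Y.src_ξ
  have b2 := Y.tgt_ξ
  rw [ha, N.src_idn] at a1
  rw [ha, N.tgt_idn] at a2
  rw [hb, N.src_idn] at b1
  rw [hb, N.tgt_idn] at b2
  have k1 : N.dom b = N.cod X.h := by rw [b1]; simp [e]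
  have k2 : N.dom Y.k = N.cod a := by rw [a1]; simp [e]
  refine ⟨N.comp Y.k a, ?_⟩
  simp only [Square.comp]
  rw [ha, hb, ← N.idn_comp _ _ k1, ← N.idn_comp _ _ k2]
  apply MonArrow.vc_idns
  rw [b1, a2, N.comp_assoc, e] <;> simp [e]

theorem Str.tensor {X Y : Square N} (hX : X.Str) (hY : Y.Str) : (X.tensor Y).Str := by
  obtain ⟨a, ha⟩ := hX
  obtain ⟨b, hb⟩ := hY
  exact ⟨N.t1 a b, by simp only [Square.tensor]; rw [ha, hb, N.t2_idn]⟩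

theorem braid_nat (X Y : Square N) :
    (braid X.g Y.g).comp (X.tensor Y) rfl = (Y.tensor X).comp (braid X.f Y.f) rfl := by
  have eh := N.br_nat1 X.h Y.h
  have ek := N.br_nat1 X.k Y.k
  have ef := N.br_nat1 X.f Y.f
  have eg := N.br_nat1 X.g Y.g
  simp only [cod_h, dom_h, cod_k, dom_k] at eh ek
  ext1
  · rfl
  · rfl
  · exact eh
  · exact ek
  · have h := N.br_nat2 X.ξ Y.ξ
    have c1 : N.dom X.k = N.cod X.f := X.dom_k
    have c2 : N.dom Y.k = N.cod Y.f := Y.dom_k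
    -- The symmetry squares have identity fillers, so each pasting has one identity factor; what
    -- remains is naturality of the symmetry at the 2-cells `X.ξ` and `Y.ξ`.
    have e1 : N.hc (N.idn (N.comp (N.br (N.cod X.g) (N.cod Y.g)) (N.t1 X.g Y.g)))
        (N.idn (N.t1 X.h Y.h)) = N.idn (N.comp (N.br (N.cod X.g) (N.cod Y.g))
          (N.t1 (N.comp X.g X.h) (N.comp Y.g Y.h))) := by
      rw [← N.idn_comp, N.t1_comp, N.comp_assoc] <;> simp
    have e2 : N.hc (N.idn (N.t1 Y.k X.k))
        (N.idn (N.comp (N.br (N.cod X.f) (N.cod Y.f)) (N.t1 X.f Y.f))) =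
        N.idn (N.comp (N.t1 (N.comp Y.k Y.f) (N.comp X.k X.f))
          (N.br (N.dom X.f) (N.dom Y.f))) := by
      rw [← N.idn_comp, N.t1_comp, ef, N.comp_assoc] <;> simp
    simp at h
    simp only [comp, braid, tensor]
    rw [e1, e2, idn_vc_of, vc_idn_of, h] <;> simp

theorem braid_braid (f g : N.Ar) : (braid g f).comp (braid f g) rfl = one (N.t1 f g) := by
  apply Str.eq ((Str.braid _ _).comp (Str.braid _ _) _) (Str.one _) rfl rfl <;>
    simp [comp, braid, one, N.br_br]

theorem braid_tensor (f g l : N.Ar) :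
    braid f (N.t1 g l) = ((one g).tensor (braid f l)).comp ((braid f g).tensor (one l))
      (by simp [tensor, one, braid, N.t1_assoc]) := by
  apply Str.eq (Str.braid _ _) (((Str.one _).tensor (Str.braid _ _)).comp
    ((Str.braid _ _).tensor (Str.one _)) _) <;>
    simp [comp, braid, tensor, one, N.br_t0, N.t1_assoc]

end Square

/-! ### 2-cells of squares -/

/-- A 2-cell between squares. -/
@[ext]
structure SquareCell (N : SM2Cat.{u}) : Type u where
  /-- the source -/
  F : Square N
  /-- the target -/
  G : Square N
  /-- the top 2-cell -/
  a : N.Ce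
  /-- the bottom 2-cell -/
  b : N.Ce
  hf : G.f = F.f
  hg : G.g = F.g
  src_a : N.src a = F.h
  tgt_a : N.tgt a = G.h
  src_b : N.src b = F.k
  tgt_b : N.tgt b = G.k
  comm : N.vc G.ξ (N.hc b (N.idn F.f)) = N.vc (N.hc (N.idn F.g) a) F.ξ

attribute [simp] SquareCell.hf SquareCell.hg SquareCell.src_a SquareCell.tgt_a SquareCell.src_b
  SquareCell.tgt_b

namespace SquareCell
variable {N : SM2Cat.{u}}

/-- The identity 2-cell. -/
def idn (X : Square N) : SquareCell N where
  F := X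
  G := X
  a := N.idn X.h
  b := N.idn X.k
  hf := rfl
  hg := rfl
  src_a := by simp
  tgt_a := by simp
  src_b := by simp
  tgt_b := by simp
  comm := by simp [← N.idn_comp]

/-- Vertical composition. -/
def vc (d c : SquareCell N) (e : d.F = c.G) : SquareCell N where
  F := c.F
  G := d.G
  a := N.vc d.a c.a
  b := N.vc d.b c.b
  hf := by rw [d.hf, e, c.hf]
  hg := by rw [d.hg, e, c.hg]
  src_a := by simp [e]
  tgt_a := by simp [e]
  src_b := by simp [e]
  tgt_b := by simp [e]
  comm := by
    have h1 := c.comm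
    have h2 := d.comm
    simp only [e, c.hf, c.hg] at h2
    rw [N.vc_hc_w, ← N.vc_assoc, h2, N.vc_assoc, h1, ← N.vc_assoc, ← N.w_hc_vc] <;> simp [e]

/-- Horizontal composition. -/
def hc (d c : SquareCell N) (e : d.F.f = c.F.g) : SquareCell N where
  F := d.F.comp c.F e
  G := d.G.comp c.G (by rw [d.hf, e, c.hg])
  a := N.hc d.a c.a
  b := N.hc d.b c.b
  hf := c.hf
  hg := d.hg
  src_a := by simp [Square.comp, e]
  tgt_a := by simp [Square.comp, e]
  src_b := by simp [Square.comp, e]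
  tgt_b := by simp [Square.comp, e]
  comm := by
    -- The two filler conditions are used in turn: `h1` is that of `c`, composed horizontally with
    -- `d.b`, and `h2` is that of `d`, composed with `c.a`.
    have h1 : N.vc (N.hc (N.idn d.G.k) c.G.ξ) (N.hc d.b (N.hc c.b (N.idn c.F.f))) =
        N.vc (N.hc d.b (N.hc (N.idn c.F.g) c.a)) (N.hc (N.idn d.F.k) c.F.ξ) := by
      rw [← N.interchange, ← N.interchange, c.comm] <;> simp [e]
    have h2 : N.vc (N.hc d.G.ξ (N.idn c.G.h)) (N.hc (N.hc d.b (N.idn d.F.f)) c.a) =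
        N.vc (N.hc (N.hc (N.idn d.F.g) d.a) c.a) (N.hc d.F.ξ (N.idn c.F.h)) := by
      rw [← N.interchange, ← N.interchange, d.comm] <;> simp [e]
    simp only [Square.comp]
    rw [N.hc_assoc, N.vc_assoc, h1, ← N.hc_assoc d.b, ← e, ← N.vc_assoc, h2, N.vc_assoc,
      N.hc_assoc] <;> simp (maxDischargeDepth := 8) [e, N.comp_assoc]

/-- The monoidal product. -/
def tensor (c d : SquareCell N) : SquareCell N where
  F := c.F.tensor d.F
  G := c.G.tensor d.G
  a := N.t2 c.a d.a
  b := N.t2 c.b d.b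
  hf := by simp [Square.tensor]
  hg := by simp [Square.tensor]
  src_a := by simp [Square.tensor]
  tgt_a := by simp [Square.tensor]
  src_b := by simp [Square.tensor]
  tgt_b := by simp [Square.tensor]
  comm := by
    simp only [Square.tensor]
    rw [← N.t2_idn, ← N.t2_idn, ← N.t2_hc, ← N.t2_hc, ← N.t2_vc, ← N.t2_vc, c.comm, d.comm] <;> simp

end SquareCell

/-! ### The arrow 2-category -/

open Classical in
/-- The symmetric strict monoidal 2-category of 1-cells, lax squares and their 2-cells. -/
noncomputable def arr (N : SM2Cat.{u}) : SM2Cat.{u} where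
  Ob := N.Ar
  Ar := Square N
  Ce := SquareCell N
  dom := Square.f
  cod := Square.g
  src := SquareCell.F
  tgt := SquareCell.G
  one := Square.one
  idn := SquareCell.idn
  -- Outside composable pairs the values are arbitrary defaults, about which the axioms of `TwoCat`
  -- say nothing.
  comp Y X := if h : Y.f = X.g then Y.comp X h else Y
  hc d c := if h : d.F.f = c.F.g then d.hc c h else d
  vc d c := if h : d.F = c.G then d.vc c h else d
  I := N.one N.I
  t0 := N.t1
  t1 := Square.tensor
  t2 := SquareCell.tensor
  br := Square.braid
  dom_tgt a := a.hf
  cod_tgt a := a.hg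
  dom_one _ := rfl
  cod_one _ := rfl
  src_idn _ := rfl
  tgt_idn _ := rfl
  dom_comp g f h := by simp only [dif_pos h]; rfl
  cod_comp g f h := by simp only [dif_pos h]; rfl
  src_hc b a h := by simp only [dif_pos h]; rfl
  tgt_hc b a h := by
    have h' : b.G.f = a.G.g := by rw [b.hf, h, a.hg]
    simp only [dif_pos h, dif_pos h']; rfl
  src_vc b a h := by simp only [dif_pos h]; rfl
  tgt_vc b a h := by simp only [dif_pos h]; rfl
  comp_one f := by
    have h : f.f = (Square.one f.f).g := rfl
    simp only [dif_pos h]; exact f.comp_one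
  one_comp f := by
    have h : (Square.one f.g).f = f.g := rfl
    simp only [dif_pos h]; exact f.one_comp
  comp_assoc h g f h1 h2 := by
    have h3 : (h.comp g h1).f = f.g := h2
    have h4 : h.f = (g.comp f h2).g := h1
    simp only [dif_pos h1, dif_pos h2, dif_pos h3, dif_pos h4]
    exact Square.comp_assoc _ _ _ _ _
  vc_idn a := by
    have h : a.F = (SquareCell.idn a.F).G := rfl
    simp only [dif_pos h]
    ext1 <;> simp [SquareCell.vc, SquareCell.idn]
  idn_vc a := by
    have h : (SquareCell.idn a.G).F = a.G := rfl
    simp only [dif_pos h]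
    ext1 <;> simp [SquareCell.vc, SquareCell.idn]
  vc_assoc c b a h1 h2 := by
    have h3 : (c.vc b h1).F = a.G := h2
    have h4 : c.F = (b.vc a h2).G := h1
    simp only [dif_pos h1, dif_pos h2, dif_pos h3, dif_pos h4]
    ext1 <;> simp [SquareCell.vc, N.vc_assoc, h1, h2]
  hc_one a := by
    have h : a.F.f = (SquareCell.idn (Square.one a.F.f)).F.g := rfl
    simp only [dif_pos h]
    ext1
    · exact a.F.comp_one
    · have e := a.G.comp_one
      simpa only [SquareCell.hc, SquareCell.idn, a.hf] using e
    all_goals simp [SquareCell.hc, SquareCell.idn, Square.one]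
  one_hc a := by
    have h : (SquareCell.idn (Square.one a.F.g)).F.f = a.F.g := rfl
    simp only [dif_pos h]
    ext1
    · exact a.F.one_comp
    · have e := a.G.one_comp
      simpa only [SquareCell.hc, SquareCell.idn, a.hg] using e
    all_goals simp [SquareCell.hc, SquareCell.idn, Square.one]
  hc_assoc c b a h1 h2 := by
    have h3 : (c.hc b h1).F.f = a.F.g := h2
    have h4 : c.F.f = (b.hc a h2).F.g := h1
    simp only [dif_pos h1, dif_pos h2, dif_pos h3, dif_pos h4]
    ext1
    · exact Square.comp_assoc _ _ _ h1 h2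
    · exact Square.comp_assoc _ _ _ (by rw [c.hf, h1, b.hg]) (by rw [b.hf, h2, a.hg])
    all_goals simp [SquareCell.hc, N.hc_assoc, h1, h2]
  idn_comp g f h := by
    have h' : (SquareCell.idn g).F.f = (SquareCell.idn f).F.g := h
    simp only [dif_pos h, dif_pos h']
    ext1
    · rfl
    · rfl
    all_goals simp [SquareCell.hc, SquareCell.idn, Square.comp, h, N.idn_comp]
  interchange b' b a' a h1 h2 h3 := by
    have h4 : b'.F.f = a'.F.g := by rw [h1, h2, b.hf, h3, a.hg]
    have h5 : (b'.vc b h1).F.f = (a'.vc a h2).F.g := h3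
    have h6 : (b'.hc a' h4).F = (b.hc a h3).G := by simp [SquareCell.hc, h1, h2]
    simp only [dif_pos h1, dif_pos h2, dif_pos h3, dif_pos h4, dif_pos h5, dif_pos h6]
    ext1
    · rfl
    · rfl
    all_goals simp [SquareCell.hc, SquareCell.vc, N.interchange, h1, h2, h3]
  dom_t1 _ _ := rfl
  cod_t1 _ _ := rfl
  src_t2 _ _ := rfl
  tgt_t2 _ _ := rfl
  t1_one := Square.tensor_one
  t2_idn f g := by
    ext1 <;> simp [SquareCell.idn, SquareCell.tensor, Square.tensor, N.t2_idn]
  t1_comp g f g' f' h h' := by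
    have h1 : (g.tensor g').f = (f.tensor f').g := by simp [Square.tensor, h, h']
    simp only [dif_pos h, dif_pos h', dif_pos h1]
    exact Square.tensor_comp _ _ _ _ _ _
  t2_hc b a b' a' h h' := by
    have h1 : (b.tensor b').F.f = (a.tensor a').F.g := by
      simp [SquareCell.tensor, Square.tensor, h, h']
    simp only [dif_pos h, dif_pos h', dif_pos h1]
    ext1
    · exact Square.tensor_comp _ _ _ _ h h'
    · exact Square.tensor_comp _ _ _ _ (by rw [b.hf, h, a.hg]) (by rw [b'.hf, h', a'.hg])
    all_goals simp [SquareCell.hc, SquareCell.tensor, N.t2_hc, h, h']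
  t2_vc b a b' a' h h' := by
    have h1 : (b.tensor b').F = (a.tensor a').G := by simp [SquareCell.tensor, h, h']
    simp only [dif_pos h, dif_pos h', dif_pos h1]
    ext1
    · rfl
    · rfl
    all_goals simp [SquareCell.vc, SquareCell.tensor, N.t2_vc, h, h']
  t0_assoc := N.t1_assoc
  t1_assoc := Square.tensor_assoc
  t2_assoc a b c := by
    ext1
    · exact Square.tensor_assoc _ _ _
    · exact Square.tensor_assoc _ _ _
    all_goals simp [SquareCell.tensor, N.t2_assoc]
  I_t0 := N.I_t1
  t0_I := N.t1_I
  I_t1 := Square.unit_tensor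
  t1_I := Square.tensor_unit
  I_t2 a := by
    ext1
    · exact Square.unit_tensor _
    · exact Square.unit_tensor _
    all_goals simp [SquareCell.tensor, SquareCell.idn, Square.one]
  t2_I a := by
    ext1
    · exact Square.tensor_unit _
    · exact Square.tensor_unit _
    all_goals simp [SquareCell.tensor, SquareCell.idn, Square.one]
  dom_br _ _ := rfl
  cod_br _ _ := rfl
  br_nat1 f g := by
    have h1 : (Square.braid f.g g.g).f = (f.tensor g).g := rfl
    have h2 : (g.tensor f).f = (Square.braid f.f g.f).g := rfl
    simp only [dif_pos h1, dif_pos h2]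
    exact Square.braid_nat f g
  br_nat2 a b := by
    have h1 : (SquareCell.idn (Square.braid a.F.g b.F.g)).F.f = (a.tensor b).F.g := rfl
    have h2 : (b.tensor a).F.f = (SquareCell.idn (Square.braid a.F.f b.F.f)).F.g := rfl
    simp only [dif_pos h1, dif_pos h2]
    ext1
    · exact Square.braid_nat _ _
    · have h := Square.braid_nat a.G b.G
      simpa [SquareCell.hc, SquareCell.idn, SquareCell.tensor] using h
    · have h := N.br_nat2 a.a b.a
      simpa [SquareCell.hc, SquareCell.idn, SquareCell.tensor, Square.braid] using h
    · have h := N.br_nat2 a.b b.b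
      simpa [SquareCell.hc, SquareCell.idn, SquareCell.tensor, Square.braid] using h
  br_br A B := by
    have h1 : (Square.braid B A).f = (Square.braid A B).g := rfl
    simp only [dif_pos h1]
    exact Square.braid_braid A B
  br_t0 A B C := by
    have h1 : ((Square.one B).tensor (Square.braid A C)).f =
        ((Square.braid A B).tensor (Square.one C)).g := by
      simp [Square.tensor, Square.one, Square.braid, N.t1_assoc]
    simp only [dif_pos h1]
    exact Square.braid_tensor A B C


/-! ### Tops, bottoms and fillers of composites in the arrow 2-category -/

section ArrComponents
variable {N : SM2Cat.{u}}

/-- A 1-cell as a 0-cell of the arrow 2-category. -/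
def arrOb (f : N.Ar) : N.arr.Ob := f

/-- A square as a 1-cell of the arrow 2-category. -/
def arrAr (X : Square N) : N.arr.Ar := X

/-- A 2-cell of squares as a 2-cell of the arrow 2-category. -/
def arrCe (c : SquareCell N) : N.arr.Ce := c

/-- The 1-cell underlying a 0-cell of the arrow 2-category. -/
def arrow (f : N.arr.Ob) : N.Ar := f

/-- The square underlying a 1-cell of the arrow 2-category. -/
def square (X : N.arr.Ar) : Square N := X

/-- The 2-cell of squares underlying a 2-cell of the arrow 2-category. -/
def cell (c : N.arr.Ce) : SquareCell N := c

theorem arr_comp_eq {Y X : Square N} (e : Y.f = X.g) :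
    N.arr.comp (arrAr Y) (arrAr X) = arrAr (Y.comp X e) := dif_pos e

theorem arr_vc_eq {d c : SquareCell N} (e : d.F = c.G) :
    N.arr.vc (arrCe d) (arrCe c) = arrCe (d.vc c e) := dif_pos e

theorem square_comp {Y X : N.arr.Ar} (e : N.arr.dom Y = N.arr.cod X) :
    square (N.arr.comp Y X) = (square Y).comp (square X) e := dif_pos e

theorem cell_hc {d c : N.arr.Ce} (e : N.arr.dom (N.arr.src d) = N.arr.cod (N.arr.src c)) :
    cell (N.arr.hc d c) = (cell d).hc (cell c) e := dif_pos e

theorem cell_vc {d c : N.arr.Ce} (e : N.arr.src d = N.arr.tgt c) :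
    cell (N.arr.vc d c) = (cell d).vc (cell c) e := dif_pos e

theorem arr_comp_h (Y X : N.arr.Ar) (e : N.arr.dom Y = N.arr.cod X) :
    (square (N.arr.comp Y X)).h = N.comp (square Y).h (square X).h := by rw [square_comp e]; rfl

theorem arr_comp_k (Y X : N.arr.Ar) (e : N.arr.dom Y = N.arr.cod X) :
    (square (N.arr.comp Y X)).k = N.comp (square Y).k (square X).k := by rw [square_comp e]; rfl

theorem arr_comp_ξ (Y X : N.arr.Ar) (e : N.arr.dom Y = N.arr.cod X) :
    (square (N.arr.comp Y X)).ξ = N.vc (N.hc (square Y).ξ (N.idn (square X).h))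
      (N.hc (N.idn (square Y).k) (square X).ξ) := by rw [square_comp e]; rfl

theorem arr_hc_a (d c : N.arr.Ce) (e : N.arr.dom (N.arr.src d) = N.arr.cod (N.arr.src c)) :
    (cell (N.arr.hc d c)).a = N.hc (cell d).a (cell c).a := by rw [cell_hc e]; rfl

theorem arr_hc_b (d c : N.arr.Ce) (e : N.arr.dom (N.arr.src d) = N.arr.cod (N.arr.src c)) :
    (cell (N.arr.hc d c)).b = N.hc (cell d).b (cell c).b := by rw [cell_hc e]; rfl

theorem arr_vc_a (d c : N.arr.Ce) (e : N.arr.src d = N.arr.tgt c) :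
    (cell (N.arr.vc d c)).a = N.vc (cell d).a (cell c).a := by rw [cell_vc e]; rfl

theorem arr_vc_b (d c : N.arr.Ce) (e : N.arr.src d = N.arr.tgt c) :
    (cell (N.arr.vc d c)).b = N.vc (cell d).b (cell c).b := by rw [cell_vc e]; rfl

theorem arr_t1_h (X Y : N.arr.Ar) : (square (N.arr.t1 X Y)).h = N.t1 (square X).h (square Y).h :=
  rfl

theorem arr_t1_k (X Y : N.arr.Ar) : (square (N.arr.t1 X Y)).k = N.t1 (square X).k (square Y).k :=
  rfl

theorem arr_t1_ξ (X Y : N.arr.Ar) : (square (N.arr.t1 X Y)).ξ = N.t2 (square X).ξ (square Y).ξ :=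
  rfl

theorem arr_t2_a (c d : N.arr.Ce) : (cell (N.arr.t2 c d)).a = N.t2 (cell c).a (cell d).a := rfl

theorem arr_t2_b (c d : N.arr.Ce) : (cell (N.arr.t2 c d)).b = N.t2 (cell c).b (cell d).b := rfl

theorem arr_one_h (f : N.arr.Ob) : (square (N.arr.one f)).h = N.one (N.dom (arrow f)) := rfl

theorem arr_one_k (f : N.arr.Ob) : (square (N.arr.one f)).k = N.one (N.cod (arrow f)) := rfl

theorem arr_one_ξ (f : N.arr.Ob) : (square (N.arr.one f)).ξ = N.idn (arrow f) := rfl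

theorem arr_idn_a (X : N.arr.Ar) : (cell (N.arr.idn X)).a = N.idn (square X).h := rfl

theorem arr_idn_b (X : N.arr.Ar) : (cell (N.arr.idn X)).b = N.idn (square X).k := rfl

theorem arrow_t0 (f g : N.arr.Ob) : arrow (N.arr.t0 f g) = N.t1 (arrow f) (arrow g) := rfl

theorem arrow_I : arrow N.arr.I = N.one N.I := rfl

theorem square_f (X : N.arr.Ar) : (square X).f = arrow (N.arr.dom X) := rfl
theorem square_g (X : N.arr.Ar) : (square X).g = arrow (N.arr.cod X) := rfl
theorem cell_F (c : N.arr.Ce) : (cell c).F = square (N.arr.src c) := rfl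
theorem cell_G (c : N.arr.Ce) : (cell c).G = square (N.arr.tgt c) := rfl

theorem arr_cell_comm (c : N.arr.Ce) :
    N.vc (square (N.arr.tgt c)).ξ (N.hc (cell c).b (N.idn (arrow (N.arr.dom (N.arr.src c))))) =
      N.vc (N.hc (N.idn (arrow (N.arr.cod (N.arr.src c)))) (cell c).a)
        (square (N.arr.src c)).ξ :=
  (cell c).comm

theorem arr_ext {c d : N.arr.Ce} (h1 : N.arr.src c = N.arr.src d)
    (h2 : N.arr.tgt c = N.arr.tgt d) (h3 : (cell c).a = (cell d).a)
    (h4 : (cell c).b = (cell d).b) : c = d :=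
  SquareCell.ext h1 h2 h3 h4

end ArrComponents

/-! ### Calculus of invertible 2-cells -/

theorem IsInv.idn_hc {N : SM2Cat.{u}} {a : N.Ce} (ha : IsInv N.toTwoCat a) (w : N.Ar)
    (hw : N.dom w = N.cod (N.src a)) : IsInv N.toTwoCat (N.hc (N.idn w) a) := by
  obtain ⟨a', h1, h2, h3, h4⟩ := ha
  have e : N.cod (N.src a') = N.cod (N.src a) := by rw [h1, N.cod_tgt]
  refine ⟨N.hc (N.idn w) a', ?_, ?_, ?_, ?_⟩
  · simp [*]
  · simp [*]
  · rw [← N.interchange] <;> simp [*, N.idn_comp]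
  · rw [← N.interchange] <;> simp [*, N.idn_comp]

theorem IsInv.vc {N : SM2Cat.{u}} {b a : N.Ce} (hb : IsInv N.toTwoCat b)
    (ha : IsInv N.toTwoCat a) (h : N.src b = N.tgt a) : IsInv N.toTwoCat (N.vc b a) := by
  obtain ⟨a', h1, h2, h3, h4⟩ := ha
  obtain ⟨b', k1, k2, k3, k4⟩ := hb
  refine ⟨N.vc a' b', ?_, ?_, ?_, ?_⟩
  · simp [*]
  · simp [*]
  · rw [N.vc_assoc, ← N.vc_assoc b', k3, h, N.idn_vc_of, h3] <;> simp [*]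
  · rw [N.vc_assoc, ← N.vc_assoc a, h4, ← h, N.idn_vc_of, k4] <;> simp [*]

theorem IsInv.cancel {N : SM2Cat.{u}} {a x y : N.Ce} (ha : IsInv N.toTwoCat a)
    (hx : N.src a = N.tgt x) (hy : N.src a = N.tgt y) (e : N.vc a x = N.vc a y) : x = y := by
  obtain ⟨a', h1, h2, h3, h4⟩ := ha
  have := congrArg (N.vc a') e
  rwa [← N.vc_assoc _ _ _ h1 hx, ← N.vc_assoc _ _ _ h1 hy, h3, idn_vc_of _ _ _ hx.symm,
    idn_vc_of _ _ _ hy.symm] at this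

theorem vc_congr23 (N : SM2Cat.{u}) {b a c' b' a' : N.Ce} (h : N.vc b a = N.vc c' (N.vc b' a'))
    (x : N.Ce) (h1 : N.src b = N.tgt a) (h0' : N.src c' = N.tgt b') (h2 : N.src b' = N.tgt a')
    (h3 : N.src a = N.tgt x) (h4 : N.src a' = N.src a) :
    N.vc b (N.vc a x) = N.vc c' (N.vc b' (N.vc a' x)) := by
  rw [← N.vc_assoc b a x h1 h3, h, N.vc_assoc, N.vc_assoc] <;> simp [*]

/-! ### Right actions of monads and equivariant squares -/

/-- `ρ : f.t → f`, as for a right module `f` over the monad `(A, t)`. -/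
structure IsRightAction {N : SM2Cat.{u}} (T : MonadIn N.toTwoCat) (f : N.Ar) (ρ : N.Ce) :
    Prop where
  dom_f : N.dom f = T.A
  src_ρ : N.src ρ = N.comp f T.t
  tgt_ρ : N.tgt ρ = f

theorem IsRightAction.tensor {N : SM2Cat.{u}} {T S : MonadIn N.toTwoCat} {f g : N.Ar}
    {ρ σ : N.Ce} (hf : IsRightAction T f ρ) (hg : IsRightAction S g σ) :
    IsRightAction (T.tensor S) (N.t1 f g) (N.t2 ρ σ) where
  dom_f := by simp [hf.dom_f, hg.dom_f, MonadIn.tensor]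
  src_ρ := by
    simp only [MonadIn.tensor, src_t2, hf.src_ρ, hg.src_ρ]
    rw [N.t1_comp] <;> simp [hf.dom_f, hg.dom_f]
  tgt_ρ := by simp [hf.tgt_ρ, hg.tgt_ρ]

/-- The filler of the square `X` is a morphism of right modules from `k.f` to `g.h`, where the
action on the latter comes from `χ : h.t → s.h`. -/
structure IsModuleSquare {N : SM2Cat.{u}} (T S : MonadIn N.toTwoCat) (ρ σ : N.Ce)
    (X : Square N) (χ : N.Ce) : Prop where
  left : IsRightAction T X.f ρ
  right : IsRightAction S X.g σ
  src_χ : N.src χ = N.comp X.h T.t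
  tgt_χ : N.tgt χ = N.comp S.t X.h
  comm : N.vc X.ξ (N.hc (N.idn X.k) ρ) =
    N.vc (N.hc σ (N.idn X.h)) (N.vc (N.hc (N.idn X.g) χ) (N.hc X.ξ (N.idn T.t)))

namespace IsModuleSquare
variable {N : SM2Cat.{u}} {T S R : MonadIn N.toTwoCat} {ρ σ τ : N.Ce}

theorem one {f : N.Ar} (h : IsRightAction T f ρ) :
    IsModuleSquare T T ρ ρ (Square.one f) (N.idn T.t) where
  left := h
  right := h
  src_χ := by simp [Square.one, h.dom_f]
  tgt_χ := by simp [Square.one, h.dom_f]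
  comm := by
    have d := h.dom_f
    simp only [Square.one, ← N.idn_comp f T.t (by simp [d])]
    have e := congrArg N.cod h.tgt_ρ
    simp at e
    simp [h.src_ρ, h.tgt_ρ, d]

/-- The equivariance conditions of `X` and `Y` are pasted, with an exchange of `Y.ξ` and `χ` between
them. The 2-cell that appears is the one of the composite in `Mnd_op`. -/
theorem comp {Y X : Square N} {υ χ : N.Ce} (hY : IsModuleSquare S R σ τ Y υ)
    (hX : IsModuleSquare T S ρ σ X χ) (e : Y.f = X.g) :
    IsModuleSquare T R ρ τ (Y.comp X e)
      (N.vc (N.hc υ (N.idn X.h)) (N.hc (N.idn Y.h) χ)) := by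
  have a1 := hX.left.dom_f
  have a2 := hX.right.dom_f
  have a3 := hY.right.dom_f
  have b1 := hX.left.src_ρ
  have b2 := hX.right.src_ρ
  have b3 := hY.right.src_ρ
  have c1 := hX.left.tgt_ρ
  have c2 := hX.right.tgt_ρ
  have c3 := hY.right.tgt_ρ
  have d1 := hX.src_χ
  have d2 := hX.tgt_χ
  have d3 := hY.src_χ
  have d4 := hY.tgt_χ
  refine ⟨hX.left, hY.right, ?_, ?_, ?_⟩
  · simp (maxDischargeDepth := 8) [Square.comp, N.comp_assoc, *]
  · simp (maxDischargeDepth := 8) [Square.comp, N.comp_assoc, *]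
  · have h1 := congrArg (fun x => N.hc (N.idn Y.k) x) hX.comm
    have h2 := congrArg (fun x => N.hc x (N.idn X.h)) hY.comm
    have h3 := N.exchange Y.ξ χ (by simp [*])
    simp (maxDischargeDepth := 8) [Square.comp, w_hc_vc, vc_hc_w, N.idn_comp, N.hc_assoc,
      N.vc_assoc, N.comp_assoc, *] at h1 h2 h3 ⊢
    rw [h1, N.vc_congr23 h2, N.vc_congr2 h3]
    all_goals simp (maxDischargeDepth := 8) [N.comp_assoc, *]

/-- The monoidal product is a strict 2-functor, so the condition for the product is the product of
the two conditions. -/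
theorem tensor {T' S' : MonadIn N.toTwoCat} {ρ' σ' : N.Ce} {X X' : Square N} {χ χ' : N.Ce}
    (hX : IsModuleSquare T S ρ σ X χ) (hX' : IsModuleSquare T' S' ρ' σ' X' χ') :
    IsModuleSquare (T.tensor T') (S.tensor S') (N.t2 ρ ρ') (N.t2 σ σ') (X.tensor X')
      (N.t2 χ χ') where
  left := hX.left.tensor hX'.left
  right := hX.right.tensor hX'.right
  src_χ := by
    simp only [src_t2, hX.src_χ, hX'.src_χ, MonadIn.tensor, Square.tensor]
    rw [N.t1_comp] <;> simp [hX.left.dom_f, hX'.left.dom_f]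
  tgt_χ := by
    simp only [tgt_t2, hX.tgt_χ, hX'.tgt_χ, MonadIn.tensor, Square.tensor]
    rw [N.t1_comp] <;> simp [hX.right.dom_f, hX'.right.dom_f]
  comm := by
    have a1 := hX.left.dom_f
    have a2 := hX.right.dom_f
    have b1 := hX.left.src_ρ
    have b2 := hX.right.src_ρ
    have c1 := hX.left.tgt_ρ
    have c2 := hX.right.tgt_ρ
    have d1 := hX.src_χ
    have d2 := hX.tgt_χ
    have a1' := hX'.left.dom_f
    have a2' := hX'.right.dom_f
    have b1' := hX'.left.src_ρ
    have b2' := hX'.right.src_ρ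
    have c1' := hX'.left.tgt_ρ
    have c2' := hX'.right.tgt_ρ
    have d1' := hX'.src_χ
    have d2' := hX'.tgt_χ
    simp only [Square.tensor, MonadIn.tensor]
    rw [← N.t2_idn, ← N.t2_idn, ← N.t2_idn, ← N.t2_idn, ← N.t2_hc, ← N.t2_hc, ← N.t2_hc,
      ← N.t2_hc, ← N.t2_vc, ← N.t2_vc, ← N.t2_vc, hX.comm, hX'.comm] <;>
      simp (maxDischargeDepth := 8) [N.comp_assoc, *]

end IsModuleSquare


/-! ### The abstract lifting property -/

/-- Invertible 2-cells, required to be identities if `s` holds. -/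
def IsCoherent (s : Prop) (N : SM2Cat.{u}) (a : N.Ce) : Prop :=
  IsInv N.toTwoCat a ∧ (s → a = N.idn (N.src a))

/-- `G T f ρ` singles out 1-cells `f` with a right action `ρ` of the monad `T`, precomposition with
which is fully faithful as a functor to right modules, along which the 1-cells of `Mnd_op(N)` lift,
and which are compatible with the monoidal product. -/
structure HasLifts (s : Prop) (N : SM2Cat.{u})
    (G : MonadIn N.toTwoCat → N.Ar → N.Ce → Prop) : Prop where
  action : ∀ {T f ρ}, G T f ρ → IsRightAction T f ρ
  exists_free : ∀ T, ∃ f ρ, G T f ρ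
  full : ∀ {T f ρ}, G T f ρ → ∀ k k' ω, N.dom k = N.cod f → N.dom k' = N.cod f →
    N.src ω = N.comp k f → N.tgt ω = N.comp k' f →
    N.vc ω (N.hc (N.idn k) ρ) = N.vc (N.hc (N.idn k') ρ) (N.hc ω (N.idn T.t)) →
    ∃ κ, N.src κ = k ∧ N.tgt κ = k' ∧ N.hc κ (N.idn f) = ω
  faithful : ∀ {T f ρ}, G T f ρ → ∀ κ κ', N.src κ = N.src κ' → N.tgt κ = N.tgt κ' →
    N.dom (N.src κ) = N.cod f → N.hc κ (N.idn f) = N.hc κ' (N.idn f) → κ = κ'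
  lift : ∀ {T f ρ S g σ}, G T f ρ → G S g σ → ∀ h χ, IsMndOp T S h χ →
    ∃ X : Square N, X.f = f ∧ X.g = g ∧ X.h = h ∧ IsCoherent s N X.ξ ∧ IsModuleSquare T S ρ σ X χ
  -- This makes fullness and faithfulness available for `ff`, `fff` and `ffff`, over which the
  -- constraints of a pseudomonoid and their axioms live.
  tensor : ∀ {T f ρ S g σ}, G T f ρ → G S g σ → G (T.tensor S) (N.t1 f g) (N.t2 ρ σ)
  unit : G (MonadIn.trivial N N.I) (N.one N.I) (N.idn (N.one N.I))

namespace HasLifts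
variable {s : Prop} {N : SM2Cat.{u}} {G : MonadIn N.toTwoCat → N.Ar → N.Ce → Prop}
  {T S : MonadIn N.toTwoCat} {f : N.Ar} {ρ σ χ χ' : N.Ce}

/-- Once the target filler is cancelled, the filler condition expresses `b.f` through the top `a`,
and faithfulness recovers `b`. This is how axioms descend to lifted structures. -/
theorem cell_ext (H : HasLifts s N G) (hf : G T f ρ) (c d : SquareCell N) (hc : c.F.f = f)
    (hF : c.F = d.F) (hG : c.G = d.G) (ha : c.a = d.a) (hi : IsInv N.toTwoCat c.G.ξ) : c = d := by
  have e : N.vc c.G.ξ (N.hc c.b (N.idn f)) = N.vc c.G.ξ (N.hc d.b (N.idn f)) := by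
    have h1 := c.comm
    have h2 := d.comm
    rw [← hF, ← hG, ← ha, ← h1, hc] at h2
    exact h2.symm
  ext1
  · exact hF
  · exact hG
  · exact ha
  · refine H.faithful hf _ _ (by simp [hF]) (by simp [hG]) (by simp [← hc]) (hi.cancel ?_ ?_ e)
    · simp [← hc]
    · simp [← hc, hG, hF]

/-- The filler condition leaves no choice but `b.f = ξ'⁻¹ ∙ (g.a) ∙ ξ`. The hypothesis `e`, which
makes `a` a 2-cell of `Mnd_op`, makes this composite equivariant, so fullness supplies `b`. -/
theorem exists_cell (H : HasLifts s N G) (X X' : Square N) (hf : G T X.f ρ)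
    (hX : IsModuleSquare T S ρ σ X χ) (hX' : IsModuleSquare T S ρ σ X' χ') (ef : X'.f = X.f)
    (eg : X'.g = X.g) (hi : IsInv N.toTwoCat X'.ξ) (a : N.Ce) (ha : N.src a = X.h)
    (ha' : N.tgt a = X'.h) (e : N.vc χ' (N.hc a (N.idn T.t)) = N.vc (N.hc (N.idn S.t) a) χ) :
    ∃ c : SquareCell N, c.F = X ∧ c.G = X' ∧ c.a = a := by
  obtain ⟨ζ, h1, h2, h3, h4⟩ := id hi
  have a1 := hX.left.dom_f
  have a2 := hX.right.dom_f
  have b1 := hX.left.src_ρ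
  have b2 := hX.right.src_ρ
  have c1 := hX.left.tgt_ρ
  have c2 := hX.right.tgt_ρ
  have d1 := hX.src_χ
  have d2 := hX.tgt_χ
  have d1' := hX'.src_χ
  have d2' := hX'.tgt_χ
  have hh : N.dom X'.h = N.dom X.f := by simp [ef]
  have hh' : N.cod X'.h = N.dom X.g := by simp [eg]
  have hk : N.dom X'.k = N.cod X.f := by simp [ef]
  have hk' : N.cod X'.k = N.cod X.g := by simp [eg]
  have sξ : N.src X'.ξ = N.comp X'.k X.f := by simp [ef]
  have tξ : N.tgt X'.ξ = N.comp X.g X'.h := by simp [eg]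
  rw [tξ] at h1 h4
  rw [sξ] at h2 h3
  -- The forced value of the bottom 2-cell whiskered with `f`.
  obtain ⟨ω, hω⟩ : ∃ ω, ω = N.vc ζ (N.vc (N.hc (N.idn X.g) a) X.ξ) := ⟨_, rfl⟩
  have key : N.vc X'.ξ ω = N.vc (N.hc (N.idn X.g) a) X.ξ := by
    rw [hω, ← N.vc_assoc, h4, idn_vc_of] <;> simp (maxDischargeDepth := 8) [h1, h2, ha, ha', ef]
  have sω : N.src ω = N.comp X.k X.f := by simp (maxDischargeDepth := 8) [hω, h1, ha, ha']
  have tω : N.tgt ω = N.comp X'.k X.f := by simp (maxDischargeDepth := 8) [hω, h1, h2, ha, ha']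
  clear hω
  obtain ⟨κ, k1, k2, k3⟩ := H.full hf X.k X'.k ω (by simp) hk sω tω (by
    -- Equivariance of `ω` is tested after composing with the invertible `X'.ξ`, where it follows
    -- from equivariance of both fillers, from `e`, and from the exchange of `σ` and `a`.
    refine hi.cancel ?_ ?_ ?_
    · simp (maxDischargeDepth := 8) [sω, tω, sξ, b1, c1, a1]
    · simp (maxDischargeDepth := 8) [sω, tω, sξ, b1, c1, a1, N.comp_assoc, hk]
    · have p1 := hX.comm
      have p2 := hX'.comm
      have p3 := congrArg (fun x => N.hc (N.idn X.g) x) e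
      have p4 := congrArg (fun x => N.hc x (N.idn T.t)) key
      have p5 := N.exchange σ a (by simp [*])
      simp only [eg] at p2
      simp (maxDischargeDepth := 8) [w_hc_vc, vc_hc_w, N.idn_comp, N.hc_assoc, a1, a2, b2, c2, d1,
        d2, d1', sξ, sω, tω,
        ha, ha'] at p1 p2 p3 p4 p5
      rw [← N.vc_assoc, key, N.vc_assoc, p1, ← N.vc_assoc X'.ξ, p2, N.vc_assoc, N.vc_assoc, p4,
        N.vc_congr2 p3, N.vc_congr2 p5]
      all_goals simp (maxDischargeDepth := 8) [N.comp_assoc, a1, a2, b1, b2, c1, c2, d1, d2, d1',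
        d2', hh, hh', hk, sξ, tξ, sω, tω, ha, ha'])
  exact ⟨⟨X, X', a, κ, ef, eg, ha, ha', k1, k2, by rw [k3, key]⟩, rfl, rfl, rfl⟩

/-- Both `a` and its inverse lift by `exists_cell`; the two composites of the lifts have identity
tops, so `cell_ext` identifies them with identities. -/
theorem exists_iso (H : HasLifts s N G) (X X' : Square N) (hf : G T X.f ρ)
    (hX : IsModuleSquare T S ρ σ X χ) (hX' : IsModuleSquare T S ρ σ X' χ') (ef : X'.f = X.f)
    (eg : X'.g = X.g) (hiX : IsInv N.toTwoCat X.ξ) (hi : IsInv N.toTwoCat X'.ξ) (a : N.Ce)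
    (ha : N.src a = X.h) (ha' : N.tgt a = X'.h)
    (e : N.vc χ' (N.hc a (N.idn T.t)) = N.vc (N.hc (N.idn S.t) a) χ)
    (hia : IsInv N.toTwoCat a) :
    ∃ c : SquareCell N, c.F = X ∧ c.G = X' ∧ c.a = a ∧ IsInv N.arr.toTwoCat (arrCe c) := by
  obtain ⟨c, hc1, hc2, hc3⟩ := H.exists_cell X X' hf hX hX' ef eg hi a ha ha' e
  obtain ⟨b, h1, h2, h3, h4⟩ := hia
  have a1 := hX.left.dom_f
  have a2 := hX.right.dom_f
  have d1 := hX.src_χ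
  have d2 := hX.tgt_χ
  have d1' := hX'.src_χ
  have d2' := hX'.tgt_χ
  have hh : N.dom X'.h = N.dom X.f := by simp [ef]
  have hh' : N.cod X'.h = N.dom X.g := by simp [eg]
  rw [ha'] at h1 h4
  rw [ha] at h2 h3
  -- The inverse of a 2-cell of `Mnd_op` is again one: compose `e` with `b` on both sides.
  have e' : N.vc χ (N.hc b (N.idn T.t)) = N.vc (N.hc (N.idn S.t) b) χ' := by
    have q1 : N.vc (N.hc (N.idn S.t) b) (N.vc χ' (N.vc (N.hc a (N.idn T.t)) (N.hc b (N.idn T.t)))) =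
        N.vc (N.hc (N.idn S.t) b) χ' := by
      rw [← N.vc_hc_w, h4, ← N.idn_comp, vc_idn_of] <;> simp [*]
    rw [← q1, N.vc_congr2 e, ← N.vc_assoc (N.hc (N.idn S.t) b), ← N.w_hc_vc, h3, ← N.idn_comp,
      idn_vc_of] <;> simp [*]
  obtain ⟨d, hd1, hd2, hd3⟩ := H.exists_cell X' X (ef ▸ hf) hX' hX ef.symm eg.symm hiX b
    h1 h2 e'
  have p1 : d.F = c.G := hd1.trans hc2.symm
  have p2 : c.F = d.G := hc1.trans hd2.symm
  refine ⟨c, hc1, hc2, hc3, arrCe d, p1, p2.symm, ?_, ?_⟩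
  · rw [arr_vc_eq p1]
    refine congrArg arrCe (H.cell_ext hf _ _ (by simp [SquareCell.vc, hc1]) rfl p2.symm ?_ ?_)
    · change N.vc d.a c.a = N.idn c.F.h
      rw [hd3, hc3, h3, hc1]
    · change IsInv _ d.G.ξ
      rwa [hd2]
  · rw [arr_vc_eq p2]
    refine congrArg arrCe (H.cell_ext hf _ _ (by simp [SquareCell.vc, hd1, ef]) p1 rfl ?_ ?_)
    · change N.vc c.a d.a = N.idn c.G.h
      rw [hd3, hc3, h4, hc2]
    · change IsInv _ c.G.ξ
      rwa [hc2]

end HasLifts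

theorem Square.isInv_comp {N : SM2Cat.{u}} {Y X : Square N} (e : Y.f = X.g)
    (hY : IsInv N.toTwoCat Y.ξ) (hX : IsInv N.toTwoCat X.ξ) :
    IsInv N.toTwoCat (Y.comp X e).ξ := by
  refine (hY.hc_idn _ ?_).vc (hX.idn_hc _ ?_) ?_ <;>
    simp (maxDischargeDepth := 8) [e, N.comp_assoc]


/-! ### The bottom of a pseudomonoid in the arrow 2-category -/

theorem IsInv.arr_b {N : SM2Cat.{u}} {c : N.arr.Ce} (h : IsInv N.arr.toTwoCat c) :
    IsInv N.toTwoCat (cell c).b := by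
  obtain ⟨d, h1, h2, h3, h4⟩ := h
  refine ⟨(cell d).b, ?_, ?_, ?_, ?_⟩
  · rw [SquareCell.src_b, SquareCell.tgt_b, cell_F, cell_G, h1]
  · rw [SquareCell.src_b, SquareCell.tgt_b, cell_F, cell_G, h2]
  · rw [← arr_vc_b _ _ h1, h3, SquareCell.src_b]; rfl
  · rw [← arr_vc_b _ _ h2.symm, h4, SquareCell.tgt_b]; rfl

theorem IsInv.arr_a {N : SM2Cat.{u}} {c : N.arr.Ce} (h : IsInv N.arr.toTwoCat c) :
    IsInv N.toTwoCat (cell c).a := by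
  obtain ⟨d, h1, h2, h3, h4⟩ := h
  refine ⟨(cell d).a, ?_, ?_, ?_, ?_⟩
  · rw [SquareCell.src_a, SquareCell.tgt_a, cell_F, cell_G, h1]
  · rw [SquareCell.src_a, SquareCell.tgt_a, cell_F, cell_G, h2]
  · rw [← arr_vc_a _ _ h1, h3, SquareCell.src_a]; rfl
  · rw [← arr_vc_a _ _ h2.symm, h4, SquareCell.tgt_a]; rfl

namespace Pseudomonoid
variable {N : SM2Cat.{u}}

/-- The pseudomonoid on the codomain underlying a pseudomonoid in the arrow 2-category. -/
noncomputable def bot (P : Pseudomonoid N.arr) : Pseudomonoid N where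
  A := N.cod (arrow P.A)
  m := (square P.m).k
  u := (square P.u).k
  α := (cell P.α).b
  l := (cell P.l).b
  r := (cell P.r).b
  dom_m := by simp [square_f, arrow_t0]
  cod_m := by simp [square_g]
  dom_u := by simp [square_f, arrow_I]
  cod_u := by simp [square_g]
  src_α := by simp [cell_F, arr_comp_k, arr_t1_k, arr_one_k]
  tgt_α := by simp [cell_G, arr_comp_k, arr_t1_k, arr_one_k]
  src_l := by simp [cell_F, arr_comp_k, arr_t1_k, arr_one_k]
  tgt_l := by simp [cell_G, arr_one_k]
  src_r := by simp [cell_F, arr_comp_k, arr_t1_k, arr_one_k]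
  tgt_r := by simp [cell_G, arr_one_k]
  inv_α := P.inv_α.arr_b
  inv_l := P.inv_l.arr_b
  inv_r := P.inv_r.arr_b
  pentagon := by
    have h := congrArg (fun c => (cell c).b) P.pentagon
    simp (maxDischargeDepth := 8) [arr_vc_b, arr_hc_b, arr_t2_b, arr_idn_b, arr_one_k, N.t2_idn,
      N.t1_one, arr_t1_k, arrow_t0, N.arr.comp_assoc, one_t1_comp, comp_t1_one, N.arr.t1_assoc, one_t1_one_t1, merge1, merge2, N.arr.t2_idn] at h ⊢
    exact h
  triangle := by
    have h := congrArg (fun c => (cell c).b) P.triangle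
    simp (maxDischargeDepth := 8) [arr_vc_b, arr_hc_b, arr_t2_b, arr_idn_b, arr_one_k, N.t2_idn,
      arr_t1_k, N.arr.comp_assoc, one_t1_comp, comp_t1_one, N.arr.t1_assoc, N.arr.t2_idn] at h ⊢
    exact h

end Pseudomonoid


/-! ### The two sides of each coherence axiom are parallel -/

section Parallel
variable (N : SM2Cat.{u})

/-- Equality of 2-cells in `arr N` presupposes equal sources and targets, so the boundaries are
compared separately. Raw data are used because the pseudomonoid is not yet available when this is
applied. -/
theorem pentagon_parallel {A : N.Ob} {m : N.Ar} {α : N.Ce} (dom_m : N.dom m = N.t0 A A)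
    (cod_m : N.cod m = A) (src_α : N.src α = N.comp m (N.t1 m (N.one A)))
    (tgt_α : N.tgt α = N.comp m (N.t1 (N.one A) m)) :
    let L := N.vc (N.hc (N.idn m) (N.t2 (N.idn (N.one A)) α))
      (N.vc (N.hc α (N.t2 (N.idn (N.one A)) (N.t2 (N.idn m) (N.idn (N.one A)))))
        (N.hc (N.idn m) (N.t2 α (N.idn (N.one A)))))
    let R := N.vc (N.hc α (N.t2 (N.idn (N.one A)) (N.t2 (N.idn (N.one A)) (N.idn m))))
      (N.hc α (N.t2 (N.idn m) (N.t2 (N.idn (N.one A)) (N.idn (N.one A)))))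
    N.src L = N.src R ∧ N.tgt L = N.tgt R := by
  intro L R
  constructor <;>
    simp (maxDischargeDepth := 8) [L, R, N.t2_idn, N.comp_assoc, one_t1_comp, comp_t1_one,
      N.t1_assoc, one_t1_one_t1, merge1, merge2, dom_m, cod_m, src_α, tgt_α]

theorem triangle_parallel {A : N.Ob} {m e : N.Ar} {α l r : N.Ce} (dom_m : N.dom m = N.t0 A A)
    (cod_m : N.cod m = A) (cod_e : N.cod e = A)
    (src_α : N.src α = N.comp m (N.t1 m (N.one A)))
    (tgt_α : N.tgt α = N.comp m (N.t1 (N.one A) m)) (src_l : N.src l = N.comp m (N.t1 e (N.one A)))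
    (tgt_l : N.tgt l = N.one A) (src_r : N.src r = N.comp m (N.t1 (N.one A) e))
    (tgt_r : N.tgt r = N.one A) :
    let L := N.vc (N.hc (N.idn m) (N.t2 (N.idn (N.one A)) l))
      (N.hc α (N.t2 (N.idn (N.one A)) (N.t2 (N.idn e) (N.idn (N.one A)))))
    let R := N.hc (N.idn m) (N.t2 r (N.idn (N.one A)))
    N.src L = N.src R ∧ N.tgt L = N.tgt R := by
  intro L R
  constructor <;>
    simp (maxDischargeDepth := 8) [L, R, N.t2_idn, N.comp_assoc, one_t1_comp, comp_t1_one,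
      N.t1_assoc, dom_m, cod_m, src_α, tgt_α, cod_e, src_l, tgt_l, src_r, tgt_r]

theorem assoc_parallel (P Q : Pseudomonoid N) {f : N.Ar} {φ₂ : N.Ce} (dom_f : N.dom f = P.A)
    (cod_f : N.cod f = Q.A) (src_φ₂ : N.src φ₂ = N.comp Q.m (N.t1 f f))
    (tgt_φ₂ : N.tgt φ₂ = N.comp f P.m) :
    let L := N.vc (N.hc (N.idn f) P.α)
      (N.vc (N.hc φ₂ (N.t2 (N.idn P.m) (N.idn (N.one P.A))))
        (N.hc (N.idn Q.m) (N.t2 φ₂ (N.idn f))))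
    let R := N.vc (N.hc φ₂ (N.t2 (N.idn (N.one P.A)) (N.idn P.m)))
      (N.vc (N.hc (N.idn Q.m) (N.t2 (N.idn f) φ₂))
        (N.hc Q.α (N.t2 (N.idn f) (N.t2 (N.idn f) (N.idn f)))))
    N.src L = N.src R ∧ N.tgt L = N.tgt R := by
  have a1 := N.k1 f P.m (by simp [dom_f])
  have a2 := N.k1' f P.m (by simp [dom_f])
  have a3 := N.k2 f Q.m (by simp [cod_f])
  have a4 := N.k2' f Q.m (by simp [cod_f])
  simp only [dom_f, cod_f] at a1 a2 a3 a4
  intro L R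
  constructor <;>
    simp (maxDischargeDepth := 8) [L, R, N.comp_assoc, a1, a2, a3, a4, dom_f, cod_f, src_φ₂, tgt_φ₂]

theorem unit_left_parallel (P Q : Pseudomonoid N) {f : N.Ar} {φ₂ φ₀ : N.Ce}
    (dom_f : N.dom f = P.A)
    (cod_f : N.cod f = Q.A) (src_φ₂ : N.src φ₂ = N.comp Q.m (N.t1 f f))
    (tgt_φ₂ : N.tgt φ₂ = N.comp f P.m) (src_φ₀ : N.src φ₀ = Q.u)
    (tgt_φ₀ : N.tgt φ₀ = N.comp f P.u) :
    let L := N.vc (N.hc (N.idn f) P.l)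
      (N.vc (N.hc φ₂ (N.t2 (N.idn P.u) (N.idn (N.one P.A))))
        (N.hc (N.idn Q.m) (N.t2 φ₀ (N.idn f))))
    let R := N.hc Q.l (N.idn f)
    N.src L = N.src R ∧ N.tgt L = N.tgt R := by
  have e : N.t1 (N.comp f P.u) f = N.comp (N.t1 f f) (N.t1 P.u (N.one P.A)) := by
    rw [← N.t1_comp] <;> simp [dom_f]
  have e' := N.merge1 Q.u f _ _ Q.dom_u cod_f
  simp at e'
  intro L R
  constructor <;>
    simp (maxDischargeDepth := 8) [L, R, N.comp_assoc, dom_f, cod_f, src_φ₂, tgt_φ₂, src_φ₀, tgt_φ₀,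
      e, e']

theorem unit_right_parallel (P Q : Pseudomonoid N) {f : N.Ar} {φ₂ φ₀ : N.Ce}
    (dom_f : N.dom f = P.A)
    (cod_f : N.cod f = Q.A) (src_φ₂ : N.src φ₂ = N.comp Q.m (N.t1 f f))
    (tgt_φ₂ : N.tgt φ₂ = N.comp f P.m) (src_φ₀ : N.src φ₀ = Q.u)
    (tgt_φ₀ : N.tgt φ₀ = N.comp f P.u) :
    let L := N.vc (N.hc (N.idn f) P.r)
      (N.vc (N.hc φ₂ (N.t2 (N.idn (N.one P.A)) (N.idn P.u)))
        (N.hc (N.idn Q.m) (N.t2 (N.idn f) φ₀)))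
    let R := N.hc Q.r (N.idn f)
    N.src L = N.src R ∧ N.tgt L = N.tgt R := by
  have e : N.t1 f (N.comp f P.u) = N.comp (N.t1 f f) (N.t1 (N.one P.A) P.u) := by
    rw [← N.t1_comp] <;> simp [dom_f]
  have e' := N.merge2 f Q.u _ _ cod_f Q.dom_u
  simp at e'
  intro L R
  constructor <;>
    simp (maxDischargeDepth := 8) [L, R, N.comp_assoc, dom_f, cod_f, src_φ₂, tgt_φ₂, src_φ₀, tgt_φ₀,
      e, e']

end Parallel

/-! ### Pentagon and triangle in the arrow 2-category, on tops and bottoms -/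

section ArrPseudomonoid
variable {N : SM2Cat.{u}}

/-- Taking tops commutes with every operation on composable cells; the boundary hypotheses serve to
establish composability. -/
theorem arr_pentagon_a {A : N.arr.Ob} {m : N.arr.Ar} {α : N.arr.Ce}
    (dom_m : N.arr.dom m = N.arr.t0 A A) (cod_m : N.arr.cod m = A)
    (src_α : N.arr.src α = N.arr.comp m (N.arr.t1 m (N.arr.one A)))
    (tgt_α : N.arr.tgt α = N.arr.comp m (N.arr.t1 (N.arr.one A) m))
    (h : N.vc (N.hc (N.idn (square m).h) (N.t2 (N.idn (N.one (N.dom (arrow A)))) (cell α).a))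
      (N.vc (N.hc (cell α).a (N.t2 (N.idn (N.one (N.dom (arrow A)))) (N.t2 (N.idn (square m).h)
        (N.idn (N.one (N.dom (arrow A)))))))
        (N.hc (N.idn (square m).h) (N.t2 (cell α).a (N.idn (N.one (N.dom (arrow A))))))) =
    N.vc (N.hc (cell α).a (N.t2 (N.idn (N.one (N.dom (arrow A)))) (N.t2 (N.idn (N.one (N.dom
      (arrow A)))) (N.idn (square m).h))))
      (N.hc (cell α).a (N.t2 (N.idn (square m).h) (N.t2 (N.idn (N.one (N.dom (arrow A)))) (N.idn
        (N.one (N.dom (arrow A)))))))) :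
    (cell (N.arr.vc (N.arr.hc (N.arr.idn m) (N.arr.t2 (N.arr.idn (N.arr.one A)) α))
      (N.arr.vc (N.arr.hc α (N.arr.t2 (N.arr.idn (N.arr.one A)) (N.arr.t2 (N.arr.idn m) (N.arr.idn
        (N.arr.one A)))))
        (N.arr.hc (N.arr.idn m) (N.arr.t2 α (N.arr.idn (N.arr.one A))))) )).a =
    (cell (N.arr.vc (N.arr.hc α (N.arr.t2 (N.arr.idn (N.arr.one A)) (N.arr.t2 (N.arr.idn
      (N.arr.one A)) (N.arr.idn m))))
      (N.arr.hc α (N.arr.t2 (N.arr.idn m) (N.arr.t2 (N.arr.idn (N.arr.one A)) (N.arr.idn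
        (N.arr.one A))))))).a := by
  simp [N.t2_idn, one_t1_one_t1] at h
  simp (maxDischargeDepth := 8) [arr_vc_a, arr_hc_a, arr_t2_a, arr_idn_a, arr_one_h, arr_t1_h,
    arrow_t0, N.arr.comp_assoc, one_t1_comp, comp_t1_one, N.arr.t1_assoc, one_t1_one_t1, merge1, merge2, N.arr.t2_idn, dom_m, cod_m, src_α, tgt_α]
  exact h

theorem arr_triangle_a {A : N.arr.Ob} {m e : N.arr.Ar} {α l r : N.arr.Ce}
    (dom_m : N.arr.dom m = N.arr.t0 A A) (cod_m : N.arr.cod m = A)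
    (src_α : N.arr.src α = N.arr.comp m (N.arr.t1 m (N.arr.one A)))
    (tgt_α : N.arr.tgt α = N.arr.comp m (N.arr.t1 (N.arr.one A) m))
    (cod_e : N.arr.cod e = A)
    (src_l : N.arr.src l = N.arr.comp m (N.arr.t1 e (N.arr.one A)))
    (src_r : N.arr.src r = N.arr.comp m (N.arr.t1 (N.arr.one A) e))
    (h : N.vc (N.hc (N.idn (square m).h) (N.t2 (N.idn (N.one (N.dom (arrow A)))) (cell l).a))
      (N.hc (cell α).a (N.t2 (N.idn (N.one (N.dom (arrow A)))) (N.t2 (N.idn (square e).h) (N.idn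
        (N.one (N.dom (arrow A))))))) =
    N.hc (N.idn (square m).h) (N.t2 (cell r).a (N.idn (N.one (N.dom (arrow A)))))) :
    (cell (N.arr.vc (N.arr.hc (N.arr.idn m) (N.arr.t2 (N.arr.idn (N.arr.one A)) l))
      (N.arr.hc α (N.arr.t2 (N.arr.idn (N.arr.one A)) (N.arr.t2 (N.arr.idn e) (N.arr.idn
        (N.arr.one A))))) )).a =
    (cell (N.arr.hc (N.arr.idn m) (N.arr.t2 r (N.arr.idn (N.arr.one A))))).a := by
  simp [N.t2_idn] at h
  simp (maxDischargeDepth := 8) [arr_vc_a, arr_hc_a, arr_t2_a, arr_idn_a, arr_one_h, arr_t1_h,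
    N.arr.comp_assoc, one_t1_comp, comp_t1_one, N.arr.t1_assoc, N.arr.t2_idn, dom_m, cod_m, src_α, tgt_α, cod_e, src_l, src_r]
  exact h

theorem arr_pentagon_b {A : N.arr.Ob} {m : N.arr.Ar} {α : N.arr.Ce}
    (dom_m : N.arr.dom m = N.arr.t0 A A) (cod_m : N.arr.cod m = A)
    (src_α : N.arr.src α = N.arr.comp m (N.arr.t1 m (N.arr.one A)))
    (tgt_α : N.arr.tgt α = N.arr.comp m (N.arr.t1 (N.arr.one A) m))
    (h : N.vc (N.hc (N.idn (square m).k) (N.t2 (N.idn (N.one (N.cod (arrow A)))) (cell α).b))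
      (N.vc (N.hc (cell α).b (N.t2 (N.idn (N.one (N.cod (arrow A)))) (N.t2 (N.idn (square m).k)
        (N.idn (N.one (N.cod (arrow A)))))))
        (N.hc (N.idn (square m).k) (N.t2 (cell α).b (N.idn (N.one (N.cod (arrow A))))))) =
    N.vc (N.hc (cell α).b (N.t2 (N.idn (N.one (N.cod (arrow A)))) (N.t2 (N.idn (N.one (N.cod
      (arrow A)))) (N.idn (square m).k))))
      (N.hc (cell α).b (N.t2 (N.idn (square m).k) (N.t2 (N.idn (N.one (N.cod (arrow A)))) (N.idn
        (N.one (N.cod (arrow A)))))))) :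
    (cell (N.arr.vc (N.arr.hc (N.arr.idn m) (N.arr.t2 (N.arr.idn (N.arr.one A)) α))
      (N.arr.vc (N.arr.hc α (N.arr.t2 (N.arr.idn (N.arr.one A)) (N.arr.t2 (N.arr.idn m) (N.arr.idn
        (N.arr.one A)))))
        (N.arr.hc (N.arr.idn m) (N.arr.t2 α (N.arr.idn (N.arr.one A))))) )).b =
    (cell (N.arr.vc (N.arr.hc α (N.arr.t2 (N.arr.idn (N.arr.one A)) (N.arr.t2 (N.arr.idn
      (N.arr.one A)) (N.arr.idn m))))
      (N.arr.hc α (N.arr.t2 (N.arr.idn m) (N.arr.t2 (N.arr.idn (N.arr.one A)) (N.arr.idn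
        (N.arr.one A))))))).b := by
  simp [N.t2_idn, one_t1_one_t1] at h
  simp (maxDischargeDepth := 8) [arr_vc_b, arr_hc_b, arr_t2_b, arr_idn_b, arr_one_k, arr_t1_k,
    arrow_t0, N.arr.comp_assoc, one_t1_comp, comp_t1_one, N.arr.t1_assoc, one_t1_one_t1, merge1, merge2, N.arr.t2_idn, dom_m, cod_m, src_α, tgt_α]
  exact h

theorem arr_triangle_b {A : N.arr.Ob} {m e : N.arr.Ar} {α l r : N.arr.Ce}
    (dom_m : N.arr.dom m = N.arr.t0 A A) (cod_m : N.arr.cod m = A)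
    (src_α : N.arr.src α = N.arr.comp m (N.arr.t1 m (N.arr.one A)))
    (tgt_α : N.arr.tgt α = N.arr.comp m (N.arr.t1 (N.arr.one A) m))
    (cod_e : N.arr.cod e = A)
    (src_l : N.arr.src l = N.arr.comp m (N.arr.t1 e (N.arr.one A)))
    (src_r : N.arr.src r = N.arr.comp m (N.arr.t1 (N.arr.one A) e))
    (h : N.vc (N.hc (N.idn (square m).k) (N.t2 (N.idn (N.one (N.cod (arrow A)))) (cell l).b))
      (N.hc (cell α).b (N.t2 (N.idn (N.one (N.cod (arrow A)))) (N.t2 (N.idn (square e).k) (N.idn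
        (N.one (N.cod (arrow A))))))) =
    N.hc (N.idn (square m).k) (N.t2 (cell r).b (N.idn (N.one (N.cod (arrow A)))))) :
    (cell (N.arr.vc (N.arr.hc (N.arr.idn m) (N.arr.t2 (N.arr.idn (N.arr.one A)) l))
      (N.arr.hc α (N.arr.t2 (N.arr.idn (N.arr.one A)) (N.arr.t2 (N.arr.idn e) (N.arr.idn
        (N.arr.one A))))) )).b =
    (cell (N.arr.hc (N.arr.idn m) (N.arr.t2 r (N.arr.idn (N.arr.one A))))).b := by
  simp [N.t2_idn] at h
  simp (maxDischargeDepth := 8) [arr_vc_b, arr_hc_b, arr_t2_b, arr_idn_b, arr_one_k, arr_t1_k,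
    N.arr.comp_assoc, one_t1_comp, comp_t1_one, N.arr.t1_assoc, N.arr.t2_idn, dom_m, cod_m, src_α, tgt_α, cod_e, src_l, src_r]
  exact h

end ArrPseudomonoid


/-! ### Pseudomonoids in the arrow 2-category are monoidal 1-cells -/

/-- The inverses of top and bottom need no extra compatibility: multiplying the filler condition by
them on both sides gives the filler condition for the inverse. -/
theorem IsInv.arr {N : SM2Cat.{u}} {c : SquareCell N} (ha : IsInv N.toTwoCat c.a)
    (hb : IsInv N.toTwoCat c.b) : IsInv N.arr.toTwoCat (arrCe c) := by
  obtain ⟨a, a1, a2, a3, a4⟩ := ha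
  obtain ⟨b, b1, b2, b3, b4⟩ := hb
  simp only [c.src_a, c.tgt_a, c.src_b, c.tgt_b] at a1 a2 a3 a4 b1 b2 b3 b4
  have hc := c.comm
  have d1 : N.dom c.G.h = N.dom c.F.f := by simp
  have d2 : N.cod c.G.h = N.dom c.F.g := by simp
  have d3 : N.dom c.G.k = N.cod c.F.f := by simp
  have d4 : N.cod c.G.k = N.cod c.F.g := by simp
  have e1 : N.src c.G.ξ = N.comp c.G.k c.F.f := by simp
  have e2 : N.tgt c.G.ξ = N.comp c.F.g c.G.h := by simp
  let d : SquareCell N := ⟨c.G, c.F, a, b, c.hf.symm, c.hg.symm, a1, a2, b1, b2, by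
    rw [c.hf, c.hg]
    have q1 : N.vc c.F.ξ (N.hc b (N.idn c.F.f)) = N.vc (N.hc (N.idn c.F.g) a)
        (N.vc (N.vc (N.hc (N.idn c.F.g) c.a) c.F.ξ) (N.hc b (N.idn c.F.f))) := by
      rw [N.vc_assoc, ← N.vc_assoc (N.hc (N.idn c.F.g) a), ← N.w_hc_vc, a3, ← N.idn_comp,
        idn_vc_of] <;> simp (maxDischargeDepth := 8) [*]
    rw [q1, ← hc, N.vc_assoc c.G.ξ, ← N.vc_hc_w, b4, ← N.idn_comp, vc_idn_of] <;>
      simp (maxDischargeDepth := 8) [*]⟩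
  refine ⟨arrCe d, rfl, rfl, ?_, ?_⟩
  · rw [arr_vc_eq rfl]
    exact arr_ext rfl rfl a3 b3
  · rw [arr_vc_eq rfl]
    exact arr_ext rfl rfl a4 b4

namespace Pseudomonoid
variable {N : SM2Cat.{u}}

/-- The pseudomonoid on the domain underlying a pseudomonoid in the arrow 2-category. -/
noncomputable def top (P : Pseudomonoid N.arr) : Pseudomonoid N where
  A := N.dom (arrow P.A)
  m := (square P.m).h
  u := (square P.u).h
  α := (cell P.α).a
  l := (cell P.l).a
  r := (cell P.r).a
  dom_m := by simp [square_f, arrow_t0]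
  cod_m := by simp [square_g]
  dom_u := by simp [square_f, arrow_I]
  cod_u := by simp [square_g]
  src_α := by simp [cell_F, arr_comp_h, arr_t1_h, arr_one_h]
  tgt_α := by simp [cell_G, arr_comp_h, arr_t1_h, arr_one_h]
  src_l := by simp [cell_F, arr_comp_h, arr_t1_h, arr_one_h]
  tgt_l := by simp [cell_G, arr_one_h]
  src_r := by simp [cell_F, arr_comp_h, arr_t1_h, arr_one_h]
  tgt_r := by simp [cell_G, arr_one_h]
  inv_α := P.inv_α.arr_a
  inv_l := P.inv_l.arr_a
  inv_r := P.inv_r.arr_a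
  pentagon := by
    have h := congrArg (fun c => (cell c).a) P.pentagon
    simp (maxDischargeDepth := 8) [arr_vc_a, arr_hc_a, arr_t2_a, arr_idn_a, arr_one_h, N.t2_idn,
      N.t1_one, arr_t1_h, arrow_t0, N.arr.comp_assoc, one_t1_comp, comp_t1_one, N.arr.t1_assoc, one_t1_one_t1, merge1, merge2, N.arr.t2_idn] at h ⊢
    exact h
  triangle := by
    have h := congrArg (fun c => (cell c).a) P.triangle
    simp (maxDischargeDepth := 8) [arr_vc_a, arr_hc_a, arr_t2_a, arr_idn_a, arr_one_h, N.t2_idn,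
      arr_t1_h, N.arr.comp_assoc, one_t1_comp, comp_t1_one, N.arr.t1_assoc, N.arr.t2_idn] at h ⊢
    exact h

/-- A pseudomonoid in the arrow 2-category as a monoidal 1-cell. -/
noncomputable def toMonArrow (P : Pseudomonoid N.arr) : MonArrow N where
  P := P.top
  Q := P.bot
  f := arrow P.A
  φ₂ := (square P.m).ξ
  φ₀ := (square P.u).ξ
  dom_f := rfl
  cod_f := rfl
  src_φ₂ := by simp [square_f, bot, arrow_t0]
  tgt_φ₂ := by simp [square_g, top]
  src_φ₀ := by simp [square_f, bot, arrow_I]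
  tgt_φ₀ := by simp [square_g, top]
  assoc := by
    -- The filler condition of the 2-cell `P.α` is the associativity axiom of a monoidal 1-cell;
    -- those of `P.l` and `P.r` are the unit axioms.
    have h := arr_cell_comm P.α
    simp (maxDischargeDepth := 8) [arr_comp_ξ, arr_t1_h, arr_t1_ξ, arr_one_h, arr_one_ξ] at h
    simp [arrow_t0, ← N.t2_idn] at h
    simp [top, bot] at h ⊢
    rw [← h, N.vc_assoc]
    · simp (maxDischargeDepth := 8) [k1', N.comp_assoc, square_f, square_g, arrow_t0]
    · simp (maxDischargeDepth := 8) [k2', N.comp_assoc, square_f, square_g, cell_F, cell_G,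
        arr_comp_k, arr_t1_k, arr_one_k, arrow_t0]
  unit_left := by
    have h := arr_cell_comm P.l
    simp (maxDischargeDepth := 8) [arr_comp_ξ, arr_t1_h, arr_t1_ξ, arr_one_h, arr_one_ξ] at h
    simp [← N.t2_idn] at h
    simp [top, bot] at h ⊢
    rw [← h, idn_vc_of]
    simp [cell_F, cell_G, square_f, arr_one_k]
  unit_right := by
    have h := arr_cell_comm P.r
    simp (maxDischargeDepth := 8) [arr_comp_ξ, arr_t1_h, arr_t1_ξ, arr_one_h, arr_one_ξ] at h
    simp [← N.t2_idn] at h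
    simp [top, bot] at h ⊢
    rw [← h, idn_vc_of]
    simp [cell_F, cell_G, square_f, arr_one_k]

/-- The binary part of a monoidal 1-cell as a square. -/
def _root_.SM2Cat.MonArrow.sqm (F : MonArrow N) : Square N :=
  ⟨N.t1 F.f F.f, F.f, F.P.m, F.Q.m, F.φ₂, by simp, by simp, by simp, by simp, by simp, by simp⟩

/-- The nullary part of a monoidal 1-cell as a square. -/
def _root_.SM2Cat.MonArrow.squ (F : MonArrow N) : Square N :=
  ⟨N.one N.I, F.f, F.P.u, F.Q.u, F.φ₀, by simp, by simp, by simp, by simp, by simp, by simp⟩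

/-- The associativity constraints as a 2-cell of squares. -/
def _root_.SM2Cat.MonArrow.cellα (F : MonArrow N) : SquareCell N where
  F := F.sqm.comp (F.sqm.tensor (Square.one F.f)) rfl
  G := F.sqm.comp ((Square.one F.f).tensor F.sqm) rfl
  a := F.P.α
  b := F.Q.α
  hf := (N.t1_assoc _ _ _).symm
  hg := rfl
  src_a := by simp [Square.comp, Square.tensor, Square.one, MonArrow.sqm]
  tgt_a := by simp [Square.comp, Square.tensor, Square.one, MonArrow.sqm]
  src_b := by simp [Square.comp, Square.tensor, Square.one, MonArrow.sqm]
  tgt_b := by simp [Square.comp, Square.tensor, Square.one, MonArrow.sqm]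
  comm := by
    have h := F.assoc
    simp [Square.comp, Square.tensor, Square.one, MonArrow.sqm, ← N.t2_idn] at h ⊢
    rw [h, N.vc_assoc, N.t2_assoc] <;>
      simp (maxDischargeDepth := 8) [k1', k2', N.comp_assoc, N.t1_assoc]

/-- The left unit constraints as a 2-cell of squares. -/
def _root_.SM2Cat.MonArrow.celll (F : MonArrow N) : SquareCell N where
  F := F.sqm.comp (F.squ.tensor (Square.one F.f)) rfl
  G := Square.one F.f
  a := F.P.l
  b := F.Q.l
  hf := by simp [Square.comp, Square.tensor, Square.one, MonArrow.sqm, MonArrow.squ]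
  hg := rfl
  src_a := by simp [Square.comp, Square.tensor, Square.one, MonArrow.sqm, MonArrow.squ]
  tgt_a := by simp [Square.one]
  src_b := by simp [Square.comp, Square.tensor, Square.one, MonArrow.sqm, MonArrow.squ]
  tgt_b := by simp [Square.one]
  comm := by
    have h := F.unit_left
    simp [Square.comp, Square.tensor, Square.one, MonArrow.sqm, MonArrow.squ, ← N.t2_idn] at h ⊢
    rw [h, idn_vc_of] <;> simp

/-- The right unit constraints as a 2-cell of squares. -/
def _root_.SM2Cat.MonArrow.cellr (F : MonArrow N) : SquareCell N where
  F := F.sqm.comp ((Square.one F.f).tensor F.squ) rfl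
  G := Square.one F.f
  a := F.P.r
  b := F.Q.r
  hf := by simp [Square.comp, Square.tensor, Square.one, MonArrow.sqm, MonArrow.squ]
  hg := rfl
  src_a := by simp [Square.comp, Square.tensor, Square.one, MonArrow.sqm, MonArrow.squ]
  tgt_a := by simp [Square.one]
  src_b := by simp [Square.comp, Square.tensor, Square.one, MonArrow.sqm, MonArrow.squ]
  tgt_b := by simp [Square.one]
  comm := by
    have h := F.unit_right
    simp [Square.comp, Square.tensor, Square.one, MonArrow.sqm, MonArrow.squ, ← N.t2_idn] at h ⊢
    rw [h, idn_vc_of] <;> simp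

/-- A monoidal 1-cell as a pseudomonoid in the arrow 2-category. -/
noncomputable def ofMonArrow (F : MonArrow N) : Pseudomonoid N.arr where
  A := arrOb F.f
  m := arrAr F.sqm
  u := arrAr F.squ
  α := arrCe F.cellα
  l := arrCe F.celll
  r := arrCe F.cellr
  dom_m := rfl
  cod_m := rfl
  dom_u := rfl
  cod_u := rfl
  src_α := (arr_comp_eq rfl).symm
  tgt_α := (arr_comp_eq rfl).symm
  src_l := (arr_comp_eq rfl).symm
  tgt_l := rfl
  src_r := (arr_comp_eq rfl).symm
  tgt_r := rfl
  inv_α := IsInv.arr F.P.inv_α F.Q.inv_α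
  inv_l := IsInv.arr F.P.inv_l F.Q.inv_l
  inv_r := IsInv.arr F.P.inv_r F.Q.inv_r
  pentagon := by
    have sα : N.arr.src (arrCe F.cellα) = N.arr.comp (arrAr F.sqm)
      (N.arr.t1 (arrAr F.sqm) (N.arr.one (arrOb F.f))) := (arr_comp_eq rfl).symm
    have tα : N.arr.tgt (arrCe F.cellα) = N.arr.comp (arrAr F.sqm)
      (N.arr.t1 (N.arr.one (arrOb F.f)) (arrAr F.sqm)) := (arr_comp_eq rfl).symm
    obtain ⟨h1, h2⟩ := N.arr.pentagon_parallel rfl rfl sα tα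
    -- The top is the pentagon of the domain of `F`, the bottom that of its codomain.
    refine arr_ext h1 h2 (arr_pentagon_a rfl rfl sα tα ?_) (arr_pentagon_b rfl rfl sα tα ?_)
    · change _ = N.vc (N.hc F.P.α _) (N.hc F.P.α _)
      have h := F.P.pentagon
      rwa [← F.dom_f] at h
    · have h := F.Q.pentagon
      rwa [← F.cod_f] at h
  triangle := by
    have sα : N.arr.src (arrCe F.cellα) = N.arr.comp (arrAr F.sqm)
      (N.arr.t1 (arrAr F.sqm) (N.arr.one (arrOb F.f))) := (arr_comp_eq rfl).symm
    have tα : N.arr.tgt (arrCe F.cellα) = N.arr.comp (arrAr F.sqm)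
      (N.arr.t1 (N.arr.one (arrOb F.f)) (arrAr F.sqm)) := (arr_comp_eq rfl).symm
    have sl : N.arr.src (arrCe F.celll) = N.arr.comp (arrAr F.sqm)
      (N.arr.t1 (arrAr F.squ) (N.arr.one (arrOb F.f))) := (arr_comp_eq rfl).symm
    have sr : N.arr.src (arrCe F.cellr) = N.arr.comp (arrAr F.sqm)
      (N.arr.t1 (N.arr.one (arrOb F.f)) (arrAr F.squ)) := (arr_comp_eq rfl).symm
    have tl : N.arr.tgt (arrCe F.celll) = N.arr.one (arrOb F.f) := rfl
    have tr : N.arr.tgt (arrCe F.cellr) = N.arr.one (arrOb F.f) := rfl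
    obtain ⟨h1, h2⟩ := N.arr.triangle_parallel (m := arrAr F.sqm)
      (e := arrAr F.squ) rfl rfl rfl sα tα sl tl sr tr
    refine arr_ext h1 h2 (arr_triangle_a (m := arrAr F.sqm)
      (e := arrAr F.squ) rfl rfl sα tα rfl sl sr ?_)
      (arr_triangle_b (m := arrAr F.sqm) (e := arrAr F.squ) rfl rfl sα tα rfl sl sr ?_)
    · have h := F.P.triangle
      rwa [← F.dom_f] at h
    · have h := F.Q.triangle
      rwa [← F.cod_f] at h

end Pseudomonoid


/-! ### Axioms of monoidal 1-cells in the arrow 2-category, on tops and bottoms -/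

section ArrMonArrow
variable {N : SM2Cat.{u}}

/-- An equivalence is needed because it is used both ways: to extract the top of a given monoidal
1-cell (`MonArrow.top`) and to build one from its top (`HasLifts.exists_monArrow`). -/
theorem arr_assoc_a (P Q : Pseudomonoid N.arr) {f : N.arr.Ar} {φ₂ : N.arr.Ce}
    (dom_f : N.arr.dom f = P.A) (cod_f : N.arr.cod f = Q.A)
    (src_φ₂ : N.arr.src φ₂ = N.arr.comp Q.m (N.arr.t1 f f))
    (tgt_φ₂ : N.arr.tgt φ₂ = N.arr.comp f P.m) :
    (cell (N.arr.vc (N.arr.hc (N.arr.idn f) P.α)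
      (N.arr.vc (N.arr.hc φ₂ (N.arr.t2 (N.arr.idn P.m) (N.arr.idn (N.arr.one P.A))))
        (N.arr.hc (N.arr.idn Q.m) (N.arr.t2 φ₂ (N.arr.idn f)))) )).a =
    (cell (N.arr.vc (N.arr.hc φ₂ (N.arr.t2 (N.arr.idn (N.arr.one P.A)) (N.arr.idn P.m)))
      (N.arr.vc (N.arr.hc (N.arr.idn Q.m) (N.arr.t2 (N.arr.idn f) φ₂))
        (N.arr.hc Q.α (N.arr.t2 (N.arr.idn f) (N.arr.t2 (N.arr.idn f) (N.arr.idn f))))))).a ↔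
    N.vc (N.hc (N.idn (square f).h) P.top.α)
      (N.vc (N.hc (cell φ₂).a (N.t2 (N.idn P.top.m) (N.idn (N.one P.top.A))))
        (N.hc (N.idn Q.top.m) (N.t2 (cell φ₂).a (N.idn (square f).h)))) =
    N.vc (N.hc (cell φ₂).a (N.t2 (N.idn (N.one P.top.A)) (N.idn P.top.m)))
      (N.vc (N.hc (N.idn Q.top.m) (N.t2 (N.idn (square f).h) (cell φ₂).a))
        (N.hc Q.top.α (N.t2 (N.idn (square f).h) (N.t2 (N.idn (square f).h) (N.idn
          (square f).h))))) := by
  have a1 := N.arr.k1 f P.m (by simp [dom_f])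
  have a2 := N.arr.k1' f P.m (by simp [dom_f])
  have a3 := N.arr.k2 f Q.m (by simp [cod_f])
  have a4 := N.arr.k2' f Q.m (by simp [cod_f])
  simp (maxDischargeDepth := 8) [arr_vc_a, arr_hc_a, arr_t2_a, arr_idn_a, arr_one_h,
    N.arr.comp_assoc, a1, a2, a3, a4, dom_f, cod_f, src_φ₂, tgt_φ₂]
  rfl

theorem arr_unit_left_a (P Q : Pseudomonoid N.arr) {f : N.arr.Ar} {φ₂ φ₀ : N.arr.Ce}
    (dom_f : N.arr.dom f = P.A) (cod_f : N.arr.cod f = Q.A)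
    (src_φ₂ : N.arr.src φ₂ = N.arr.comp Q.m (N.arr.t1 f f))
    (tgt_φ₂ : N.arr.tgt φ₂ = N.arr.comp f P.m)
    (src_φ₀ : N.arr.src φ₀ = Q.u) (tgt_φ₀ : N.arr.tgt φ₀ = N.arr.comp f P.u) :
    (cell (N.arr.vc (N.arr.hc (N.arr.idn f) P.l)
      (N.arr.vc (N.arr.hc φ₂ (N.arr.t2 (N.arr.idn P.u) (N.arr.idn (N.arr.one P.A))))
        (N.arr.hc (N.arr.idn Q.m) (N.arr.t2 φ₀ (N.arr.idn f)))) )).a =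
    (cell (N.arr.hc Q.l (N.arr.idn f))).a ↔
    N.vc (N.hc (N.idn (square f).h) P.top.l)
      (N.vc (N.hc (cell φ₂).a (N.t2 (N.idn P.top.u) (N.idn (N.one P.top.A))))
        (N.hc (N.idn Q.top.m) (N.t2 (cell φ₀).a (N.idn (square f).h)))) =
    N.hc Q.top.l (N.idn (square f).h) := by
  have a1 : N.arr.t1 (N.arr.comp f P.u) f =
      N.arr.comp (N.arr.t1 f f) (N.arr.t1 P.u (N.arr.one P.A)) := by
    rw [← N.arr.t1_comp] <;> simp [dom_f]
  have a2 := N.arr.merge1 Q.u f _ _ Q.dom_u cod_f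
  simp at a2
  simp (maxDischargeDepth := 8) [arr_vc_a, arr_hc_a, arr_t2_a, arr_idn_a, arr_one_h,
    N.arr.comp_assoc, a1, dom_f, cod_f, src_φ₂, tgt_φ₂, src_φ₀, tgt_φ₀]
  rfl

theorem arr_unit_right_a (P Q : Pseudomonoid N.arr) {f : N.arr.Ar} {φ₂ φ₀ : N.arr.Ce}
    (dom_f : N.arr.dom f = P.A) (cod_f : N.arr.cod f = Q.A)
    (src_φ₂ : N.arr.src φ₂ = N.arr.comp Q.m (N.arr.t1 f f))
    (tgt_φ₂ : N.arr.tgt φ₂ = N.arr.comp f P.m)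
    (src_φ₀ : N.arr.src φ₀ = Q.u) (tgt_φ₀ : N.arr.tgt φ₀ = N.arr.comp f P.u) :
    (cell (N.arr.vc (N.arr.hc (N.arr.idn f) P.r)
      (N.arr.vc (N.arr.hc φ₂ (N.arr.t2 (N.arr.idn (N.arr.one P.A)) (N.arr.idn P.u)))
        (N.arr.hc (N.arr.idn Q.m) (N.arr.t2 (N.arr.idn f) φ₀))) )).a =
    (cell (N.arr.hc Q.r (N.arr.idn f))).a ↔
    N.vc (N.hc (N.idn (square f).h) P.top.r)
      (N.vc (N.hc (cell φ₂).a (N.t2 (N.idn (N.one P.top.A)) (N.idn P.top.u)))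
        (N.hc (N.idn Q.top.m) (N.t2 (N.idn (square f).h) (cell φ₀).a))) =
    N.hc Q.top.r (N.idn (square f).h) := by
  have a1 : N.arr.t1 f (N.arr.comp f P.u) =
      N.arr.comp (N.arr.t1 f f) (N.arr.t1 (N.arr.one P.A) P.u) := by
    rw [← N.arr.t1_comp] <;> simp [dom_f]
  have a2 := N.arr.merge2 f Q.u _ _ cod_f Q.dom_u
  simp at a2
  simp (maxDischargeDepth := 8) [arr_vc_a, arr_hc_a, arr_t2_a, arr_idn_a, arr_one_h,
    N.arr.comp_assoc, a1, dom_f, cod_f, src_φ₂, tgt_φ₂, src_φ₀, tgt_φ₀]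
  rfl

theorem arr_assoc_b (P Q : Pseudomonoid N.arr) {f : N.arr.Ar} {φ₂ : N.arr.Ce}
    (dom_f : N.arr.dom f = P.A) (cod_f : N.arr.cod f = Q.A)
    (src_φ₂ : N.arr.src φ₂ = N.arr.comp Q.m (N.arr.t1 f f))
    (tgt_φ₂ : N.arr.tgt φ₂ = N.arr.comp f P.m) :
    (cell (N.arr.vc (N.arr.hc (N.arr.idn f) P.α)
      (N.arr.vc (N.arr.hc φ₂ (N.arr.t2 (N.arr.idn P.m) (N.arr.idn (N.arr.one P.A))))
        (N.arr.hc (N.arr.idn Q.m) (N.arr.t2 φ₂ (N.arr.idn f)))) )).b =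
    (cell (N.arr.vc (N.arr.hc φ₂ (N.arr.t2 (N.arr.idn (N.arr.one P.A)) (N.arr.idn P.m)))
      (N.arr.vc (N.arr.hc (N.arr.idn Q.m) (N.arr.t2 (N.arr.idn f) φ₂))
        (N.arr.hc Q.α (N.arr.t2 (N.arr.idn f) (N.arr.t2 (N.arr.idn f) (N.arr.idn f))))))).b ↔
    N.vc (N.hc (N.idn (square f).k) P.bot.α)
      (N.vc (N.hc (cell φ₂).b (N.t2 (N.idn P.bot.m) (N.idn (N.one P.bot.A))))
        (N.hc (N.idn Q.bot.m) (N.t2 (cell φ₂).b (N.idn (square f).k)))) =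
    N.vc (N.hc (cell φ₂).b (N.t2 (N.idn (N.one P.bot.A)) (N.idn P.bot.m)))
      (N.vc (N.hc (N.idn Q.bot.m) (N.t2 (N.idn (square f).k) (cell φ₂).b))
        (N.hc Q.bot.α (N.t2 (N.idn (square f).k) (N.t2 (N.idn (square f).k) (N.idn
          (square f).k))))) := by
  have a1 := N.arr.k1 f P.m (by simp [dom_f])
  have a2 := N.arr.k1' f P.m (by simp [dom_f])
  have a3 := N.arr.k2 f Q.m (by simp [cod_f])
  have a4 := N.arr.k2' f Q.m (by simp [cod_f])
  simp (maxDischargeDepth := 8) [arr_vc_b, arr_hc_b, arr_t2_b, arr_idn_b, arr_one_k,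
    N.arr.comp_assoc, a1, a2, a3, a4, dom_f, cod_f, src_φ₂, tgt_φ₂]
  rfl

theorem arr_unit_left_b (P Q : Pseudomonoid N.arr) {f : N.arr.Ar} {φ₂ φ₀ : N.arr.Ce}
    (dom_f : N.arr.dom f = P.A) (cod_f : N.arr.cod f = Q.A)
    (src_φ₂ : N.arr.src φ₂ = N.arr.comp Q.m (N.arr.t1 f f))
    (tgt_φ₂ : N.arr.tgt φ₂ = N.arr.comp f P.m)
    (src_φ₀ : N.arr.src φ₀ = Q.u) (tgt_φ₀ : N.arr.tgt φ₀ = N.arr.comp f P.u) :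
    (cell (N.arr.vc (N.arr.hc (N.arr.idn f) P.l)
      (N.arr.vc (N.arr.hc φ₂ (N.arr.t2 (N.arr.idn P.u) (N.arr.idn (N.arr.one P.A))))
        (N.arr.hc (N.arr.idn Q.m) (N.arr.t2 φ₀ (N.arr.idn f)))) )).b =
    (cell (N.arr.hc Q.l (N.arr.idn f))).b ↔
    N.vc (N.hc (N.idn (square f).k) P.bot.l)
      (N.vc (N.hc (cell φ₂).b (N.t2 (N.idn P.bot.u) (N.idn (N.one P.bot.A))))
        (N.hc (N.idn Q.bot.m) (N.t2 (cell φ₀).b (N.idn (square f).k)))) =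
    N.hc Q.bot.l (N.idn (square f).k) := by
  have a1 : N.arr.t1 (N.arr.comp f P.u) f =
      N.arr.comp (N.arr.t1 f f) (N.arr.t1 P.u (N.arr.one P.A)) := by
    rw [← N.arr.t1_comp] <;> simp [dom_f]
  have a2 := N.arr.merge1 Q.u f _ _ Q.dom_u cod_f
  simp at a2
  simp (maxDischargeDepth := 8) [arr_vc_b, arr_hc_b, arr_t2_b, arr_idn_b, arr_one_k,
    N.arr.comp_assoc, a1, dom_f, cod_f, src_φ₂, tgt_φ₂, src_φ₀, tgt_φ₀]
  rfl

theorem arr_unit_right_b (P Q : Pseudomonoid N.arr) {f : N.arr.Ar} {φ₂ φ₀ : N.arr.Ce}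
    (dom_f : N.arr.dom f = P.A) (cod_f : N.arr.cod f = Q.A)
    (src_φ₂ : N.arr.src φ₂ = N.arr.comp Q.m (N.arr.t1 f f))
    (tgt_φ₂ : N.arr.tgt φ₂ = N.arr.comp f P.m)
    (src_φ₀ : N.arr.src φ₀ = Q.u) (tgt_φ₀ : N.arr.tgt φ₀ = N.arr.comp f P.u) :
    (cell (N.arr.vc (N.arr.hc (N.arr.idn f) P.r)
      (N.arr.vc (N.arr.hc φ₂ (N.arr.t2 (N.arr.idn (N.arr.one P.A)) (N.arr.idn P.u)))
        (N.arr.hc (N.arr.idn Q.m) (N.arr.t2 (N.arr.idn f) φ₀))) )).b =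
    (cell (N.arr.hc Q.r (N.arr.idn f))).b ↔
    N.vc (N.hc (N.idn (square f).k) P.bot.r)
      (N.vc (N.hc (cell φ₂).b (N.t2 (N.idn (N.one P.bot.A)) (N.idn P.bot.u)))
        (N.hc (N.idn Q.bot.m) (N.t2 (N.idn (square f).k) (cell φ₀).b))) =
    N.hc Q.bot.r (N.idn (square f).k) := by
  have a1 : N.arr.t1 f (N.arr.comp f P.u) =
      N.arr.comp (N.arr.t1 f f) (N.arr.t1 (N.arr.one P.A) P.u) := by
    rw [← N.arr.t1_comp] <;> simp [dom_f]
  have a2 := N.arr.merge2 f Q.u _ _ cod_f Q.dom_u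
  simp at a2
  simp (maxDischargeDepth := 8) [arr_vc_b, arr_hc_b, arr_t2_b, arr_idn_b, arr_one_k,
    N.arr.comp_assoc, a1, dom_f, cod_f, src_φ₂, tgt_φ₂, src_φ₀, tgt_φ₀]
  rfl

end ArrMonArrow


/-! ### Monoidal 1-cells in the arrow 2-category as squares of monoidal 1-cells -/

namespace Pseudomonoid
variable {N : SM2Cat.{u}}

theorem top_ofMonArrow (F : MonArrow N) : (ofMonArrow F).top = F.P :=
  Pseudomonoid.ext F.dom_f rfl rfl rfl rfl rfl

theorem bot_ofMonArrow (F : MonArrow N) : (ofMonArrow F).bot = F.Q :=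
  Pseudomonoid.ext F.cod_f rfl rfl rfl rfl rfl

/-- The direction of the correspondence that is needed later: it identifies the vertical sides of a
filler with the monoidal 1-cells one started from. -/
theorem toMonArrow_ofMonArrow (F : MonArrow N) : (ofMonArrow F).toMonArrow = F :=
  MonArrow.ext (top_ofMonArrow F) (bot_ofMonArrow F) rfl rfl rfl

end Pseudomonoid

namespace MonArrow
variable {N : SM2Cat.{u}}

/-- The top monoidal 1-cell of a monoidal 1-cell in the arrow 2-category. -/
noncomputable def top (K : MonArrow N.arr) : MonArrow N where
  P := K.P.top
  Q := K.Q.top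
  f := (square K.f).h
  φ₂ := (cell K.φ₂).a
  φ₀ := (cell K.φ₀).a
  dom_f := by simp [square_f, Pseudomonoid.top]
  cod_f := by simp [square_g, Pseudomonoid.top]
  src_φ₂ := by simp [cell_F, Pseudomonoid.top, arr_comp_h, arr_t1_h]
  tgt_φ₂ := by simp [cell_G, Pseudomonoid.top, arr_comp_h]
  src_φ₀ := by simp [cell_F, Pseudomonoid.top]
  tgt_φ₀ := by simp [cell_G, Pseudomonoid.top, arr_comp_h]
  assoc := (arr_assoc_a K.P K.Q K.dom_f K.cod_f K.src_φ₂ K.tgt_φ₂).1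
    (congrArg (fun c => (cell c).a) K.assoc)
  unit_left := (arr_unit_left_a K.P K.Q K.dom_f K.cod_f K.src_φ₂ K.tgt_φ₂ K.src_φ₀ K.tgt_φ₀).1
    (congrArg (fun c => (cell c).a) K.unit_left)
  unit_right := (arr_unit_right_a K.P K.Q K.dom_f K.cod_f K.src_φ₂ K.tgt_φ₂ K.src_φ₀ K.tgt_φ₀).1
    (congrArg (fun c => (cell c).a) K.unit_right)

/-- The bottom monoidal 1-cell of a monoidal 1-cell in the arrow 2-category. -/
noncomputable def bot (K : MonArrow N.arr) : MonArrow N where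
  P := K.P.bot
  Q := K.Q.bot
  f := (square K.f).k
  φ₂ := (cell K.φ₂).b
  φ₀ := (cell K.φ₀).b
  dom_f := by simp [square_f, Pseudomonoid.bot]
  cod_f := by simp [square_g, Pseudomonoid.bot]
  src_φ₂ := by simp [cell_F, Pseudomonoid.bot, arr_comp_k, arr_t1_k]
  tgt_φ₂ := by simp [cell_G, Pseudomonoid.bot, arr_comp_k]
  src_φ₀ := by simp [cell_F, Pseudomonoid.bot]
  tgt_φ₀ := by simp [cell_G, Pseudomonoid.bot, arr_comp_k]
  assoc := (arr_assoc_b K.P K.Q K.dom_f K.cod_f K.src_φ₂ K.tgt_φ₂).1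
    (congrArg (fun c => (cell c).b) K.assoc)
  unit_left := (arr_unit_left_b K.P K.Q K.dom_f K.cod_f K.src_φ₂ K.tgt_φ₂ K.src_φ₀ K.tgt_φ₀).1
    (congrArg (fun c => (cell c).b) K.unit_left)
  unit_right := (arr_unit_right_b K.P K.Q K.dom_f K.cod_f K.src_φ₂ K.tgt_φ₂ K.src_φ₀ K.tgt_φ₀).1
    (congrArg (fun c => (cell c).b) K.unit_right)

/-- The filler of a monoidal 1-cell in the arrow 2-category is a monoidal 2-cell. -/
noncomputable def filler (K : MonArrow N.arr) : MonTrans N where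
  F := K.bot.comp K.P.toMonArrow rfl
  G := K.Q.toMonArrow.comp K.top rfl
  ω := (square K.f).ξ
  hP := rfl
  hQ := rfl
  src_ω := by simp [square_f, comp, bot, Pseudomonoid.toMonArrow]
  tgt_ω := by simp [square_g, comp, top, Pseudomonoid.toMonArrow]
  binary := by
    -- The filler condition of the 2-cell `K.φ₂` is the binary axiom for the filler of `K.f`; that
    -- of `K.φ₀` is the nullary one.
    have h := arr_cell_comm K.φ₂
    simp (maxDischargeDepth := 8) [arr_comp_ξ, arr_t1_h, arr_t1_ξ] at h
    simp [arrow_t0, ← N.t2_idn] at h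
    simp [comp, top, bot, Pseudomonoid.toMonArrow, Pseudomonoid.top, Pseudomonoid.bot] at h ⊢
    rw [← N.vc_assoc, h, N.vc_assoc]
    all_goals simp (maxDischargeDepth := 8) [square_f, square_g, cell_F, cell_G, N.comp_assoc,
      N.t1_comp, arrow_t0, arr_comp_k, arr_comp_h, arr_t1_k, arr_t1_h]
  nullary := by
    have h := arr_cell_comm K.φ₀
    simp (maxDischargeDepth := 8) [arr_comp_ξ] at h
    simp [arrow_I] at h
    simp [comp, top, bot, Pseudomonoid.toMonArrow, Pseudomonoid.top, Pseudomonoid.bot] at h ⊢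
    rw [N.hc_one_of _ N.I (by simp [cell_F, square_f, arrow_I])] at h
    rw [← N.vc_assoc, h]
    all_goals simp (maxDischargeDepth := 8) [square_f, square_g, cell_G, N.comp_assoc, arrow_I,
      arr_comp_k]

end MonArrow


/-! ### Coherent 2-cells and their passage to monoidal 2-cells -/

namespace IsCoherent
variable {s : Prop} {N : SM2Cat.{u}}

theorem idn (f : N.Ar) : IsCoherent s N (N.idn f) := ⟨IsInv.idn f, fun _ => by simp⟩

theorem t2 {a b : N.Ce} (ha : IsCoherent s N a) (hb : IsCoherent s N b) :
    IsCoherent s N (N.t2 a b) := by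
  refine ⟨ha.1.t2 hb.1, fun h => ?_⟩
  have e1 := ha.2 h
  have e2 := hb.2 h
  rw [N.src_t2, ← N.t2_idn, ← e1, ← e2]

theorem hc_idn {a : N.Ce} (ha : IsCoherent s N a) (w : N.Ar) (hw : N.cod w = N.dom (N.src a)) :
    IsCoherent s N (N.hc a (N.idn w)) := by
  refine ⟨ha.1.hc_idn w hw, fun h => ?_⟩
  have e1 := ha.2 h
  rw [N.src_hc _ _ (by simp [hw]), N.src_idn, N.idn_comp _ _ hw.symm, ← e1]

end IsCoherent

/-- If the underlying 2-cell is an identity, the monoidality axioms force source and target to carry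
the same structure 2-cells. This is how strictness passes from `N` to `N.tenZero`. -/
theorem MonTrans.eq_idn {N : SM2Cat.{u}} (a : MonTrans N) (h : a.ω = N.idn (N.src a.ω)) :
    a = MonTrans.idn a.F := by
  have h1 := a.src_ω
  have h2 := a.tgt_ω
  have e2 := a.binary
  have e0 := a.nullary
  rw [h1] at h
  rw [h, N.tgt_idn] at h2
  have hG : a.G = a.F := by
    refine MonArrow.ext a.hP a.hQ h2.symm ?_ ?_
    · rw [h, N.t2_idn, ← N.idn_comp, ← N.idn_comp, vc_idn_of, idn_vc_of] at e2
      · exact e2.symm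
      all_goals simp [← h2]
    · rw [h, ← N.idn_comp, idn_vc_of] at e0
      · exact e0.symm
      all_goals simp
  exact MonTrans.ext rfl hG h

/-! Passage between the pseudomonoids of `N` and the cells of `N.tenZero`. -/

section TenZero
variable {N : SM2Cat.{u}}

theorem tenZero_comp {G F : MonArrow N} (h : G.P = F.Q) :
    N.tenZero.comp (show N.tenZero.Ar from G) (show N.tenZero.Ar from F) = G.comp F h := dif_pos h

theorem tenZero_hc {b a : MonTrans N} (h : b.F.P = a.F.Q) :
    N.tenZero.hc (show N.tenZero.Ce from b) (show N.tenZero.Ce from a) = b.hc a h := dif_pos h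

theorem tenZero_vc {b a : MonTrans N} (h : b.F = a.G) :
    N.tenZero.vc (show N.tenZero.Ce from b) (show N.tenZero.Ce from a) = b.vc a h := dif_pos h

/-- The monoidal 1-cell underlying a 1-cell of `N.tenZero`. -/
def monArrow (F : N.tenZero.Ar) : MonArrow N := F

/-- The monoidal 2-cell underlying a 2-cell of `N.tenZero`. -/
def monTrans (a : N.tenZero.Ce) : MonTrans N := a

theorem monTrans_hc_ω (b a : N.tenZero.Ce)
    (h : N.tenZero.dom (N.tenZero.src b) = N.tenZero.cod (N.tenZero.src a)) :
    (monTrans (N.tenZero.hc b a)).ω = N.hc (monTrans b).ω (monTrans a).ω := by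
  rw [show monTrans (N.tenZero.hc b a) = (monTrans b).hc (monTrans a) h from dif_pos h]; rfl

theorem monTrans_vc_ω (b a : N.tenZero.Ce) (h : N.tenZero.src b = N.tenZero.tgt a) :
    (monTrans (N.tenZero.vc b a)).ω = N.vc (monTrans b).ω (monTrans a).ω := by
  rw [show monTrans (N.tenZero.vc b a) = (monTrans b).vc (monTrans a) h from dif_pos h]; rfl

theorem monTrans_ext {c d : N.tenZero.Ce} (h1 : N.tenZero.src c = N.tenZero.src d)
    (h2 : N.tenZero.tgt c = N.tenZero.tgt d) (h : (monTrans c).ω = (monTrans d).ω) : c = d :=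
  MonTrans.ext h1 h2 h

/-- The inverse of an invertible monoidal 2-cell is automatically monoidal: conjugate the axioms by
it. -/
theorem IsInv.tenZero {a : N.tenZero.Ce} (h : IsInv N.toTwoCat (monTrans a).ω) :
    IsInv N.tenZero.toTwoCat a := by
  obtain ⟨b, h1, h2, h3, h4⟩ := h
  have e1 := (monTrans a).src_ω
  have e2 := (monTrans a).tgt_ω
  have hb := (monTrans a).binary
  have hn := (monTrans a).nullary
  have hP := (monTrans a).hP
  have hQ := (monTrans a).hQ
  rw [e2] at h1 h4
  rw [e1] at h2 h3
  have d1 : N.dom (monTrans a).G.f = (monTrans a).F.P.A := by simp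
  have d2 : N.cod (monTrans a).G.f = (monTrans a).F.Q.A := by simp
  have d3 : N.src (monTrans a).G.φ₂ = N.comp (monTrans a).F.Q.m (N.t1 (monTrans a).G.f
    (monTrans a).G.f) := by
    simp
  have d4 : N.tgt (monTrans a).G.φ₂ = N.comp (monTrans a).G.f (monTrans a).F.P.m := by simp
  let b' : MonTrans N := ⟨(monTrans a).G, (monTrans a).F, b, hP.symm, hQ.symm, h1, h2, by
      rw [hP, hQ]
      have q : N.vc (N.hc b (N.idn (monTrans a).F.P.m)) (N.vc (N.vc (monTrans a).G.φ₂
          (N.hc (N.idn (monTrans a).F.Q.m) (N.t2 (monTrans a).ω (monTrans a).ω)))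
          (N.hc (N.idn (monTrans a).F.Q.m) (N.t2 b b))) =
          N.vc (N.hc b (N.idn (monTrans a).F.P.m)) (monTrans a).G.φ₂ := by
        rw [N.vc_assoc, ← N.w_hc_vc, ← N.t2_vc, h4, N.t2_idn, ← N.idn_comp, vc_idn_of] <;>
          simp (maxDischargeDepth := 8) [h1, h2]
      rw [← q, ← hb, N.vc_assoc, ← N.vc_assoc, ← N.vc_hc_w, h3, ← N.idn_comp, idn_vc_of] <;>
        simp (maxDischargeDepth := 8) [h1, h2], by
      rw [hP, ← hn, ← N.vc_assoc, ← N.vc_hc_w, h3, ← N.idn_comp, idn_vc_of] <;>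
        simp (maxDischargeDepth := 8) [h1]⟩
  refine ⟨b', rfl, rfl, ?_, ?_⟩
  · exact (tenZero_vc (b := b') (a := monTrans a) rfl).trans (MonTrans.ext rfl rfl h3)
  · exact (tenZero_vc (b := monTrans a) (a := b') rfl).trans (MonTrans.ext rfl rfl h4)

theorem IsCoherent.tenZero {s : Prop} {a : N.tenZero.Ce} (h : IsCoherent s N (monTrans a).ω) :
    IsCoherent s N.tenZero a :=
  ⟨h.1.tenZero, fun hs => (monTrans a).eq_idn (h.2 hs)⟩

namespace MonadIn

/-- The base pseudomonoid. -/
def obA (T : MonadIn N.tenZero.toTwoCat) : Pseudomonoid N := T.A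
/-- The underlying monoidal 1-cell. -/
def arT (T : MonadIn N.tenZero.toTwoCat) : MonArrow N := T.t
/-- The multiplication as a monoidal 2-cell. -/
def ceμ (T : MonadIn N.tenZero.toTwoCat) : MonTrans N := T.μ
/-- The unit as a monoidal 2-cell. -/
def ceη (T : MonadIn N.tenZero.toTwoCat) : MonTrans N := T.η

variable (T : MonadIn N.tenZero.toTwoCat)

theorem arT_P : T.arT.P = T.obA := T.dom_t
theorem arT_Q : T.arT.Q = T.obA := T.cod_t
theorem ceμ_F : T.ceμ.F = T.arT.comp T.arT (T.arT_P.trans T.arT_Q.symm) :=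
  T.src_μ.trans (dif_pos (T.arT_P.trans T.arT_Q.symm))
theorem ceμ_G : T.ceμ.G = T.arT := T.tgt_μ
theorem ceη_F : T.ceη.F = MonArrow.one T.obA := T.src_η
theorem ceη_G : T.ceη.G = T.arT := T.tgt_η

theorem under_A : T.under.A = T.obA.A := rfl
theorem under_t : T.under.t = T.arT.f := rfl
theorem under_μ : T.under.μ = T.ceμ.ω := rfl
theorem under_η : T.under.η = T.ceη.ω := rfl

/-- The binary axioms making `μ` and `η` monoidal 2-cells are exactly the multiplicative and unital
laws of a 1-cell of `Mnd_op`. This is what makes the multiplication of `A` liftable. -/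
theorem isMndOp_m : IsMndOp (T.under.tensor T.under) T.under T.obA.m T.arT.φ₂ where
  dom_h := by simp [tensor, under_A]
  cod_h := by simp [under_A]
  src_χ := by simp [tensor, under_t, arT_Q]
  tgt_χ := by simp [under_t, arT_P]
  mul := by
    have h := T.ceμ.binary
    rw [ceμ_F, ceμ_G] at h
    simp only [MonArrow.comp, arT_P, arT_Q, N.t2_idn] at h
    exact h.symm
  unit := by
    have h := T.ceη.binary
    rw [ceη_F, ceη_G] at h
    simp only [MonArrow.one] at h
    rw [vc_idn_of] at h
    · exact h.symm
    · simp [ceη_F, MonArrow.one]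

/-- The same with the nullary axioms of `μ` and `η`, for the unit of `A`. -/
theorem isMndOp_u : IsMndOp (trivial N N.I) T.under T.obA.u T.arT.φ₀ where
  dom_h := by simp [trivial]
  cod_h := by simp [under_A]
  src_χ := by simp [trivial, arT_Q]
  tgt_χ := by simp [under_t, arT_P]
  mul := by
    have h := T.ceμ.nullary
    rw [ceμ_F, ceμ_G] at h
    simp only [MonArrow.comp, arT_P, arT_Q] at h
    simp [trivial, under_t, arT_Q, under_μ]
    exact h.symm
  unit := by
    have h := T.ceη.nullary
    rw [ceη_F, ceη_G] at h
    simp only [MonArrow.one] at h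
    simp [trivial, arT_Q, under_η]
    rw [vc_idn_of] at h
    · exact h.symm
    · simp [ceη_F, MonArrow.one]

end MonadIn

end TenZero


/-! ### Inductive step: fullness, faithfulness, products and unit -/

/-- A monoidal 1-cell with a monoidal right action, the underlying data of which satisfy `G`. -/
structure IsMonoidalLift (s : Prop) (N : SM2Cat.{u}) (G : MonadIn N.toTwoCat → N.Ar → N.Ce → Prop)
    (T : MonadIn N.tenZero.toTwoCat) (F : N.tenZero.Ar) (ρ : N.tenZero.Ce) : Prop where
  action : IsRightAction (N := N.tenZero) T F ρ
  base : G T.under (monArrow F).f (monTrans ρ).ω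
  bin : IsCoherent s N (monArrow F).φ₂
  nul : IsCoherent s N (monArrow F).φ₀

section Step
variable {s : Prop} {N : SM2Cat.{u}} {G : MonadIn N.toTwoCat → N.Ar → N.Ce → Prop}

/-- Monoidality is reflected by whiskering with a strong `F`: the axioms for `κ.F` are those for `κ`
whiskered, up to the invertible structure 2-cells of `F`. -/
theorem HasLifts.monoidal_of_whisker (H : HasLifts s N G) {T : MonadIn N.toTwoCat} {ρ : N.Ce}
    (F k k' : MonArrow N) (hf : G T F.f ρ) (h2 : IsInv N.toTwoCat F.φ₂)
    (h0 : IsInv N.toTwoCat F.φ₀) (hk : k.P = F.Q) (hk' : k'.P = F.Q) (ω : MonTrans N)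
    (hω : ω.F = k.comp F hk) (hω' : ω.G = k'.comp F hk') (κ : N.Ce) (s1 : N.src κ = k.f)
    (s2 : N.tgt κ = k'.f) (e : N.hc κ (N.idn F.f) = ω.ω) :
    ∃ κ' : MonTrans N, κ'.F = k ∧ κ'.G = k' ∧ κ'.ω = κ := by
  have hQ : k'.Q = k.Q := by
    have := ω.hQ
    rw [hω, hω'] at this
    exact this
  have b2 := ω.binary
  have b0 := ω.nullary
  simp only [hω, hω', MonArrow.comp, ← e] at b2 b0
  have d1 : N.dom k.f = F.Q.A := by simp [hk]
  have d2 : N.dom k'.f = F.Q.A := by simp [hk']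
  have d3 : N.cod k'.f = k.Q.A := by simp [hQ]
  have t2 : N.src k'.φ₂ = N.comp k.Q.m (N.t1 k'.f k'.f) := by simp [hQ]
  have t2' : N.tgt k'.φ₂ = N.comp k'.f F.Q.m := by simp [hk']
  have t3 : N.src k.φ₂ = N.comp k.Q.m (N.t1 k.f k.f) := by simp
  have t3' : N.tgt k.φ₂ = N.comp k.f F.Q.m := by simp [hk]
  have t0 : N.src k'.φ₀ = k.Q.u := by simp [hQ]
  have t0' : N.tgt k'.φ₀ = N.comp k'.f F.Q.u := by simp [hk']
  have t1 : N.src k.φ₀ = k.Q.u := by simp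
  have t1' : N.tgt k.φ₀ = N.comp k.f F.Q.u := by simp [hk]
  refine ⟨⟨k, k', κ, hk'.trans hk.symm, hQ, s1, s2, ?_, ?_⟩, rfl, rfl, rfl⟩
  -- The binary axiom has domain two copies of the codomain of `F`, so it may be tested after
  -- whiskering with `F.f ⊗ F.f`, and then after composing with the invertible `k'.φ₂` of `F`, that
  -- is, `F.φ₂` whiskered by `k'.f`.
  · refine H.faithful (H.tensor hf hf) _ _ ?_ ?_ ?_ ?_
    · simp (maxDischargeDepth := 8) [*]
    · simp (maxDischargeDepth := 8) [*]
    · simp (maxDischargeDepth := 8) [*]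
    · refine (h2.idn_hc k'.f (by simp [*])).cancel ?_ ?_ ?_
      · simp (maxDischargeDepth := 8) [*, N.comp_assoc]
      · simp (maxDischargeDepth := 8) [*, N.comp_assoc]
      · have x := N.exchange κ F.φ₂ (by simp [*])
        simp only [hk, s1, s2, F.src_φ₂, F.tgt_φ₂] at x ⊢
        rw [N.t2_hc] at b2
        simp (maxDischargeDepth := 8) [vc_hc_w, N.idn_comp, N.hc_assoc, N.vc_assoc,
          N.comp_assoc, ← N.t2_idn, d1, d2, d3, s1, s2, t2, t2', t3, t3'] at x b2 ⊢
        rw [N.vc_congr2 x.symm, b2]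
        all_goals simp (maxDischargeDepth := 8) [*, N.comp_assoc]
  -- The nullary axiom already has domain `I`: no whiskering is needed, only cancellation of the
  -- whiskered `F.φ₀`.
  · refine (h0.idn_hc k'.f (by simp [*])).cancel ?_ ?_ ?_
    · simp (maxDischargeDepth := 8) [*]
    · simp (maxDischargeDepth := 8) [*]
    · have x := N.exchange κ F.φ₀ (by simp [*])
      simp only [hk, s1, s2, F.src_φ₀, F.tgt_φ₀] at x ⊢
      simp (maxDischargeDepth := 8) [N.idn_comp, N.hc_assoc, d1, s1] at x b0 ⊢
      rw [N.vc_congr2 x.symm, b0]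
      all_goals simp (maxDischargeDepth := 8) [*]

namespace IsMonoidalLift
variable {T S : MonadIn N.tenZero.toTwoCat} {F K : N.tenZero.Ar} {ρ σ : N.tenZero.Ce}

/-- Fullness in `N` provides the underlying 2-cell, and `monoidal_of_whisker` makes it monoidal
since `F` is strong. -/
theorem full (H : HasLifts s N G) (hF : IsMonoidalLift s N G T F ρ) (k k' : N.tenZero.Ar)
    (ω : N.tenZero.Ce) (hk : N.tenZero.dom k = N.tenZero.cod F)
    (hk' : N.tenZero.dom k' = N.tenZero.cod F) (hω : N.tenZero.src ω = N.tenZero.comp k F)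
    (hω' : N.tenZero.tgt ω = N.tenZero.comp k' F)
    (e : N.tenZero.vc ω (N.tenZero.hc (N.tenZero.idn k) ρ) =
      N.tenZero.vc (N.tenZero.hc (N.tenZero.idn k') ρ) (N.tenZero.hc ω (N.tenZero.idn T.t))) :
    ∃ κ, N.tenZero.src κ = k ∧ N.tenZero.tgt κ = k' ∧ N.tenZero.hc κ (N.tenZero.idn F) = ω := by
  have q1 : (monTrans ω).F = (monArrow k).comp (monArrow F) hk := hω.trans (dif_pos hk)
  have q2 : (monTrans ω).G = (monArrow k').comp (monArrow F) hk' := hω'.trans (dif_pos hk')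
  have a1 := hF.action.dom_f
  have a2 := hF.action.src_ρ
  have a3 := hF.action.tgt_ρ
  have e' := congrArg (fun c => (monTrans c).ω) e
  rw [monTrans_vc_ω, monTrans_vc_ω, monTrans_hc_ω, monTrans_hc_ω, monTrans_hc_ω] at e'
  · obtain ⟨κ, h1, h2, h3⟩ := H.full hF.base (monArrow k).f (monArrow k').f (monTrans ω).ω
      (by rw [MonArrow.dom_f, MonArrow.cod_f]; exact congrArg Pseudomonoid.A hk)
      (by rw [MonArrow.dom_f, MonArrow.cod_f]; exact congrArg Pseudomonoid.A hk')
      (by rw [MonTrans.src_ω, q1]; rfl) (by rw [MonTrans.tgt_ω, q2]; rfl) e'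
    obtain ⟨κ', k1, k2, k3⟩ := H.monoidal_of_whisker (monArrow F) (monArrow k) (monArrow k')
      hF.base hF.bin.1 hF.nul.1 hk hk' (monTrans ω) q1 q2 κ h1 h2 h3
    have d : κ'.F.P = (MonTrans.idn (monArrow F)).F.Q := by rw [k1]; exact hk
    refine ⟨κ', k1, k2, (tenZero_hc d).trans (MonTrans.ext ?_ ?_ ?_)⟩
    · refine Eq.trans ?_ q1.symm
      simp only [MonTrans.hc, MonTrans.idn, k1]
    · refine Eq.trans ?_ q2.symm
      simp only [MonTrans.hc, MonTrans.idn, k2]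
    · simp only [MonTrans.hc, MonTrans.idn, k3, h3]; rfl
  all_goals simp (maxDischargeDepth := 8) [a1, a2, a3, hk, hk', hω, hω', N.tenZero.comp_assoc]

theorem faithful (H : HasLifts s N G) (hF : IsMonoidalLift s N G T F ρ) (κ κ' : N.tenZero.Ce)
    (h1 : N.tenZero.src κ = N.tenZero.src κ') (h2 : N.tenZero.tgt κ = N.tenZero.tgt κ')
    (h3 : N.tenZero.dom (N.tenZero.src κ) = N.tenZero.cod F)
    (e : N.tenZero.hc κ (N.tenZero.idn F) = N.tenZero.hc κ' (N.tenZero.idn F)) : κ = κ' := by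
  have e' := congrArg (fun c => (monTrans c).ω) e
  rw [monTrans_hc_ω _ _ (by simp [h3]), monTrans_hc_ω _ _ (by simp [← h1, h3])] at e'
  refine monTrans_ext h1 h2 (H.faithful hF.base _ _ ?_ ?_ ?_ e')
  · rw [MonTrans.src_ω, MonTrans.src_ω]; exact congrArg MonArrow.f h1
  · rw [MonTrans.tgt_ω, MonTrans.tgt_ω]; exact congrArg MonArrow.f h2
  · rw [MonTrans.src_ω, MonArrow.dom_f, MonArrow.cod_f]; exact congrArg Pseudomonoid.A h3

theorem tensor (H : HasLifts s N G) (hF : IsMonoidalLift s N G T F ρ)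
    (hK : IsMonoidalLift s N G S K σ) :
    IsMonoidalLift s N G (T.tensor S) (N.tenZero.t1 F K) (N.tenZero.t2 ρ σ) where
  action := hF.action.tensor hK.action
  base := H.tensor hF.base hK.base
  bin := (hF.bin.t2 hK.bin).hc_idn _ (by simp; rfl)
  nul := hF.nul.t2 hK.nul

theorem unit (H : HasLifts s N G) : IsMonoidalLift s N G (MonadIn.trivial N.tenZero N.tenZero.I)
    (N.tenZero.one N.tenZero.I) (N.tenZero.idn (N.tenZero.one N.tenZero.I)) where
  action := ⟨by simp; rfl, by simp [MonadIn.trivial], by simp⟩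
  base := H.unit
  bin := .idn _
  nul := .idn _

end IsMonoidalLift

end Step


/-! ### Inductive step: pseudomonoids with a prescribed top -/

theorem IsInv.arr_comp_ξ {N : SM2Cat.{u}} {Y X : N.arr.Ar} (hY : IsInv N.toTwoCat (square Y).ξ)
    (hX : IsInv N.toTwoCat (square X).ξ) (e : N.arr.dom Y = N.arr.cod X) :
    IsInv N.toTwoCat (square (N.arr.comp Y X)).ξ := by
  rw [square_comp e]; exact Square.isInv_comp e hY hX

theorem IsInv.arr_t1_ξ {N : SM2Cat.{u}} {Y X : N.arr.Ar} (hY : IsInv N.toTwoCat (square Y).ξ)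
    (hX : IsInv N.toTwoCat (square X).ξ) : IsInv N.toTwoCat (square (N.arr.t1 Y X)).ξ :=
  hY.t2 hX

theorem IsInv.arr_one_ξ {N : SM2Cat.{u}} (f : N.arr.Ob) :
    IsInv N.toTwoCat (square (N.arr.one f)).ξ :=
  IsInv.idn _

namespace HasLifts
variable {s : Prop} {N : SM2Cat.{u}} {G : MonadIn N.toTwoCat → N.Ar → N.Ce → Prop}
  {T : MonadIn N.toTwoCat} {ρ : N.Ce}

theorem arr_ext (H : HasLifts s N G) {f : N.Ar} (hf : G T f ρ) {c d : N.arr.Ce}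
    (hc : N.arr.dom (N.arr.src c) = arrOb f) (h1 : N.arr.src c = N.arr.src d)
    (h2 : N.arr.tgt c = N.arr.tgt d) (ha : (cell c).a = (cell d).a)
    (hi : IsInv N.toTwoCat (square (N.arr.tgt c)).ξ) : c = d :=
  H.cell_ext hf (cell c) (cell d) hc h1 h2 ha hi

/-- No axiom is assumed for the bottom data: each axiom holds on tops because `A` is a pseudomonoid,
and then everywhere because the fillers are invertible. -/
theorem exists_pseudomonoid (H : HasLifts s N G) (A : Pseudomonoid N) {f : N.arr.Ob}
    (hf : G T (arrow f) ρ) (dom_f : N.dom (arrow f) = A.A) (m e : N.arr.Ar) (α l r : N.arr.Ce)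
    (dom_m : N.arr.dom m = N.arr.t0 f f) (cod_m : N.arr.cod m = f) (dom_e : N.arr.dom e = N.arr.I)
    (cod_e : N.arr.cod e = f) (src_α : N.arr.src α = N.arr.comp m (N.arr.t1 m (N.arr.one f)))
    (tgt_α : N.arr.tgt α = N.arr.comp m (N.arr.t1 (N.arr.one f) m))
    (src_l : N.arr.src l = N.arr.comp m (N.arr.t1 e (N.arr.one f))) (tgt_l : N.arr.tgt l =
      N.arr.one f)
    (src_r : N.arr.src r = N.arr.comp m (N.arr.t1 (N.arr.one f) e)) (tgt_r : N.arr.tgt r =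
      N.arr.one f)
    (hm : (square m).h = A.m) (he : (square e).h = A.u) (hα : (cell α).a = A.α)
    (hl : (cell l).a = A.l) (hr : (cell r).a = A.r) (iα : IsInv N.arr.toTwoCat α)
    (il : IsInv N.arr.toTwoCat l) (ir : IsInv N.arr.toTwoCat r)
    (im : IsInv N.toTwoCat (square m).ξ) :
    ∃ P : Pseudomonoid N.arr, P.top = A ∧ P.A = f ∧ P.m = m ∧ P.u = e := by
  have i1 := IsInv.arr_one_ξ f
  refine ⟨⟨f, m, e, α, l, r, dom_m, cod_m, dom_e, cod_e, src_α, tgt_α, src_l, tgt_l, src_r, tgt_r,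
    iα, il, ir, ?_, ?_⟩, Pseudomonoid.ext dom_f hm he hα hl hr, rfl, rfl, rfl⟩
  · obtain ⟨h1, h2⟩ := N.arr.pentagon_parallel dom_m cod_m src_α tgt_α
    refine H.arr_ext (H.tensor hf (H.tensor hf (H.tensor hf hf))) ?_ h1 h2
      (arr_pentagon_a dom_m cod_m src_α tgt_α ?_) ?_
    · refine (congrArg N.arr.dom h1).trans ?_
      simp (maxDischargeDepth := 8) [N.arr.t2_idn, N.arr.comp_assoc, one_t1_one_t1, merge1, merge2,
        src_α, tgt_α, dom_m, cod_m]
      rfl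
    · have h := A.pentagon
      rwa [← dom_f, ← hm, ← hα] at h
    -- The pentagon ends at `m.(1m).(11m)`, a pasting of squares with invertible fillers.
    · rw [h2, N.arr.tgt_vc, N.arr.tgt_hc, tgt_α]
      · refine (im.arr_comp_ξ (i1.arr_t1_ξ im) ?_).arr_comp_ξ (i1.arr_t1_ξ (i1.arr_t1_ξ im)) ?_ <;>
          simp [dom_m, cod_m]
      all_goals simp (maxDischargeDepth := 8) [N.arr.t2_idn, N.arr.comp_assoc, one_t1_one_t1,
        merge1, merge2, src_α, tgt_α, dom_m, cod_m]
  · obtain ⟨h1, h2⟩ := N.arr.triangle_parallel dom_m cod_m cod_e src_α tgt_α src_l tgt_l src_r tgt_r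
    refine H.arr_ext (H.tensor hf hf) ?_ h1 h2
      (arr_triangle_a dom_m cod_m src_α tgt_α cod_e src_l src_r ?_) ?_
    · refine (congrArg N.arr.dom h1).trans ?_
      simp (maxDischargeDepth := 8) [dom_m, cod_m, src_r, cod_e, dom_e]
      rfl
    · have h := A.triangle
      rwa [← dom_f, ← hm, ← hα, ← hl, ← hr, ← he] at h
    -- The triangle ends at `m` itself.
    · rw [h2]
      simp (maxDischargeDepth := 8) [dom_m, cod_m, tgt_r, src_r, cod_e]
      exact im

end HasLifts


/-! ### Inductive step: lifting the base object of a monad -/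

/-- Reconciles the two bracketings of a triple product of monads, and `I ⊗ T` with `T`. Equivariance
sees only the base and the 1-cell of the acting monad and the action, so an equality of whole monads
is not required. -/
theorem IsModuleSquare.congr {N : SM2Cat.{u}} {T T' S : MonadIn N.toTwoCat} {ρ ρ' σ : N.Ce}
    {X : Square N} {χ : N.Ce} (h : IsModuleSquare T S ρ σ X χ) (hA : T'.A = T.A) (ht : T'.t = T.t)
    (hρ : ρ' = ρ) : IsModuleSquare T' S ρ' σ X χ := by
  subst hρ
  refine ⟨⟨h.left.1.trans hA.symm, ?_, h.left.3⟩, h.right, ?_, h.tgt_χ, ?_⟩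
  · rw [ht]; exact h.left.2
  · rw [ht]; exact h.src_χ
  · rw [ht]; exact h.comm

namespace MonadIn
variable {N : SM2Cat.{u}} (T : MonadIn N.tenZero.toTwoCat)

/-- The monoidality axioms of `t` written with the single base pseudomonoid `T.obA`, in place of the
propositionally equal domain and codomain of `t`. -/
theorem arT_assoc : N.vc (N.hc (N.idn T.arT.f) T.obA.α)
      (N.vc (N.hc T.arT.φ₂ (N.t2 (N.idn T.obA.m) (N.idn (N.one T.obA.A))))
        (N.hc (N.idn T.obA.m) (N.t2 T.arT.φ₂ (N.idn T.arT.f)))) =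
    N.vc (N.hc T.arT.φ₂ (N.t2 (N.idn (N.one T.obA.A)) (N.idn T.obA.m)))
      (N.vc (N.hc (N.idn T.obA.m) (N.t2 (N.idn T.arT.f) T.arT.φ₂))
        (N.hc T.obA.α (N.t2 (N.idn T.arT.f) (N.t2 (N.idn T.arT.f) (N.idn T.arT.f))))) := by
  have h := T.arT.assoc
  rwa [arT_P, arT_Q] at h

theorem arT_unit_left : N.vc (N.hc (N.idn T.arT.f) T.obA.l)
      (N.vc (N.hc T.arT.φ₂ (N.t2 (N.idn T.obA.u) (N.idn (N.one T.obA.A))))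
        (N.hc (N.idn T.obA.m) (N.t2 T.arT.φ₀ (N.idn T.arT.f)))) =
    N.hc T.obA.l (N.idn T.arT.f) := by
  have h := T.arT.unit_left
  rwa [arT_P, arT_Q] at h

theorem arT_unit_right : N.vc (N.hc (N.idn T.arT.f) T.obA.r)
      (N.vc (N.hc T.arT.φ₂ (N.t2 (N.idn (N.one T.obA.A)) (N.idn T.obA.u)))
        (N.hc (N.idn T.obA.m) (N.t2 (N.idn T.arT.f) T.arT.φ₀))) =
    N.hc T.obA.r (N.idn T.arT.f) := by
  have h := T.arT.unit_right
  rwa [arT_P, arT_Q] at h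

theorem dom_arT : N.dom T.arT.f = T.obA.A := by rw [T.arT.dom_f, arT_P]
theorem cod_arT : N.cod T.arT.f = T.obA.A := by rw [T.arT.cod_f, arT_Q]
theorem src_arTφ₂ : N.src T.arT.φ₂ = N.comp T.obA.m (N.t1 T.arT.f T.arT.f) := by
  rw [T.arT.src_φ₂, arT_Q]
theorem tgt_arTφ₂ : N.tgt T.arT.φ₂ = N.comp T.arT.f T.obA.m := by
  rw [T.arT.tgt_φ₂, arT_P]
theorem src_arTφ₀ : N.src T.arT.φ₀ = T.obA.u := by
  rw [T.arT.src_φ₀, arT_Q]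
theorem tgt_arTφ₀ : N.tgt T.arT.φ₀ = N.comp T.arT.f T.obA.u := by
  rw [T.arT.tgt_φ₀, arT_P]

end MonadIn

namespace HasLifts
variable {s : Prop} {N : SM2Cat.{u}} {G : MonadIn N.toTwoCat → N.Ar → N.Ce → Prop}

/-- The squares `M` and `U` lift multiplication and unit. The constraints of `A` are 2-cells between
composites of these in `Mnd_op`, by the monoidality axioms of `t`, and so lift to invertible 2-cells
of squares. -/
theorem exists_lift_object (H : HasLifts s N G) (T : MonadIn N.tenZero.toTwoCat) {f : N.Ar}
    {ρ : N.Ce} (hf : G T.under f ρ) (M U : Square N) (hMf : M.f = N.t1 f f) (hMg : M.g = f)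
    (hMh : M.h = T.obA.m) (hMi : IsInv N.toTwoCat M.ξ)
    (hM : IsModuleSquare (T.under.tensor T.under) T.under (N.t2 ρ ρ) ρ M T.arT.φ₂)
    (hUf : U.f = N.one N.I) (hUg : U.g = f) (hUh : U.h = T.obA.u) (hUi : IsInv N.toTwoCat U.ξ)
    (hU : IsModuleSquare (MonadIn.trivial N N.I) T.under (N.idn (N.one N.I)) ρ U T.arT.φ₀) :
    ∃ P : Pseudomonoid N.arr, P.top = T.obA ∧ arrow P.A = f ∧ square P.m = M ∧ square P.u = U := by
  have df : N.dom f = T.obA.A := (H.action hf).dom_f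
  have h1 := IsModuleSquare.one (H.action hf)
  have hMi1 : IsInv N.toTwoCat (M.tensor (Square.one f)).ξ := hMi.t2 (.idn _)
  have h1Mi : IsInv N.toTwoCat ((Square.one f).tensor M).ξ := IsInv.t2 (.idn _) hMi
  have hUi1 : IsInv N.toTwoCat (U.tensor (Square.one f)).ξ := hUi.t2 (.idn _)
  have h1Ui : IsInv N.toTwoCat ((Square.one f).tensor U).ξ := IsInv.t2 (.idn _) hUi
  have eM1 : M.f = (M.tensor (Square.one f)).g := by simp [Square.tensor, Square.one, hMf, hMg]
  have e1M : M.f = ((Square.one f).tensor M).g := by simp [Square.tensor, Square.one, hMf, hMg]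
  have eU1 : M.f = (U.tensor (Square.one f)).g := by simp [Square.tensor, Square.one, hMf, hUg]
  have e1U : M.f = ((Square.one f).tensor U).g := by simp [Square.tensor, Square.one, hMf, hUg]
  -- The source square is `M.(M ⊗ 1)` and the target square `M.(1 ⊗ M)`, both over `fff`.
  obtain ⟨α, α1, α2, α3, α4⟩ := H.exists_iso _ _ (by
      simpa [Square.comp, Square.tensor, Square.one, hMf] using H.tensor (H.tensor hf hf) hf)
    (hM.comp (hM.tensor h1) eM1)
    ((hM.comp (h1.tensor hM) e1M).congr (by simp [MonadIn.tensor])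
      (by simp [MonadIn.tensor, N.t1_assoc]) (N.t2_assoc ρ ρ ρ))
    (by simp [Square.comp, Square.tensor, Square.one, hMf, N.t1_assoc]) rfl
    (Square.isInv_comp eM1 hMi hMi1) (Square.isInv_comp e1M hMi h1Mi) T.obA.α
    (by simp [Square.comp, Square.tensor, Square.one, hMh, df])
    (by simp [Square.comp, Square.tensor, Square.one, hMh, df])
    (by
      -- Compatibility of the associativity constraint with the two `Mnd_op` structures is the
      -- associativity axiom of the monoidal 1-cell `t`.
      have h := T.arT_assoc
      simp [Square.tensor, Square.one, MonadIn.tensor, MonadIn.under_t, hMh, df, ← N.t2_idn] at h ⊢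
      rw [h, N.vc_assoc, N.t2_assoc] <;>
        simp (maxDischargeDepth := 8) [T.dom_arT, T.cod_arT, T.src_arTφ₂, T.tgt_arTφ₂, N.comp_assoc,
          N.t1_assoc, k1', k2']) T.obA.inv_α
  obtain ⟨l, l1, l2, l3, l4⟩ := H.exists_iso _ _ (by
      simpa [Square.comp, Square.tensor, Square.one, hUf] using hf)
    ((hM.comp (hU.tensor h1) eU1).congr (T' := T.under) (by simp [MonadIn.tensor, MonadIn.trivial])
      (by simp [MonadIn.tensor, MonadIn.trivial]) (N.I_t2 ρ).symm) h1
    (by simp [Square.comp, Square.tensor, Square.one, hUf]) (by simp [Square.comp, Square.one, hMg])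
    (Square.isInv_comp eU1 hMi hUi1) (.idn _) T.obA.l
    (by simp [Square.comp, Square.tensor, Square.one, hMh, hUh, df])
    (by simp [Square.one, df])
    (by
      -- Likewise, the unit constraint is compatible with them by the unit axiom of `t`.
      have h := T.arT_unit_left
      simp [Square.tensor, Square.one, MonadIn.under_t, hMh, hUh, df, ← N.t2_idn] at h ⊢
      rw [h, idn_vc_of]
      simp [T.cod_arT]) T.obA.inv_l
  obtain ⟨r, r1, r2, r3, r4⟩ := H.exists_iso _ _ (by
      simpa [Square.comp, Square.tensor, Square.one, hUf] using hf)
    ((hM.comp (h1.tensor hU) e1U).congr (T' := T.under) (by simp [MonadIn.tensor, MonadIn.trivial])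
      (by simp [MonadIn.tensor, MonadIn.trivial]) (N.t2_I ρ).symm) h1
    (by simp [Square.comp, Square.tensor, Square.one, hUf]) (by simp [Square.comp, Square.one, hMg])
    (Square.isInv_comp e1U hMi h1Ui) (.idn _) T.obA.r
    (by simp [Square.comp, Square.tensor, Square.one, hMh, hUh, df])
    (by simp [Square.one, df])
    (by
      have h := T.arT_unit_right
      simp [Square.tensor, Square.one, MonadIn.under_t, hMh, hUh, df, ← N.t2_idn] at h ⊢
      rw [h, idn_vc_of]
      simp [T.cod_arT]) T.obA.inv_r
  obtain ⟨P, p1, p2, p3, p4⟩ := H.exists_pseudomonoid T.obA (f := arrOb f) hf df (arrAr M)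
    (arrAr U) (arrCe α) (arrCe l) (arrCe r) hMf hMg hUf hUg
    (α1.trans (arr_comp_eq eM1).symm) (α2.trans (arr_comp_eq e1M).symm)
    (l1.trans (arr_comp_eq eU1).symm) l2 (r1.trans (arr_comp_eq e1U).symm) r2 hMh hUh α3 l3 r3
    α4 l4 r4 hMi
  exact ⟨P, p1, p2, p3, p4⟩

end HasLifts


section
variable {s : Prop} {N : SM2Cat.{u}} {G : MonadIn N.toTwoCat → N.Ar → N.Ce → Prop}

/-- The lifted pseudomonoid in `arr N`, read as a monoidal 1-cell, is the required free 1-cell; the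
coherent fillers of the lifted squares are its structure 2-cells. -/
theorem IsMonoidalLift.exists_free (H : HasLifts s N G) (T : MonadIn N.tenZero.toTwoCat) :
    ∃ F ρ, IsMonoidalLift s N G T F ρ := by
  obtain ⟨f, ρ, hf⟩ := H.exists_free T.under
  obtain ⟨M, M1, M2, M3, M4, M5⟩ := H.lift (H.tensor hf hf) hf _ _ T.isMndOp_m
  obtain ⟨U, U1, U2, U3, U4, U5⟩ := H.lift H.unit hf _ _ T.isMndOp_u
  obtain ⟨P, p1, rfl, rfl, rfl⟩ := H.exists_lift_object T hf M U M1 M2 M3 M4.1 M5 U1 U2 U3 U4.1 U5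
  have hA := H.action hf
  have e : P.toMonArrow.P = T.arT.Q := p1.trans T.arT_Q.symm
  -- The action is monoidal because its binary and nullary axioms are the equivariance conditions of
  -- the two lifted squares.
  let ρ' : MonTrans N :=
    { F := P.toMonArrow.comp T.arT e
      G := P.toMonArrow
      ω := ρ
      hP := p1.trans T.arT_P.symm
      hQ := rfl
      src_ω := hA.src_ρ
      tgt_ω := hA.tgt_ρ
      binary := by
        have h := M5.comm
        rw [M2, M3] at h
        refine Eq.trans ?_ h.symm
        simp only [MonArrow.comp, T.arT_P, N.t2_idn]
        rfl
      nullary := by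
        have h := U5.comm
        rw [U2, U3] at h
        simp [U1, MonadIn.trivial] at h
        simp only [MonArrow.comp, T.arT_P]
        exact h.symm }
  refine ⟨P.toMonArrow, ρ', ⟨p1, (tenZero_comp e).symm, rfl⟩, hf, M4, U4⟩

end


/-! ### Inductive step: lifting 1-cells of `Mnd_op` -/

section
variable {s : Prop} {N : SM2Cat.{u}} {G : MonadIn N.toTwoCat → N.Ar → N.Ce → Prop}
  {T S : MonadIn N.tenZero.toTwoCat} {F K : N.tenZero.Ar} {ρ σ : N.tenZero.Ce}

theorem IsMndOp.under {h : N.tenZero.Ar} {χ : N.tenZero.Ce}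
    (H : IsMndOp (N := N.tenZero.toTwoCat) T S h χ) :
    IsMndOp T.under S.under (monArrow h).f (monTrans χ).ω := by
  have d1 := H.dom_h
  have d2 := H.cod_h
  have d3 := H.src_χ
  have d4 := H.tgt_χ
  have q1 : (monTrans χ).F = (monArrow h).comp T.arT (d1.trans T.arT_Q.symm) :=
    d3.trans (tenZero_comp _)
  have q2 : (monTrans χ).G = S.arT.comp (monArrow h) (S.arT_P.trans d2.symm) :=
    d4.trans (tenZero_comp _)
  refine ⟨?_, ?_, ?_, ?_, ?_, ?_⟩
  · rw [MonArrow.dom_f]; exact congrArg Pseudomonoid.A d1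
  · rw [MonArrow.cod_f]; exact congrArg Pseudomonoid.A d2
  · rw [MonTrans.src_ω, q1]; rfl
  · rw [MonTrans.tgt_ω, q2]; rfl
  · have e := congrArg (fun c => (monTrans c).ω) H.mul
    rw [monTrans_vc_ω, monTrans_vc_ω, monTrans_vc_ω, monTrans_hc_ω, monTrans_hc_ω, monTrans_hc_ω,
      monTrans_hc_ω] at e
    · exact e
    all_goals simp (maxDischargeDepth := 8) [d1, d2, d3, d4, N.tenZero.comp_assoc]
  · have e := congrArg (fun c => (monTrans c).ω) H.unit
    rw [monTrans_vc_ω, monTrans_hc_ω, monTrans_hc_ω] at e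
    · exact e
    all_goals simp (maxDischargeDepth := 8) [d1, d2, d3]

namespace IsMonoidalLift

theorem P_eq (hF : IsMonoidalLift s N G T F ρ) : (monArrow F).P = T.obA := hF.action.dom_f

theorem F_eq (hF : IsMonoidalLift s N G T F ρ) :
    (monTrans ρ).F = (monArrow F).comp T.arT (hF.P_eq.trans T.arT_Q.symm) :=
  hF.action.src_ρ.trans (tenZero_comp _)

theorem G_eq (hF : IsMonoidalLift s N G T F ρ) : (monTrans ρ).G = monArrow F := hF.action.tgt_ρ

/-- The converse reading of the step in `exists_free`: monoidality of the action is equivariance of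
the binary structure square. -/
theorem binary (H : HasLifts s N G) (hF : IsMonoidalLift s N G T F ρ) :
    IsModuleSquare (T.under.tensor T.under) T.under (N.t2 (monTrans ρ).ω (monTrans ρ).ω)
      (monTrans ρ).ω (monArrow F).sqm T.arT.φ₂ where
  left := H.action (H.tensor hF.base hF.base)
  right := H.action hF.base
  src_χ := by rw [T.src_arTφ₂, ← hF.P_eq]; rfl
  tgt_χ := by rw [T.tgt_arTφ₂, ← hF.P_eq]; rfl
  comm := by
    have h := (monTrans ρ).binary
    rw [hF.F_eq, hF.G_eq] at h
    simp only [MonArrow.comp, T.arT_P, ← hF.P_eq, N.t2_idn] at h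
    exact h.symm

theorem nullary (H : HasLifts s N G) (hF : IsMonoidalLift s N G T F ρ) :
    IsModuleSquare (MonadIn.trivial N N.I) T.under (N.idn (N.one N.I))
      (monTrans ρ).ω (monArrow F).squ T.arT.φ₀ where
  left := H.action H.unit
  right := H.action hF.base
  src_χ := by rw [T.src_arTφ₀, ← hF.P_eq]; simp [MonArrow.squ, MonadIn.trivial]
  tgt_χ := by rw [T.tgt_arTφ₀, ← hF.P_eq]; rfl
  comm := by
    have h := (monTrans ρ).nullary
    rw [hF.F_eq, hF.G_eq] at h
    simp only [MonArrow.comp, T.arT_P, ← hF.P_eq] at h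
    simp [MonArrow.squ, MonadIn.trivial]
    exact h.symm

end IsMonoidalLift

namespace HasLifts

/-- The analogue of `exists_pseudomonoid` for 1-cells: the tops of the axioms are those of the
monoidal 1-cell `h`, and the bottoms follow since the target fillers are invertible. -/
theorem exists_monArrow (H : HasLifts s N G) {T : MonadIn N.toTwoCat} {ρ : N.Ce}
    (F K h : MonArrow N) (hf : G T F.f ρ) (hP : h.P = F.P) (hQ : h.Q = K.P) (X : Square N)
    (hXf : X.f = F.f) (hXg : X.g = K.f) (hXh : X.h = h.f) (hi : IsInv N.toTwoCat X.ξ)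
    (i2 : IsInv N.toTwoCat F.φ₂) (c2 c0 : SquareCell N)
    (h2 : c2.F = K.sqm.comp (X.tensor X) (by simp [MonArrow.sqm, Square.tensor, hXg]))
    (h2' : c2.G = X.comp F.sqm hXf) (h2a : c2.a = h.φ₂)
    (h0 : c0.F = K.squ) (h0' : c0.G = X.comp F.squ hXf) (h0a : c0.a = h.φ₀) :
    ∃ L : MonArrow N.arr, L.P = .ofMonArrow F ∧ L.Q = .ofMonArrow K ∧ square L.f = X ∧
      L.top = h := by
  obtain ⟨P, hPe⟩ : ∃ P, P = Pseudomonoid.ofMonArrow F := ⟨_, rfl⟩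
  obtain ⟨Q, hQe⟩ : ∃ Q, Q = Pseudomonoid.ofMonArrow K := ⟨_, rfl⟩
  have tP : P.top = h.P := by rw [hPe, Pseudomonoid.top_ofMonArrow, hP]
  have tQ : Q.top = h.Q := by rw [hQe, Pseudomonoid.top_ofMonArrow, hQ]
  have df : N.arr.dom (arrAr X) = P.A := by rw [hPe]; exact hXf
  have cf : N.arr.cod (arrAr X) = Q.A := by rw [hQe]; exact hXg
  have s2 : N.arr.src (arrCe c2) = N.arr.comp Q.m (N.arr.t1 (arrAr X) (arrAr X)) := by
    rw [hQe]; exact h2.trans (arr_comp_eq _).symm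
  have t2 : N.arr.tgt (arrCe c2) = N.arr.comp (arrAr X) P.m := by
    rw [hPe]; exact h2'.trans (arr_comp_eq _).symm
  have s0 : N.arr.src (arrCe c0) = Q.u := by
    rw [hQe]; exact h0
  have t0 : N.arr.tgt (arrCe c0) = N.arr.comp (arrAr X) P.u := by
    rw [hPe]; exact h0'.trans (arr_comp_eq _).symm
  have j2 : IsInv N.toTwoCat (square P.m).ξ := by rw [hPe]; exact i2
  have hf' : G T (arrow P.A) ρ := by rw [hPe]; exact hf
  have i1 := IsInv.arr_one_ξ P.A
  have eh : (square (arrAr X)).h = h.f := hXh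
  have e2 : (cell (arrCe c2)).a = h.φ₂ := h2a
  have e0 : (cell (arrCe c0)).a = h.φ₀ := h0a
  have hi' : IsInv N.toTwoCat (square (arrAr X)).ξ := hi
  refine ⟨⟨P, Q, arrAr X, arrCe c2, arrCe c0, df, cf, s2, t2, s0, t0, ?_, ?_, ?_⟩, hPe, hQe, rfl,
    MonArrow.ext tP tQ hXh h2a h0a⟩
  · obtain ⟨h1, h2⟩ := N.arr.assoc_parallel P Q df cf s2 t2
    have a1 := N.arr.k1 (arrAr X) P.m (by simp [df])
    have a2 := N.arr.k1' (arrAr X) P.m (by simp [df])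
    have a3 := N.arr.k2 (arrAr X) Q.m (by simp [cf])
    have a4 := N.arr.k2' (arrAr X) Q.m (by simp [cf])
    simp only [df, cf] at a1 a2 a3 a4
    refine H.arr_ext (H.tensor hf' (H.tensor hf' hf')) ?_ h1 h2
      ((arr_assoc_a P Q df cf s2 t2).2 ?_) ?_
    · refine (congrArg N.arr.dom h1).trans ?_
      simp (maxDischargeDepth := 8) [N.arr.comp_assoc, a2, a4, df, cf, s2, t2]
      rfl
    · rw [tP, tQ, eh, e2]; exact h.assoc
    -- The associativity axiom ends at `X.m.(1m)` for the multiplication `m` of `P`, so only the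
    -- fillers of `X` and of the domain multiplication matter.
    · rw [h2, N.arr.tgt_vc, N.arr.tgt_hc, t2]
      · refine (hi'.arr_comp_ξ j2 ?_).arr_comp_ξ (i1.arr_t1_ξ j2) ?_ <;> simp [df]
      all_goals
        simp (maxDischargeDepth := 8) [N.arr.comp_assoc, a2, a4, df, cf, s2, t2]
  · obtain ⟨h1, h2⟩ := N.arr.unit_left_parallel P Q df cf s2 t2 s0 t0
    refine H.arr_ext hf' ?_ h1 h2
      ((arr_unit_left_a P Q df cf s2 t2 s0 t0).2 ?_) ?_
    · refine (congrArg N.arr.dom h1).trans ?_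
      simp (maxDischargeDepth := 8) [df, cf]
      rfl
    · rw [tP, tQ, eh, e2, e0]; exact h.unit_left
    -- The unit axioms end at the square `X`.
    · rw [h2, N.arr.tgt_hc]
      · simp [cf]; exact hi'
      · simp [cf]
  · obtain ⟨h1, h2⟩ := N.arr.unit_right_parallel P Q df cf s2 t2 s0 t0
    refine H.arr_ext hf' ?_ h1 h2
      ((arr_unit_right_a P Q df cf s2 t2 s0 t0).2 ?_) ?_
    · refine (congrArg N.arr.dom h1).trans ?_
      simp (maxDischargeDepth := 8) [df, cf]
      rfl
    · rw [tP, tQ, eh, e2, e0]; exact h.unit_right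
    · rw [h2, N.arr.tgt_hc]
      · simp [cf]; exact hi'
      · simp [cf]

end HasLifts

/-- The underlying 1-cell lifts to a square `X` by hypothesis. The structure 2-cells of `h` lift
because `χ` is monoidal, which turns `X` into a monoidal 1-cell of `arr N`; its bottom and filler
form the lift in `N.tenZero`. -/
theorem IsMonoidalLift.lift (H : HasLifts s N G) (hF : IsMonoidalLift s N G T F ρ)
    (hK : IsMonoidalLift s N G S K σ) (h : N.tenZero.Ar) (χ : N.tenZero.Ce)
    (hχ : IsMndOp (N := N.tenZero.toTwoCat) T S h χ) :
    ∃ X : Square N.tenZero, X.f = F ∧ X.g = K ∧ X.h = h ∧ IsCoherent s N.tenZero X.ξ ∧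
      IsModuleSquare T S ρ σ X χ := by
  obtain ⟨X, x1, x2, x3, x4, x5⟩ := H.lift hF.base hK.base _ _ hχ.under
  have d1 : (monArrow h).P = T.obA := hχ.dom_h
  have d2 : (monArrow h).Q = S.obA := hχ.cod_h
  have q1 : (monTrans χ).F = (monArrow h).comp T.arT (d1.trans T.arT_Q.symm) :=
    hχ.src_χ.trans (tenZero_comp _)
  have q2 : (monTrans χ).G = S.arT.comp (monArrow h) (S.arT_P.trans d2.symm) :=
    hχ.tgt_χ.trans (tenZero_comp _)
  have eP : (monArrow h).P = (monArrow F).P := d1.trans hF.P_eq.symm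
  have eQ : (monArrow h).Q = (monArrow K).P := d2.trans hK.P_eq.symm
  have e2 : (monArrow K).sqm.f = (X.tensor X).g := by simp [MonArrow.sqm, Square.tensor, x2]
  have f1 : N.src (monTrans χ).ω = N.comp (monArrow h).f T.arT.f := by
    rw [MonTrans.src_ω, q1]; rfl
  have f2 : N.tgt (monTrans χ).ω = N.comp S.arT.f (monArrow h).f := by
    rw [MonTrans.tgt_ω, q2]; rfl
  have f3 : N.dom (monArrow h).f = T.obA.A := by simp [d1]
  have f4 : N.cod (monArrow h).f = S.obA.A := by simp [d2]
  -- A 2-cell over `h.φ₂`, from `X ⊗ X` followed by the multiplication square of `K` to the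
  -- multiplication square of `F` followed by `X`. Its bottom will be the binary part of the lifted
  -- 1-cell.
  obtain ⟨c2, c21, c22, c23⟩ := H.exists_cell _ _ (by
      simpa [Square.comp, Square.tensor, x1] using H.tensor hF.base hF.base)
    ((hK.binary H).comp (x5.tensor x5) e2) (x5.comp (hF.binary H) x1)
    (by simp [Square.comp, Square.tensor, MonArrow.sqm, x1])
    (by simp [Square.comp, MonArrow.sqm, x2])
    (Square.isInv_comp x1 x4.1 hF.bin.1) (monArrow h).φ₂
    (by simp [Square.comp, Square.tensor, MonArrow.sqm, x3, eQ])
    (by simp [Square.comp, MonArrow.sqm, x3, eP])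
    (by
      -- The binary axiom of `χ` says that `h.φ₂` is compatible with the two composite `Mnd_op`
      -- structures.
      have b := (monTrans χ).binary
      rw [q1, q2] at b
      simp only [MonArrow.comp, T.arT_P, S.arT_Q, d1, d2, N.t2_idn] at b
      simp only [Square.tensor, MonArrow.sqm, x3, hF.P_eq, hK.P_eq, MonadIn.tensor,
        MonadIn.under_t]
      rw [N.vc_assoc, b, N.vc_assoc] <;>
        simp (maxDischargeDepth := 8) [f1, f2, f3, f4, N.comp_assoc, N.t1_comp, T.dom_arT,
          T.cod_arT, S.dom_arT, S.cod_arT, T.src_arTφ₂,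
          T.tgt_arTφ₂, S.src_arTφ₂, S.tgt_arTφ₂, d1, d2])
  -- The nullary analogue over `h.φ₀`, with domain the free 1-cell on the unit.
  obtain ⟨c0, c01, c02, c03⟩ := H.exists_cell _ _ H.unit
    (hK.nullary H) (x5.comp (hF.nullary H) x1) rfl
    (by simp [Square.comp, MonArrow.squ, x2])
    (Square.isInv_comp x1 x4.1 hF.nul.1) (monArrow h).φ₀
    (by simp [MonArrow.squ, eQ])
    (by simp [Square.comp, MonArrow.squ, x3, eP])
    (by
      have b := (monTrans χ).nullary
      rw [q1, q2] at b
      simp only [MonArrow.comp, T.arT_P, S.arT_Q, d1, d2] at b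
      simp only [MonArrow.squ, x3, hF.P_eq, MonadIn.trivial,
        MonadIn.under_t]
      rw [N.hc_one_of _ _ (by simp [d2]), N.vc_assoc, b] <;>
        simp (maxDischargeDepth := 8) [f1, f3, N.comp_assoc, T.dom_arT, T.cod_arT, T.src_arTφ₀,
          T.tgt_arTφ₀, d1])
  obtain ⟨L, l1, l2, rfl, l4⟩ := H.exists_monArrow (monArrow F) (monArrow K) (monArrow h) hF.base
    eP eQ X x1 x2 x3 x4.1 hF.bin.1 c2 c0 c21 c22 c23 c01 c02 c03
  have r1 : L.bot.P = (monArrow F).Q := by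
    change L.P.bot = _
    rw [l1, Pseudomonoid.bot_ofMonArrow]
  have r2 : L.bot.Q = (monArrow K).Q := by
    change L.Q.bot = _
    rw [l2, Pseudomonoid.bot_ofMonArrow]
  have r3 : L.filler.F = L.bot.comp (monArrow F) r1 := by
    simp only [MonArrow.filler, l1, Pseudomonoid.toMonArrow_ofMonArrow]
  have r4 : L.filler.G = (monArrow K).comp (monArrow h) eQ.symm := by
    simp only [MonArrow.filler, l2, l4, Pseudomonoid.toMonArrow_ofMonArrow]
  let Y : Square N.tenZero :=
    ⟨F, K, h, L.bot, L.filler, eP, eQ, r1, r2, r3.trans (tenZero_comp _).symm,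
      r4.trans (tenZero_comp _).symm⟩
  refine ⟨Y, rfl, rfl, rfl, IsCoherent.tenZero x4, hF.action, hK.action, hχ.src_χ, hχ.tgt_χ, ?_⟩
  have sY := Y.src_ξ
  have tY := Y.tgt_ξ
  have a1 := hF.action.dom_f
  have a2 := hF.action.src_ρ
  have a3 := hF.action.tgt_ρ
  have a4 := hK.action.dom_f
  have a5 := hK.action.src_ρ
  have a6 := hK.action.tgt_ρ
  have a7 := hχ.src_χ
  have a8 := hχ.tgt_χ
  have a9 := hχ.dom_h
  have a10 := hχ.cod_h
  have dk : N.tenZero.dom Y.k = N.tenZero.cod F := Y.dom_k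
  have ck : N.tenZero.cod Y.k = N.tenZero.cod K := Y.cod_k
  change N.tenZero.src Y.ξ = N.tenZero.comp Y.k F at sY
  change N.tenZero.tgt Y.ξ = N.tenZero.comp K h at tY
  change N.tenZero.vc Y.ξ (N.tenZero.hc (N.tenZero.idn Y.k) ρ) =
    N.tenZero.vc (N.tenZero.hc σ (N.tenZero.idn h)) (N.tenZero.vc
      (N.tenZero.hc (N.tenZero.idn K) χ) (N.tenZero.hc Y.ξ (N.tenZero.idn T.t)))
  -- Monoidal 2-cells with equal boundaries are compared on underlying 2-cells, where equivariance
  -- is that of the underlying square, already known.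
  refine monTrans_ext ?_ ?_ ?_
  · simp (maxDischargeDepth := 8) [sY, tY, a1, a2, a3, a4, a5, a7, a8, a9, a10, dk,
      N.tenZero.comp_assoc]
  · simp (maxDischargeDepth := 8) [sY, tY, a1, a2, a3, a4, a5, a6, a7, a8, a9, a10, dk,
      N.tenZero.comp_assoc]
  · rw [monTrans_vc_ω, monTrans_vc_ω, monTrans_vc_ω, monTrans_hc_ω, monTrans_hc_ω, monTrans_hc_ω,
      monTrans_hc_ω]
    · have q := x5.comm
      rw [x2, x3] at q
      exact q
    all_goals simp (maxDischargeDepth := 8) [sY, tY, a1, a2, a3, a4, a5, a7, a8, a9, a10, dk,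
      N.tenZero.comp_assoc]

end


/-! ### Induction on `p` -/

theorem HasLifts.tenZero {s : Prop} {N : SM2Cat.{u}} {G : MonadIn N.toTwoCat → N.Ar → N.Ce → Prop}
    (H : HasLifts s N G) : HasLifts s N.tenZero (IsMonoidalLift s N G) where
  action h := h.action
  exists_free := IsMonoidalLift.exists_free H
  full h := h.full H
  faithful h := h.faithful H
  lift h h' := h.lift H h'
  tensor h h' := h.tensor H h'
  unit := IsMonoidalLift.unit H

/-- The free 1-cells with their actions in `M_{p0}`, obtained from those in `M`. -/
def IsOidalLift (s : Prop) (M : SM2Cat.{u}) (G : MonadIn M.toTwoCat → M.Ar → M.Ce → Prop) :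
    (p : ℕ) → MonadIn (M.oidal p).toTwoCat → (M.oidal p).Ar → (M.oidal p).Ce → Prop
  | 0 => G
  | p + 1 => IsMonoidalLift s (M.oidal p) (IsOidalLift s M G p)

theorem HasLifts.oidal {s : Prop} {M : SM2Cat.{u}}
    {G : MonadIn M.toTwoCat → M.Ar → M.Ce → Prop} (H : HasLifts s M G) :
    ∀ p, HasLifts s (M.oidal p) (IsOidalLift s M G p)
  | 0 => H
  | p + 1 => (H.oidal p).tenZero

namespace IsOidalLift
variable {s : Prop} {M : SM2Cat.{u}} {G : MonadIn M.toTwoCat → M.Ar → M.Ce → Prop}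

theorem base : ∀ (p : ℕ) {T : MonadIn (M.oidal p).toTwoCat} {F : (M.oidal p).Ar}
    {ρ : (M.oidal p).Ce}, IsOidalLift s M G p T F ρ →
    G (M.baseMonad p T) (M.base1 p F) (M.base2 p ρ)
  | 0, _, _, _, h => h
  | p + 1, _, _, _, h => base p (IsMonoidalLift.base h)

theorem isStrong : ∀ (p : ℕ) {T : MonadIn (M.oidal p).toTwoCat} {F : (M.oidal p).Ar}
    {ρ : (M.oidal p).Ce}, IsOidalLift s M G p T F ρ → M.IsStrong p F
  | 0, _, _, _, _ => True.intro
  | p + 1, _, _, _, h => ⟨isStrong p (IsMonoidalLift.base h), h.bin.1, h.nul.1⟩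

theorem isStrict (hs : s) : ∀ (p : ℕ) {T : MonadIn (M.oidal p).toTwoCat} {F : (M.oidal p).Ar}
    {ρ : (M.oidal p).Ce}, IsOidalLift s M G p T F ρ → M.IsStrict p F
  | 0, _, _, _, _ => True.intro
  | p + 1, _, _, _, h => ⟨isStrict hs p (IsMonoidalLift.base h), h.bin.2 hs, h.nul.2 hs⟩

end IsOidalLift

theorem base0_cod (M : SM2Cat.{u}) : ∀ (p : ℕ) (F : (M.oidal p).Ar),
    M.base0 p ((M.oidal p).cod F) = M.cod (M.base1 p F)
  | 0, _ => rfl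
  | p + 1, F => by
    have h : (M.oidal p).cod (monArrow (N := M.oidal p) F).f =
      (monArrow (N := M.oidal p) F).Q.A := MonArrow.cod_f _
    exact (congrArg (M.base0 p) h.symm).trans (base0_cod M p _)

end SM2Cat

/-! ### Base case: the counit as a coequalizer -/

theorem IsCoeq.epi {N : TwoCat.{u}} {a b π κ κ' : N.Ce} (h : IsCoeq N a b π)
    (h1 : N.src κ = N.tgt π) (h2 : N.src κ' = N.tgt π) (h3 : N.tgt κ = N.tgt κ')
    (e : N.vc κ π = N.vc κ' π) : κ = κ' := by
  have hb : N.src π = N.tgt b := h.src_π.trans h.tgt_eq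
  obtain ⟨z, -, hz⟩ := h.desc (N.vc κ π) (by rw [N.src_vc _ _ h1, h.src_π])
    (by rw [N.vc_assoc _ _ _ h1 h.src_π, N.vc_assoc _ _ _ h1 hb, h.comm])
  rw [hz κ ⟨h1, by rw [N.tgt_vc _ _ h1], rfl⟩, hz κ' ⟨h2, by rw [N.tgt_vc _ _ h1, h3], e.symm⟩]

namespace EMConstruction
variable {M : SM2Cat.{u}} (E : EMConstruction M.toTwoCat) (T : MonadIn M.toTwoCat)

theorem dom_free : M.dom (E.free T) = T.A := (E.free_spec T).1
theorem cod_free : M.cod (E.free T) = E.obj T := (E.free_spec T).2.1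
theorem comp_u_free : M.comp (E.u T) (E.free T) = T.t := (E.free_spec T).2.2.1
theorem θ_free : M.hc (E.θ T) (M.idn (E.free T)) = T.μ := (E.free_spec T).2.2.2
theorem cod_u : M.cod (E.u T) = T.A := (E.action T).cod_g
theorem src_θ : M.src (E.θ T) = M.comp T.t (E.u T) := (E.action T).src_φ
theorem tgt_θ : M.tgt (E.θ T) = E.u T := (E.action T).tgt_φ
theorem src_counit : M.src (E.counit T) = M.comp (E.free T) (E.u T) :=
  (E.exists_counit T).choose_spec.1
theorem tgt_counit : M.tgt (E.counit T) = M.one (E.obj T) := (E.exists_counit T).choose_spec.2.1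
theorem u_counit : M.hc (M.idn (E.u T)) (E.counit T) = E.θ T :=
  (E.exists_counit T).choose_spec.2.2

attribute [simp] dom_free cod_free comp_u_free θ_free cod_u src_θ tgt_θ src_counit tgt_counit
  u_counit EMConstruction.dom_u

@[simp] theorem hc_u_free : M.hc (M.idn (E.u T)) (M.idn (E.free T)) = M.idn T.t := by
  rw [← M.idn_comp] <;> simp

@[simp] theorem comp_u_free_assoc (x : M.Ar) (h : M.cod x = T.A) :
    M.comp (E.u T) (M.comp (E.free T) x) = M.comp T.t x := by
  rw [← M.comp_assoc] <;> simp [h]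

@[simp] theorem hc_u_free_assoc (x : M.Ce) (h : M.cod (M.src x) = T.A) :
    M.hc (M.idn (E.u T)) (M.hc (M.idn (E.free T)) x) = M.hc (M.idn T.t) x := by
  rw [← M.hc_assoc] <;> simp [h]

@[simp] theorem hc_θ_free_assoc (x : M.Ce) (h : M.cod (M.src x) = T.A) :
    M.hc (E.θ T) (M.hc (M.idn (E.free T)) x) = M.hc T.μ x := by
  rw [← M.hc_assoc] <;> simp [h]

@[simp] theorem u_counit_assoc (x : M.Ce) (h : M.cod (M.src x) = E.obj T) :
    M.hc (M.idn (E.u T)) (M.hc (E.counit T) x) = M.hc (E.θ T) x := by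
  rw [← M.hc_assoc] <;> simp [h]

/-- By the exchange law `u.κ` is always a map of actions, so the uniqueness in the 2-dimensional
universal property makes `u^t` faithful on 2-cells. -/
theorem cell_ext {κ κ' : M.Ce} (h1 : M.src κ = M.src κ') (h2 : M.tgt κ = M.tgt κ')
    (h3 : M.cod (M.src κ) = E.obj T)
    (e : M.hc (M.idn (E.u T)) κ = M.hc (M.idn (E.u T)) κ') : κ = κ' := by
  obtain ⟨z, -, hz⟩ := E.lift_two T (M.src κ) (M.tgt κ) (M.hc (M.idn (E.u T)) κ)
    (by simp) h3 (by simp [h3]) ⟨by simp [h3], by simp [h3], by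
      have x := M.exchange (E.θ T) κ (by simp [h3])
      simp (maxDischargeDepth := 8) [M.idn_comp, M.hc_assoc, h3] at x ⊢
      exact x.symm⟩
  rw [hz κ ⟨rfl, rfl, rfl⟩, hz κ' ⟨h1.symm, h2.symm, e.symm⟩]

/-- One triangle identity of `f^t ⊣ u^t`: after applying the faithful `u^t` it is the right unit law
of the monad. -/
theorem counit_free_unit :
    M.vc (M.hc (E.counit T) (M.idn (E.free T))) (M.hc (M.idn (E.free T)) T.η) =
      M.idn (E.free T) := by
  refine E.cell_ext T ?_ ?_ ?_ ?_
  · simp (maxDischargeDepth := 8) [M.comp_assoc]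
  · simp (maxDischargeDepth := 8) [M.comp_assoc]
  · simp (maxDischargeDepth := 8) [M.comp_assoc]
  · rw [M.w_hc_vc] <;> simp (maxDischargeDepth := 8) [M.comp_assoc, T.unit_right]

/-- Both sides are the horizontal composite of the counit with itself. -/
theorem counit_counit :
    M.vc (E.counit T) (M.hc (M.idn (M.comp (E.free T) (E.u T))) (E.counit T)) =
      M.vc (E.counit T) (M.hc (E.counit T) (M.idn (M.comp (E.free T) (E.u T)))) := by
  have x := M.exchange (E.counit T) (E.counit T) (by simp)
  simp at x
  exact x

theorem counit_counit_free :
    M.vc (M.hc (E.counit T) (M.idn (E.free T))) (M.hc (M.idn (E.free T)) T.μ) =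
      M.vc (M.hc (E.counit T) (M.idn (E.free T)))
        (M.hc (E.counit T) (M.hc (M.idn (E.free T)) (M.idn T.t))) := by
  have x := congrArg (fun c => M.hc c (M.idn (E.free T))) (E.counit_counit T)
  simp (maxDischargeDepth := 8) [M.vc_hc_w, M.idn_comp, M.hc_assoc] at x
  exact x

theorem θ_unit : M.vc (E.θ T) (M.hc T.η (M.idn (E.u T))) = M.idn (E.u T) := (E.action T).unit

theorem linton₁_one : E.linton₁ T T (M.one T.A) =
    M.hc (M.idn (M.comp (E.free T) (E.u T))) (E.counit T) := by
  simp [linton₁]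

theorem linton₂_one : E.linton₂ T T (M.one T.A) (M.idn T.t) =
    M.hc (E.counit T) (M.idn (M.comp (E.free T) (E.u T))) := by
  simp [linton₂]
  rw [← M.idn_comp, ← M.idn_comp, M.vc_idn_of] <;> simp [M.comp_assoc]

/-- The counit is isomorphic to a Linton coequalizer. -/
theorem exists_linton_iso (hL : E.HasLinton) : ∃ π κ ι V, 
    E.IsLinton T T (M.one T.A) (M.idn T.t) π ∧ M.tgt π = V ∧ M.src κ = V ∧
    M.tgt κ = M.one (E.obj T) ∧ M.src ι = M.one (E.obj T) ∧ M.tgt ι = V ∧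
    M.vc κ π = E.counit T ∧ M.vc ι (E.counit T) = π ∧ M.vc κ ι = M.idn (M.one (E.obj T)) := by
  obtain ⟨π, hπ⟩ := hL T T (M.one T.A) (M.idn T.t) ⟨by simp, by simp, by simp, by simp,
    by simp [← M.idn_comp], by simp⟩
  have l1 := E.linton₁_one T
  have l2 := E.linton₂_one T
  -- The counit coequalizes the pair by `counit_counit`, hence factors through `π`. The rest of the
  -- proof inverts this comparison `κ`.
  obtain ⟨κ, ⟨k1, k2, k3⟩, -⟩ := hπ.coeq.desc (E.counit T) (by rw [l1]; simp) (by
    rw [l1, l2]; exact E.counit_counit T)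
  have sπ : M.src π = M.comp (E.free T) (E.u T) := by
    rw [hπ.coeq.src_π, l1]; simp
  obtain ⟨V, hV⟩ : ∃ V, V = M.tgt π := ⟨_, rfl⟩
  have dV : M.dom V = E.obj T := by rw [hV, M.dom_tgt, sπ]; simp
  have cV : M.cod V = E.obj T := by rw [hV, M.cod_tgt, sπ]; simp
  rw [tgt_counit] at k2
  have c1 := hπ.coeq.comm
  rw [l1, l2] at c1
  have hu := hπ.left (E.u T) (by simp)
  rw [← hV] at k1
  have tπ := hV.symm
  -- After applying `u^t` the pair is split by the unit `η`, with coequalizer `u.ε = θ`; `w` is the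
  -- resulting candidate for the inverse of `u.κ`.
  obtain ⟨w, hw⟩ : ∃ w, w = M.vc (M.hc (M.idn (E.u T)) π) (M.hc T.η (M.idn (E.u T))) := ⟨_, rfl⟩
  have sw : M.src w = E.u T := by simp (maxDischargeDepth := 8) [hw, sπ]
  have tw : M.tgt w = M.comp (E.u T) V := by simp (maxDischargeDepth := 8) [hw, sπ, tπ]
  have w1 : M.vc (M.hc (M.idn (E.u T)) κ) w = M.idn (E.u T) := by
    rw [hw, ← M.vc_assoc, ← M.w_hc_vc, k3, u_counit, θ_unit] <;> simp [k1, sπ, tπ, cV]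
  have w2 : M.vc w (M.hc (M.idn (E.u T)) κ) = M.idn (M.comp (E.u T) V) := by
    -- Tested on `u.π`, which is a coequalizer because Linton coequalizers are preserved by
    -- composition with `u^t`.
    refine hu.epi ?_ ?_ ?_ ?_
    · simp [k1, sπ, tπ, cV, k2, sw]
    · simp [sπ, tπ]
    · simp [k1, cV, k2, sw, tw]
    · rw [M.vc_assoc, ← M.w_hc_vc, k3, u_counit, hw, M.vc_assoc]
      · have x := M.exchange T.η (E.θ T) (by simp)
        have c2 := congrArg (fun c => M.hc (M.idn (E.u T)) c) c1
        have c3 := congrArg (fun c => M.hc c (M.idn (E.u T))) T.unit_left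
        simp (maxDischargeDepth := 8) [M.w_hc_vc, M.vc_hc_w, M.idn_comp, M.hc_assoc, sπ,
          M.comp_assoc] at x c2 c3
        rw [x, M.vc_congr2 c2, c3, ← M.idn_comp, vc_idn_of, idn_vc_of] <;>
          simp (maxDischargeDepth := 8) [sπ, tπ, M.comp_assoc]
      all_goals simp (maxDischargeDepth := 8) [k1, k2, sπ, tπ, cV, sw]
  have x := M.exchange (E.θ T) κ (by simp [k1, cV])
  simp only [k1, k2, src_θ, tgt_θ] at x
  -- As the inverse of `u.κ`, which is a map of actions by the exchange law, `w` is a map of actions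
  -- too, and therefore lifts along `u^t`.
  have w3 : M.vc w (E.θ T) = M.vc (M.hc (E.θ T) (M.idn V)) (M.hc (M.idn T.t) w) := by
    have y : M.vc (M.hc (M.idn T.t) (M.hc (M.idn (E.u T)) κ)) (M.hc (M.idn T.t) w) =
        M.idn (M.comp T.t (E.u T)) := by
      rw [← M.w_hc_vc, w1, ← M.idn_comp] <;>
        simp (maxDischargeDepth := 8) [k1, cV, sw, tw]
    have q := M.vc_idn_of (E.θ T) (M.comp T.t (E.u T)) (by simp)
    simp (maxDischargeDepth := 8) [M.idn_comp, M.hc_assoc, k1, cV] at x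
    rw [← y, ← M.vc_assoc (E.θ T), x, M.vc_assoc] at q
    · refine (congrArg (M.vc w) q.symm).trans ?_
      rw [← M.vc_assoc w, w2, idn_vc_of] <;>
        simp (maxDischargeDepth := 8) [k1, k2, cV, sw, tw, M.comp_assoc]
    all_goals simp (maxDischargeDepth := 8) [k1, k2, cV, sw, tw, M.comp_assoc]
  obtain ⟨ι, ⟨i1, i2, i3⟩, -⟩ := E.lift_two T (M.one (E.obj T)) V w (by simp [dV]) (by simp) cV
    ⟨by simp [sw], tw, by simpa using w3⟩
  refine ⟨π, κ, ι, V, hπ, tπ, k1, k2, i1, i2, k3, ?_, ?_⟩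
  · have q : M.vc ι κ = M.idn V := by
      refine E.cell_ext T ?_ ?_ ?_ ?_
      · simp [i1, k2, k1]
      · simp [i1, i2, k2]
      · simp [i1, k2, k1, cV]
      · rw [M.w_hc_vc, i3, w2, M.idn_comp] <;> simp [i1, k2, k1, cV]
    rw [← k3, ← M.vc_assoc, q, idn_vc_of] <;> simp [i1, k2, k1, tπ]
  · refine E.cell_ext T ?_ ?_ ?_ ?_
    · simp [i1, i2, k1]
    · simp [i2, k2, k1]
    · simp [i1, i2, k1]
    · rw [M.w_hc_vc, i3, w1] <;> simp [i1, i2, k1]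

end EMConstruction

/-! ### Base case: precomposition with the free 1-cell is fully faithful -/

namespace EMConstruction
variable {M : SM2Cat.{u}} (E : EMConstruction M.toTwoCat) (T : MonadIn M.toTwoCat)

/-- The uniqueness half of the coequalizer property of `z.ε`, transported from `z.π` along the
comparison; `counit_desc` is the existence half. Neither would follow for general `z` without
preservation of `π`. -/
theorem counit_epi (hL : E.HasLinton) {κ κ' : M.Ce} {z : M.Ar} (hz : M.dom z = E.obj T)
    (h1 : M.src κ = z) (h2 : M.src κ' = z) (h3 : M.tgt κ = M.tgt κ')
    (e : M.vc κ (M.hc (M.idn z) (E.counit T)) = M.vc κ' (M.hc (M.idn z) (E.counit T))) :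
    κ = κ' := by
  obtain ⟨π, γ, ι, V, hπ, tπ, k1, k2, i1, i2, e1, e2, e3⟩ := E.exists_linton_iso T hL
  have hl := hπ.left z hz
  have sπ : M.src π = M.comp (E.free T) (E.u T) := by
    rw [hπ.coeq.src_π, linton₁_one]; simp
  have cV : M.cod V = E.obj T := by rw [← tπ, M.cod_tgt, sπ]; simp
  -- Cancelling the epimorphism `z.π` leaves an equality precomposed with `z.γ`, which is undone by
  -- its section `z.ι`.
  have q : M.vc κ (M.hc (M.idn z) γ) = M.vc κ' (M.hc (M.idn z) γ) := by
    refine hl.epi ?_ ?_ ?_ ?_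
    · simp [h1, k1, k2, hz, cV, sπ, tπ]
    · simp [h2, k1, k2, hz, cV, sπ, tπ]
    · simp [h1, h2, h3, k1, k2, hz, cV]
    · rw [M.vc_assoc, M.vc_assoc, ← M.w_hc_vc, e1, e] <;> simp [h1, h2, k1, k2, hz, cV, sπ, tπ]
  have q' := congrArg (fun c => M.vc c (M.hc (M.idn z) ι)) q
  rw [M.vc_assoc, M.vc_assoc, ← M.w_hc_vc, e3, ← M.idn_comp, vc_idn_of, vc_idn_of] at q'
  · exact q'
  all_goals simp [h1, h2, k1, k2, i1, i2, hz, cV]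

theorem counit_desc (hL : E.HasLinton) {ψ : M.Ce} {z : M.Ar} (hz : M.dom z = E.obj T)
    (h1 : M.src ψ = M.comp z (M.comp (E.free T) (E.u T)))
    (e : M.vc ψ (M.hc (M.idn z) (M.hc (M.idn (M.comp (E.free T) (E.u T))) (E.counit T))) =
      M.vc ψ (M.hc (M.idn z) (M.hc (E.counit T) (M.idn (M.comp (E.free T) (E.u T)))))) :
    ∃ κ, M.src κ = z ∧ M.tgt κ = M.tgt ψ ∧ M.vc κ (M.hc (M.idn z) (E.counit T)) = ψ := by
  obtain ⟨π, γ, ι, V, hπ, tπ, k1, k2, i1, i2, e1, e2, e3⟩ := E.exists_linton_iso T hL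
  have hl := hπ.left z hz
  have sπ : M.src π = M.comp (E.free T) (E.u T) := by
    rw [hπ.coeq.src_π, linton₁_one]; simp
  have cV : M.cod V = E.obj T := by rw [← tπ, M.cod_tgt, sπ]; simp
  rw [linton₁_one, linton₂_one] at hl
  obtain ⟨κ, ⟨a1, a2, a3⟩, -⟩ := hl.desc ψ (by simp (maxDischargeDepth := 8) [h1, hz,
    M.comp_assoc]) e
  have a4 : M.src κ = M.comp z V := by rw [a1]; simp [hz, tπ, sπ]
  refine ⟨M.vc κ (M.hc (M.idn z) ι), ?_, ?_, ?_⟩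
  · simp [a4, i1, i2, hz]
  · simp [a4, i1, i2, hz, a2]
  · rw [M.vc_assoc, ← M.w_hc_vc, e2, a3] <;> simp [a4, i1, i2, hz]

/-- Precomposition with `u` is left adjoint to precomposition with `f`. The transpose `k.f.u → k'`
of an equivariant `ω` coequalizes the pair of which `k.ε` is the coequalizer, and so descends to
`k`. -/
theorem free_full (hL : E.HasLinton) (k k' : M.Ar) (ω : M.Ce) (hk : M.dom k = M.cod (E.free T))
    (hk' : M.dom k' = M.cod (E.free T)) (s1 : M.src ω = M.comp k (E.free T))
    (t1 : M.tgt ω = M.comp k' (E.free T))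
    (e : M.vc ω (M.hc (M.idn k) (M.hc (E.counit T) (M.idn (E.free T)))) =
      M.vc (M.hc (M.idn k') (M.hc (E.counit T) (M.idn (E.free T)))) (M.hc ω (M.idn T.t))) :
    ∃ κ, M.src κ = k ∧ M.tgt κ = k' ∧ M.hc κ (M.idn (E.free T)) = ω := by
  rw [cod_free] at hk hk'
  have ck : M.cod k' = M.cod k := by
    have := M.cod_tgt ω
    rw [s1, t1] at this
    simpa [hk, hk'] using this
  -- The transpose of `ω` under `f ⊣ u`.
  obtain ⟨ψ, hψ⟩ : ∃ ψ, ψ = M.vc (M.hc (M.idn k') (E.counit T)) (M.hc ω (M.idn (E.u T))) := ⟨_, rfl⟩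
  have sψ : M.src ψ = M.comp k (M.comp (E.free T) (E.u T)) := by
    simp (maxDischargeDepth := 8) [hψ, s1, t1, hk, hk', M.comp_assoc]
  have tψ : M.tgt ψ = k' := by
    simp (maxDischargeDepth := 8) [hψ, s1, t1, hk, hk', M.comp_assoc]
  obtain ⟨κ, k1, k2, k3⟩ := E.counit_desc T hL hk sψ (by
    have x1 := M.exchange ω (M.hc (M.idn (E.u T)) (E.counit T)) (by simp [s1, hk])
    have x2 := congrArg (fun c => M.hc (M.idn k') c) (E.counit_counit T)
    have x3 := congrArg (fun c => M.hc c (M.idn (E.u T))) e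
    simp (maxDischargeDepth := 8) [M.w_hc_vc, M.vc_hc_w, M.idn_comp, M.hc_assoc, s1, t1, hk, hk',
      hψ,
          M.comp_assoc, M.vc_assoc] at x1 x2 x3 ⊢
    rw [x1, x3, M.vc_congr2 x2]
    all_goals simp (maxDischargeDepth := 8) [s1, t1, hk, hk', M.comp_assoc])
  rw [tψ] at k2
  refine ⟨κ, k1, k2, ?_⟩
  -- Transposing back: whisker with `f` and precompose with the unit. The triangle identity reduces
  -- one side to `κ.f`; equivariance of `ω` together with the triangle identity reduces the other to
  -- `ω`.
  have x1 := congrArg (fun c => M.vc (M.hc c (M.idn (E.free T)))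
    (M.hc (M.idn k) (M.hc (M.idn (E.free T)) T.η))) k3
  have x2 := congrArg (fun c => M.hc (M.idn k) c) (E.counit_free_unit T)
  simp (maxDischargeDepth := 8) [M.w_hc_vc, M.vc_hc_w, M.hc_assoc, s1, t1, k1, hk, hk', hψ,
          M.comp_assoc, M.vc_assoc] at x1 x2
  rw [x2, ← M.idn_comp, vc_idn_of] at x1
  · rw [x1, ← M.vc_assoc, ← e, M.vc_assoc, x2, ← M.idn_comp, vc_idn_of]
    all_goals simp (maxDischargeDepth := 8) [s1, t1, hk, hk', M.comp_assoc]
  all_goals simp (maxDischargeDepth := 8) [k1, hk]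

/-- By the exchange law `κ ∙ (k.ε)` depends only on `κ.f`, and `k.ε` is epi. -/
theorem free_faithful (hL : E.HasLinton) (κ κ' : M.Ce) (h1 : M.src κ = M.src κ')
    (h2 : M.tgt κ = M.tgt κ') (h3 : M.dom (M.src κ) = M.cod (E.free T))
    (e : M.hc κ (M.idn (E.free T)) = M.hc κ' (M.idn (E.free T))) : κ = κ' := by
  rw [cod_free] at h3
  refine E.counit_epi T hL h3 rfl h1.symm h2 ?_
  have x := M.exchange κ (E.counit T) (by simp [h3])
  have x' := M.exchange κ' (E.counit T) (by simp [← h1, h3])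
  simp (maxDischargeDepth := 8) [← h1, h3, M.idn_comp, ← M.hc_assoc, e] at x x'
  rw [x, x', h2]

end EMConstruction

/-! ### Base case: lifting 1-cells of `Mnd_op` by Linton coequalizers -/

namespace EMConstruction
variable {M : SM2Cat.{u}} (E : EMConstruction M.toTwoCat) {T S : MonadIn M.toTwoCat}

theorem isRightAction_free (T : MonadIn M.toTwoCat) : IsRightAction T (E.free T)
    (M.hc (E.counit T) (M.idn (E.free T))) where
  dom_f := E.dom_free T
  src_ρ := by simp (maxDischargeDepth := 8) [M.comp_assoc]
  tgt_ρ := by simp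

/-- Precomposed with `f^t`, the Linton pair becomes the pair of an action of `t` on `f^s.h`, which
the unit of `t` splits. The comparison from the preserved coequalizer `π.f^t` to that action is the
required filler. -/
theorem exists_lift_square {h : M.Ar} {χ π : M.Ce} (hm : IsMndOp T S h χ)
    (hπ : E.IsLinton T S h χ π) (s : Prop)
    (hs : s → M.comp (M.tgt π) (E.free T) = M.comp (E.free S) h ∧ M.hc π (M.idn (E.free T)) =
      M.vc (M.hc (E.counit S) (M.idn (M.comp (E.free S) h))) (M.hc (M.idn (E.free S)) χ)) :
    ∃ X : Square M, X.f = E.free T ∧ X.g = E.free S ∧ X.h = h ∧ IsCoherent s M X.ξ ∧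
      IsModuleSquare T S (M.hc (E.counit T) (M.idn (E.free T)))
        (M.hc (E.counit S) (M.idn (E.free S))) X χ := by
  have dh := hm.dom_h
  have ch := hm.cod_h
  have sχ := hm.src_χ
  have tχ := hm.tgt_χ
  obtain ⟨V, tπ⟩ : ∃ V, M.tgt π = V := ⟨_, rfl⟩
  have sπ : M.src π = M.comp (E.free S) (M.comp h (E.u T)) := by
    rw [hπ.coeq.src_π]
    simp (maxDischargeDepth := 8) [linton₁, dh, ch]
  have dV : M.dom V = E.obj T := by rw [← tπ, M.dom_tgt, sπ]; simp [dh, ch]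
  have cV : M.cod V = E.obj S := by rw [← tπ, M.cod_tgt, sπ]; simp [dh, ch]
  -- The right action of `t` on `f^s.h` induced by `χ`; `aμ` and `aη` are its associativity and unit
  -- laws, from the two laws of `χ`.
  obtain ⟨a, ha⟩ : ∃ a, a = M.vc (M.hc (E.counit S) (M.idn (M.comp (E.free S) h)))
    (M.hc (M.idn (E.free S)) χ) := ⟨_, rfl⟩
  rw [← ha] at hs
  have sa : M.src a = M.comp (E.free S) (M.comp h T.t) := by
    simp (maxDischargeDepth := 8) [ha, sχ, tχ, dh, ch, M.comp_assoc]
  have ta : M.tgt a = M.comp (E.free S) h := by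
    simp (maxDischargeDepth := 8) [ha, sχ, tχ, dh, ch, M.comp_assoc]
  have aμ : M.vc a (M.hc (M.idn (E.free S)) (M.hc (M.idn h) T.μ)) =
      M.vc a (M.hc a (M.idn T.t)) := by
    have x1 := congrArg (fun c => M.hc (M.idn (E.free S)) c) hm.mul
    have x2 := M.exchange (E.counit S) (M.hc (M.idn (E.free S)) χ) (by simp [sχ, dh, ch])
    have x3 := congrArg (fun c => M.hc c (M.idn h)) (E.counit_counit_free S)
    simp (maxDischargeDepth := 8) [M.w_hc_vc, M.vc_hc_w, M.idn_comp, M.hc_assoc, M.vc_assoc,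
      M.comp_assoc, sχ, tχ, dh, ch, ha] at x1 x2 x3 ⊢
    rw [x1, M.vc_congr2 x3, M.vc_congr2 x2]
    all_goals simp (maxDischargeDepth := 8) [M.comp_assoc, sχ, tχ, dh, ch]
  have aη : M.vc a (M.hc (M.idn (E.free S)) (M.hc (M.idn h) T.η)) =
      M.idn (M.comp (E.free S) h) := by
    have x1 := congrArg (fun c => M.hc (M.idn (E.free S)) c) hm.unit
    have x2 := congrArg (fun c => M.hc c (M.idn h)) (E.counit_free_unit S)
    simp (maxDischargeDepth := 8) [M.w_hc_vc, M.vc_hc_w, M.idn_comp, M.hc_assoc, M.vc_assoc,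
      M.comp_assoc, sχ, tχ, dh, ch, ha] at x1 x2 ⊢
    rw [x1, x2]
  have l1 : M.hc (E.linton₁ T S h) (M.idn (E.free T)) =
      M.hc (M.idn (E.free S)) (M.hc (M.idn h) T.μ) := by
    simp (maxDischargeDepth := 8) [linton₁, M.idn_comp, M.hc_assoc, dh, ch]
  have l2 : M.hc (E.linton₂ T S h χ) (M.idn (E.free T)) = M.hc a (M.idn T.t) := by
    simp (maxDischargeDepth := 8) [linton₂, M.vc_hc_w, ha, M.idn_comp, M.hc_assoc, dh, ch, sχ, tχ,
      M.comp_assoc]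
  have hf := hπ.right (E.free T) (by simp)
  rw [l1, l2] at hf
  -- A second whiskering, by `f^t.t`, needed to test equivariance of the filler.
  have hft := hπ.right (M.comp (E.free T) T.t) (by simp)
  obtain ⟨ξ, ⟨ξ1, ξ2, ξ3⟩, -⟩ := hf.desc a (by
    simp (maxDischargeDepth := 8) [sa, dh, ch]) aμ
  have sξ : M.src ξ = M.comp V (E.free T) := by
    rw [ξ1]; simp (maxDischargeDepth := 8) [sπ, tπ, dh, ch]
  rw [ta] at ξ2
  let X : Square M := ⟨E.free T, E.free S, h, V, ξ, by simp [dh], by simp [ch], by simp [dV],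
    by simp [cV], sξ, ξ2⟩
  -- The inverse of `ξ` is `π.f^t` restricted along the section `f^s.h.η` of `a`.
  refine ⟨X, rfl, rfl, rfl, ⟨⟨M.vc (M.hc π (M.idn (E.free T)))
    (M.hc (M.idn (E.free S)) (M.hc (M.idn h) T.η)), ?_, ?_, ?_, ?_⟩, ?_⟩,
    E.isRightAction_free T, E.isRightAction_free S, sχ, tχ, ?_⟩
  · change _ = M.tgt ξ
    simp (maxDischargeDepth := 8) [ξ2, sπ, dh, ch, M.comp_assoc]
  · change _ = M.src ξ
    simp (maxDischargeDepth := 8) [sξ, sπ, tπ, dh, ch, M.comp_assoc]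
  · change M.vc _ ξ = M.idn (M.src ξ)
    refine hf.epi ?_ ?_ ?_ ?_
    · simp (maxDischargeDepth := 8) [ξ2, sξ, sπ, tπ, dh, ch, M.comp_assoc]
    · simp (maxDischargeDepth := 8) [sξ, sπ, tπ, dh, ch]
    · simp (maxDischargeDepth := 8) [ξ2, sξ, sπ, tπ, dh, ch, M.comp_assoc]
    -- Precomposing with `π.f^t` leaves `π.f^t ∙ (f^s.h.η) ∙ a`; the exchange law moves `a` past
    -- `η`, the coequalizing property replaces `a.t` by `f^s.h.μ`, and the unit law of `t` finishes.
    · have x1 := M.exchange a T.η (by simp [sa, dh, ch])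
      have x2 := hf.comm
      have x3 := congrArg (fun c => M.hc (M.idn (E.free S)) (M.hc (M.idn h) c)) T.unit_right
      simp (maxDischargeDepth := 8) [M.w_hc_vc, M.idn_comp, M.hc_assoc, dh, ch, sa, ta] at x1 x2 x3
      rw [M.vc_assoc, ξ3, M.vc_assoc, ← x1, M.vc_congr2 x2.symm, x3, ← M.idn_comp, ← M.idn_comp,
        vc_idn_of, idn_vc_of]
      all_goals simp (maxDischargeDepth := 8) [ξ2, sξ, sπ, tπ, dh, ch, sa, ta, M.comp_assoc]
  · change M.vc ξ _ = M.idn (M.tgt ξ)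
    rw [← M.vc_assoc, ξ3, aη, ξ2]
    all_goals simp (maxDischargeDepth := 8) [sξ, sπ, tπ, dh, ch, M.comp_assoc]
  -- With the strict choice `π.f^t = a`, both `ξ` and the identity factor `a` through `π.f^t`.
  · intro h
    obtain ⟨e1, e2⟩ := hs h
    rw [tπ] at e1
    change ξ = M.idn (M.src ξ)
    refine hf.epi ?_ ?_ ?_ ?_
    · simp (maxDischargeDepth := 8) [sξ, sπ, tπ, dh, ch]
    · simp (maxDischargeDepth := 8) [sξ, sπ, tπ, dh, ch]
    · simp [ξ2, sξ, e1]
    · rw [ξ3, e2, sξ, e1, idn_vc_of _ _ _ ta]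
  · change M.vc ξ (M.hc (M.idn V) _) = M.vc (M.hc _ (M.idn h)) (M.vc (M.hc (M.idn (E.free S)) χ)
      (M.hc ξ (M.idn T.t)))
    refine hft.epi ?_ ?_ ?_ ?_
    · simp (maxDischargeDepth := 8) [sξ, sπ, tπ, dh, ch, dV, M.comp_assoc]
    · simp (maxDischargeDepth := 8) [ξ2, sξ, sπ, tπ, dh, ch, dV, sχ, tχ, M.comp_assoc]
    · simp (maxDischargeDepth := 8) [ξ2, sξ, dh, ch, dV, sχ, tχ, M.comp_assoc]
    -- On the epimorphism `π.f^t.t`, equivariance of `ξ` turns into the associativity law `aμ`.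
    · have x1 := M.exchange π (M.hc (E.counit T) (M.idn (E.free T))) (by simp [sπ, dh, ch])
      have x2 := congrArg (fun c => M.hc c (M.idn T.t)) ξ3
      have ha' := ha
      simp (maxDischargeDepth := 8) [M.vc_hc_w, M.idn_comp, M.hc_assoc, M.vc_assoc,
        M.comp_assoc, sχ, tχ, dh, ch, dV, sξ, ξ2, sπ, tπ] at x1 x2 ha' ⊢
      rw [← x1, ← M.vc_assoc, ξ3, x2, ← M.vc_assoc, ← ha', aμ]
      all_goals simp (maxDischargeDepth := 8) [sξ, sπ, tπ, dh, ch, sa, ta, sχ, tχ, M.comp_assoc]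

/-- `free` and `counit` are obtained by choice, so identifying them for product and trivial monads
goes through uniqueness in the universal property. -/
theorem free_unique {T : MonadIn M.toTwoCat} {k : M.Ar} (h1 : M.dom k = T.A)
    (h2 : M.cod k = E.obj T) (h3 : M.comp (E.u T) k = T.t)
    (h4 : M.hc (E.θ T) (M.idn k) = T.μ) : k = E.free T := by
  obtain ⟨z, -, hz⟩ := E.lift_one T T.t T.μ
    ⟨T.cod_t, T.src_μ, T.tgt_μ, T.assoc.symm, T.unit_left⟩
  rw [hz k ⟨h1.trans T.dom_t.symm, h2, h3, h4⟩, hz (E.free T) ⟨by simp, by simp, by simp, by simp⟩]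

theorem counit_unique {T : MonadIn M.toTwoCat} {e : M.Ce}
    (h1 : M.src e = M.comp (E.free T) (E.u T)) (h2 : M.tgt e = M.one (E.obj T))
    (h3 : M.hc (M.idn (E.u T)) e = E.θ T) : e = E.counit T :=
  E.cell_ext T (by simp [h1]) (by simp [h2]) (by simp [h1]) (by simp [h3])

/-! ### Base case: compatibility with the monoidal product -/

namespace IsMonoidal
variable {E}

theorem free_tensor (hE : E.IsMonoidal) (T S : MonadIn M.toTwoCat) :
    M.t1 (E.free T) (E.free S) = E.free (T.tensor S) := by
  refine E.free_unique ?_ ?_ ?_ ?_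
  · simp [MonadIn.tensor]
  · simp [hE.obj_tensor]
  · rw [hE.u_tensor, ← M.t1_comp] <;> simp [MonadIn.tensor]
  · rw [hE.θ_tensor, ← M.t2_idn, ← M.t2_hc] <;> simp [MonadIn.tensor]

theorem counit_tensor (hE : E.IsMonoidal) (T S : MonadIn M.toTwoCat) :
    M.t2 (E.counit T) (E.counit S) = E.counit (T.tensor S) := by
  refine E.counit_unique ?_ ?_ ?_
  · rw [hE.u_tensor, ← hE.free_tensor, ← M.t1_comp] <;> simp
  · simp [hE.obj_tensor]
  · rw [hE.u_tensor, hE.θ_tensor, ← M.t2_idn, ← M.t2_hc] <;> simp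

theorem free_unit (hE : E.IsMonoidal) : M.one M.I = E.free (MonadIn.trivial M M.I) := by
  refine E.free_unique ?_ ?_ ?_ ?_
  · simp [MonadIn.trivial]
  · simp [hE.obj_unit]
  · rw [hE.u_unit]; simp [MonadIn.trivial]
  · rw [hE.θ_unit]; simp [MonadIn.trivial]

theorem counit_unit (hE : E.IsMonoidal) : M.idn (M.one M.I) = E.counit (MonadIn.trivial M M.I) := by
  refine E.counit_unique ?_ ?_ ?_
  · rw [hE.u_unit, ← hE.free_unit]; simp
  · simp [hE.obj_unit]
  · simp [hE.u_unit, hE.θ_unit]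

end IsMonoidal

/-! ### Conclusion -/

/-- The free 1-cell `f^t` with its action `ε^t.f^t`. -/
def IsFree (T : MonadIn M.toTwoCat) (f : M.Ar) (ρ : M.Ce) : Prop :=
  f = E.free T ∧ ρ = M.hc (E.counit T) (M.idn (E.free T))

theorem hasLifts (hE : E.IsMonoidal) (hL : E.HasLinton) (s : Prop) (hs : s → E.HasStrictLinton) :
    HasLifts s M E.IsFree where
  action := by
    rintro T f ρ ⟨rfl, rfl⟩
    exact E.isRightAction_free T
  exists_free T := ⟨_, _, rfl, rfl⟩
  full := by
    rintro T f ρ ⟨rfl, rfl⟩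
    exact E.free_full T hL
  faithful := by
    rintro T f ρ ⟨rfl, rfl⟩
    exact E.free_faithful T hL
  lift := by
    rintro T f ρ S g σ ⟨rfl, rfl⟩ ⟨rfl, rfl⟩ h χ hm
    -- The strict choice of coequalizers is available only under `s`; otherwise any choice will do,
    -- and the identity requirement is vacuous.
    by_cases h0 : s
    · obtain ⟨π, h1, h2⟩ := hs h0 T S h χ hm
      exact E.exists_lift_square hm h1 s fun _ => h2
    · obtain ⟨π, h1⟩ := hL T S h χ hm
      exact E.exists_lift_square hm h1 s fun h => absurd h h0
  tensor := by
    rintro T f ρ S g σ ⟨rfl, rfl⟩ ⟨rfl, rfl⟩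
    refine ⟨hE.free_tensor T S, ?_⟩
    rw [← hE.free_tensor, ← hE.counit_tensor, ← M.t2_idn, ← M.t2_hc] <;> simp
  unit := by
    refine ⟨hE.free_unit, ?_⟩
    rw [← hE.free_unit, ← hE.counit_unit]
    simp

theorem isLifting_of_isOidalLift {s : Prop} (H : HasLifts s M E.IsFree) {p : ℕ}
    {T : MonadIn (M.oidal p).toTwoCat} {F : (M.oidal p).Ar} {ρ : (M.oidal p).Ce}
    (h : IsOidalLift s M E.IsFree p T F ρ) : IsLifting E p T ((M.oidal p).cod F) F := by
  have ha := (H.oidal p).action h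
  obtain ⟨b1, b2⟩ := h.base
  refine ⟨ha.dom_f, rfl, ?_, b1, ρ, ha.src_ρ, ha.tgt_ρ, b2⟩
  rw [base0_cod, b1, cod_free]

end EMConstruction

theorem mainTheorem4 (M : SM2Cat.{u}) (E : EMConstruction M.toTwoCat) (hE : E.IsMonoidal)
    (hL : E.HasLinton) (p : ℕ) (T : SM2Cat.MonadIn (M.oidal p).toTwoCat) :
    (∃ (B : (M.oidal p).Ob) (F : (M.oidal p).Ar), IsLifting E p T B F ∧ M.IsStrong p F) ∧
    (E.HasStrictLinton →
      ∃ (B : (M.oidal p).Ob) (F : (M.oidal p).Ar), IsLifting E p T B F ∧ M.IsStrict p F) := by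
  constructor
  -- With the switch off, coherent means invertible, which gives a strong lift.
  · have H := E.hasLifts hE hL False False.elim
    obtain ⟨F, ρ, h⟩ := (H.oidal p).exists_free T
    exact ⟨_, F, E.isLifting_of_isOidalLift H h, h.isStrong⟩
  · intro hS
    -- With the switch on, every structure 2-cell is an identity, which gives a strict lift.
    have H := E.hasLifts hE hL True fun _ => hS
    obtain ⟨F, ρ, h⟩ := (H.oidal p).exists_free T
    exact ⟨_, F, E.isLifting_of_isOidalLift H h, h.isStrict True.intro⟩
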